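/- Let $\mathcal{M}=(S,\mathit{Act},P,\mathit{init})$ be a finite Markov decision process (MDP): $S$ and $\mathit{Act}$ are finite, $\mathit{init}\in S$, and $P:S\times\mathit{Act}\times S\to[0,1]$ satisfies $\sum_{t}P(s,\alpha,t)\in\{0,1\}$ for all $s,\alpha$. The action $\alpha$ is enabled in $s$ if this sum is $1$, and $s$ is terminal if no action is enabled in $s$. A policy maps each finite path ending in a non-terminal state to a distribution over the actions enabled in that state (policies may be randomized and history-dependent). $\mathrm{Pr}^{\mathfrak{S}}_{\mathcal{M},s}$ denotes the probability measure on maximal paths induced by the policy $\mathfrak S$ with initial state $s$, $\mathrm{Pr}^{\mathfrak{S}}_{\mathcal{M}}=\mathrm{Pr}^{\mathfrak{S}}_{\mathcal{M},\mathit{init}}$, and $\lozenge T$ is the event that $T$ is visited (at time $0$ or later). Let $E\subseteq S$ be a set of terminal states and let $C\subseteq S\setminus E$. For a policy $\mathfrak{S}$ of $\mathcal{M}$ let $$\mathit{tp}^{\mathfrak S}=\mathrm{Pr}^{\mathfrak S}_{\mathcal M}(\lozenge C\wedge\lozenge E),\quad \mathit{fp}^{\mathfrak S}=\mathrm{Pr}^{\mathfrak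 S}_{\mathcal M}(\lozenge C\wedge\neg\lozenge E),\quad \mathit{fn}^{\mathfrak S}=\mathrm{Pr}^{\mathfrak S}_{\mathcal M}(\neg\lozenge C\wedge\lozenge E),\quad \mathit{tn}^{\mathfrak S}=\mathrm{Pr}^{\mathfrak S}_{\mathcal M}(\neg\lozenge C\wedge\neg\lozenge E).$$ The canonical MDP $\mathcal{N}$ of $\mathcal{M}$ with respect to $C$ and $E$ is obtained as follows. (i) For each $c\in C$ delete all outgoing transitions of $c$ and add two fresh actions $\alpha_{\min},\alpha_{\max}$, which lead to a fresh terminal state $\mathit{TP}$ with probability $p_{c,\min}=\inf_{\mathfrak S}\mathrm{Pr}^{\mathfrak S}_{\mathcal M,c}(\lozenge E)$ and $p_{c,\max}=\sup_{\mathfrak S}\mathrm{Pr}^{\mathfrak S}_{\mathcal M,c}(\lozenge E)$, respectively, and with the remaining probability to a fresh terminal state $\mathit{FP}$. (ii) In the resulting MDP, collapse each maximal end component $\mathcal{E}$ (an inclusion-maximal strongly connected sub-MDP with at least one state-action pair) into a single state $s_{\mathcal E}$. The actions enabled in $s_{\mathcal E}$ are the pairs $(s,\alpha)$ where $s$ is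 a state of $\mathcal{E}$ and $\alpha$ is enabled in $s$, but $(s,\alpha)$ does not belong to $\mathcal E$; all transition probabilities are inherited, with the probabilities of moving to states that are collapsed into the same state being added up. (iii) Collapse all states of $E$ into a state $\mathit{FN}$ and all other terminal states, except $\mathit{TP}$, $\mathit{FP}$ and the states $s_{\mathcal{E}}$, into a state $\mathit{TN}$ (both states are present and terminal). In every state $s_{\mathcal E}$ enable a fresh action $\tau$ that leads to $\mathit{TN}$ with probability $1$. The initial state of $\mathcal{N}$ is the state into which $\mathit{init}$ is collapsed. Then for every policy $\mathfrak S$ of $\mathcal M$ there is a policy $\mathfrak U$ of $\mathcal N$, and conversely for every policy $\mathfrak U$ of $\mathcal N$ there is a policy $\mathfrak S$ of $\mathcal M$, such that $$\mathit{tp}^{\mathfrak S}=\mathrm{Pr}^{\mathfrak U}_{\mathcal N}(\lozenge\mathit{TP}),\qquad \mathit{fp}^{\mathfrak S}=\mathrm{Pr}^{\mathfrak U}_{\mathcal N}(\lozenge\mathit{FP}),\qquad \mathit{fn}^{\mathfrak S}=\mathrm{Pr}^{\mathfrak U}_{\mathcal N}(\lozenge\mathit{FN}),\qquad \mathit{tn}^{\mathfrak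 S}=\mathrm{Pr}^{\mathfrak U}_{\mathcal N}(\lozenge\mathit{TN}).$$ -/

import Mathlib

open MeasureTheory ProbabilityTheory
open scoped ENNReal

noncomputable section

/-- A finite Markov decision process with state set `S` and action set `A`. Every row
`P s α` sums up to `0` (`α` is not enabled in `s`) or to `1` (`α` is enabled in `s`). Finiteness of `A` is required
where it is used. -/
structure MDP (S A : Type*) [Fintype S] where
  P : S → A → S → ℝ≥0∞
  sum_P : ∀ s α, ∑ t, P s α t = 0 ∨ ∑ t, P s α t = 1
  init : S

/-- Finite alternating sequences `s₀ α₀ s₁ α₁ … sₙ` of states and actions. -/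
inductive History (S A : Type*) where
  | start (s : S) : History S A
  | snoc (π : History S A) (α : A) (t : S) : History S A

namespace History

variable {S A : Type*}

/-- The last state of a finite alternating sequence. -/
def last : History S A → S
  | start s => s
  | snoc _ _ t => t

instance : MeasurableSpace (History S A) := ⊤

instance : DiscreteMeasurableSpace (History S A) := ⟨fun _ => trivial⟩

end History

/-- The transition kernel, at time `n`, of the Markov chain with one-step distributions `step`. -/
def markovKernel {X : Type*} [MeasurableSpace X] [DiscreteMeasurableSpace X]
    (step : X → PMF X) (n : ℕ) : Kernel ((_ : Finset.Iic n) → X) X where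
  toFun h := (step (h ⟨n, Finset.mem_Iic.2 le_rfl⟩)).toMeasure
  measurable' := (Measurable.of_discrete (f := fun x : X => (step x).toMeasure)).comp
    (measurable_pi_apply _)

instance {X : Type*} [MeasurableSpace X] [DiscreteMeasurableSpace X]
    (step : X → PMF X) (n : ℕ) : IsMarkovKernel (markovKernel step n) :=
  ⟨fun _ => PMF.toMeasure.isProbabilityMeasure _⟩

/-- The law, on the space of infinite sequences, of the Markov chain with one-step distributions
`step` that starts in `x`. -/
def markovMeasure {X : Type*} [MeasurableSpace X] [DiscreteMeasurableSpace X]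
    (step : X → PMF X) (x : X) : Measure (ℕ → X) :=
  Kernel.traj (X := fun _ => X) (markovKernel step) 0 (fun _ => x)

namespace MDP

variable {S A : Type*} [Fintype S]

/-- The action `α` is enabled in the state `s`. -/
def Enabled (M : MDP S A) (s : S) (α : A) : Prop := ∑ t, M.P s α t = 1

/-- A state is terminal if no action is enabled in it. -/
def Terminal (M : MDP S A) (s : S) : Prop := ∀ α, ¬ M.Enabled s α

/-- The distribution over the successors of `s` under an enabled action. -/
def next (M : MDP S A) (s : S) (α : {α // M.Enabled s α}) : PMF S :=
  PMF.ofFintype (M.P s α.1) α.2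

/-- A (randomized, history-dependent) policy: it maps every finite path that ends in a
non-terminal state to a distribution over the actions enabled in its last state. (A policy is
given a value on alternating sequences along which some transition probability vanishes, too;
these have probability `0`, so the value there is irrelevant.) -/
structure Policy (M : MDP S A) where
  choice : ∀ π : History S A, ¬ M.Terminal π.last → PMF {α // M.Enabled π.last α}

open Classical in
/-- One step of the Markov chain induced by a policy. Its states are the finite paths; a path that
ends in a terminal state is maximal and is not extended any more. -/
def Policy.step {M : MDP S A} (σ : M.Policy) (π : History S A) : PMF (History S A) :=
  if h : M.Terminal π.last then PMF.pure π
  else (σ.choice π h).bind fun α => (M.next π.last α).map (π.snoc α.1)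

/-- The probability measure on maximal paths for the policy `σ` and the starting state `s`.
A maximal path is represented by the sequence of its finite prefixes, in increasing order, which is
eventually constant if the maximal path is finite. -/
def Pr (M : MDP S A) (σ : M.Policy) (s : S) : Measure (ℕ → History S A) :=
  markovMeasure σ.step (History.start s)

/-- The set of maximal paths that eventually visit `T`. -/
def ev (T : Set S) : Set (ℕ → History S A) := {ω | ∃ n, (ω n).last ∈ T}

/-- Probability of a true positive: both `C` and `E` are visited. -/
def tp (M : MDP S A) (C E : Set S) (σ : M.Policy) : ℝ≥0∞ := M.Pr σ M.init (ev C ∩ ev E)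

/-- Probability of a false positive: `C` is visited, but not `E`. -/
def fp (M : MDP S A) (C E : Set S) (σ : M.Policy) : ℝ≥0∞ := M.Pr σ M.init (ev C ∩ (ev E)ᶜ)

/-- Probability of a false negative: `E` is visited, but not `C`. -/
def fn (M : MDP S A) (C E : Set S) (σ : M.Policy) : ℝ≥0∞ := M.Pr σ M.init ((ev C)ᶜ ∩ ev E)

/-- Probability of a true negative: neither `C` nor `E` is visited. -/
def tn (M : MDP S A) (C E : Set S) (σ : M.Policy) : ℝ≥0∞ := M.Pr σ M.init ((ev C)ᶜ ∩ (ev E)ᶜ)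

/-- Minimal probability, over all policies, to reach `E` from `s`. -/
def prMin (M : MDP S A) (E : Set S) (s : S) : ℝ≥0∞ := ⨅ σ : M.Policy, M.Pr σ s (ev E)

/-- Maximal probability, over all policies, to reach `E` from `s`. -/
def prMax (M : MDP S A) (E : Set S) (s : S) : ℝ≥0∞ := ⨆ σ : M.Policy, M.Pr σ s (ev E)

instance (M : MDP S A) : Nonempty M.Policy :=
  ⟨⟨fun π h => PMF.pure (Classical.choice (by
    unfold Terminal at h
    push Not at h
    obtain ⟨α, hα⟩ := h
    exact ⟨⟨α, hα⟩⟩))⟩⟩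

instance (M : MDP S A) (σ : M.Policy) (s : S) : IsProbabilityMeasure (M.Pr σ s) := by
  unfold Pr markovMeasure
  infer_instance

theorem prMax_le_one (M : MDP S A) (E : Set S) (s : S) : M.prMax E s ≤ 1 :=
  iSup_le fun _ => prob_le_one

theorem prMin_le_one (M : MDP S A) (E : Set S) (s : S) : M.prMin E s ≤ 1 :=
  iInf_le_of_le (Classical.arbitrary M.Policy) prob_le_one

/-- `(T, B)` is an end component: a strongly connected sub-MDP with the states `T` and the
state-action pairs `B`, of which there is at least one. -/
structure IsEC (M : MDP S A) (T : Set S) (B : Set (S × A)) : Prop where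
  mem : ∀ s α, (s, α) ∈ B → s ∈ T
  enabled : ∀ s α, (s, α) ∈ B → M.Enabled s α
  closed : ∀ s α, (s, α) ∈ B → ∀ t, M.P s α t ≠ 0 → t ∈ T
  connected : ∀ s ∈ T, ∀ t ∈ T,
    Relation.ReflTransGen (fun u v => ∃ α, (u, α) ∈ B ∧ M.P u α v ≠ 0) s t
  nonempty : B.Nonempty

/-- The maximal end components (MECs), with respect to inclusion of sub-MDPs. -/
def MEC (M : MDP S A) : Type _ :=
  {e : Set S × Set (S × A) // Maximal (fun e => M.IsEC e.1 e.2) e}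

/-- The states of a maximal end component. -/
def MEC.states {M : MDP S A} (e : M.MEC) : Set S := e.1.1

/-- The state-action pairs of a maximal end component. -/
def MEC.pairs {M : MDP S A} (e : M.MEC) : Set (S × A) := e.1.2

instance [Finite A] (M : MDP S A) : Finite M.MEC := by unfold MEC; infer_instance

end MDP

/-! ### First step: minimizing and maximizing actions in the states of `C` -/

/-- The states of an MDP together with two fresh states. -/
inductive MMState (S : Type*) where
  | orig (s : S)
  | TP
  | FP
  deriving Fintype

/-- The actions of an MDP together with two fresh actions. -/
inductive MMAct (A : Type*) where
  | orig (α : A)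
  | amin
  | amax
  deriving Fintype

namespace MDP

variable {S A : Type*} [Fintype S]

open Classical in
/-- The transition probabilities after the outgoing transitions of all `c ∈ C` have been replaced
by the two actions `amin` and `amax`. -/
def minmaxP (M : MDP S A) (C E : Set S) : MMState S → MMAct A → MMState S → ℝ≥0∞
  | .orig s, .orig α, .orig t => if s ∈ C then 0 else M.P s α t
  | .orig s, .amin, .TP => if s ∈ C then M.prMin E s else 0
  | .orig s, .amin, .FP => if s ∈ C then 1 - M.prMin E s else 0
  | .orig s, .amax, .TP => if s ∈ C then M.prMax E s else 0
  | .orig s, .amax, .FP => if s ∈ C then 1 - M.prMax E s else 0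
  | _, _, _ => 0

theorem sum_MMState (f : MMState S → ℝ≥0∞) :
    ∑ x, f x = (∑ s, f (.orig s)) + f .TP + f .FP := by
  let e : MMState S ≃ Option (Option S) :=
    { toFun := fun x => match x with
        | .orig s => some (some s)
        | .TP => some none
        | .FP => none
      invFun := fun x => match x with
        | some (some s) => .orig s
        | some none => .TP
        | none => .FP
      left_inv := by rintro (_ | _ | _) <;> rfl
      right_inv := by rintro (_ | _ | _) <;> rfl }
  rw [← e.symm.sum_comp, Fintype.sum_option, Fintype.sum_option]
  change f .FP + (f .TP + ∑ s, f (.orig s)) = _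
  ring

/-- The MDP in which the outgoing transitions of all `c ∈ C` have been replaced by `amin` and
`amax`. -/
def minmax (M : MDP S A) (C E : Set S) : MDP (MMState S) (MMAct A) where
  P := M.minmaxP C E
  sum_P s α := by
    rw [sum_MMState]
    rcases s with s | _ | _
    · by_cases hs : s ∈ C
      · rcases α with α | _ | _
        · simp [minmaxP, hs]
        · simp [minmaxP, hs, add_tsub_cancel_of_le (M.prMin_le_one E s)]
        · simp [minmaxP, hs, add_tsub_cancel_of_le (M.prMax_le_one E s)]
      · rcases α with α | _ | _
        · simpa [minmaxP, hs] using M.sum_P s α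
        · simp [minmaxP, hs]
        · simp [minmaxP, hs]
    · simp [minmaxP]
    · simp [minmaxP]
  init := .orig M.init

/-! ### Second and third step: collapsing the maximal end components and the terminal states -/

/-- The original states that are left as they are: those that are not in `E`, not terminal (in the
MDP after the first step), and in no maximal end component (of the MDP after the first step). -/
def Kept (M : MDP S A) (C E : Set S) (s : S) : Prop :=
  s ∉ E ∧ ¬ (M.minmax C E).Terminal (.orig s) ∧
    ¬ ∃ e : (M.minmax C E).MEC, MMState.orig s ∈ e.states

/-- The states of the canonical MDP: the kept states, one state for each maximal end component,
and four terminal states. -/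
inductive CanState (M : MDP S A) (C E : Set S) where
  | keep (s : {s : S // M.Kept C E s})
  | mec (e : (M.minmax C E).MEC)
  | TP
  | FP
  | FN
  | TN

instance [Finite A] (M : MDP S A) (C E : Set S) : Finite (M.CanState C E) := by
  have : Finite (MMAct A) := by
    have := Fintype.ofFinite A
    infer_instance
  let f : M.CanState C E → {s : S // M.Kept C E s} ⊕ (M.minmax C E).MEC ⊕ Fin 4 := fun x =>
    match x with
    | .keep s => .inl s
    | .mec e => .inr (.inl e)
    | .TP => .inr (.inr 0)
    | .FP => .inr (.inr 1)
    | .FN => .inr (.inr 2)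
    | .TN => .inr (.inr 3)
  refine Finite.of_injective f ?_
  rintro (_ | _ | _ | _ | _ | _) (_ | _ | _ | _ | _ | _) h <;> simp_all [f]

instance [Finite A] (M : MDP S A) (C E : Set S) : Fintype (M.CanState C E) := Fintype.ofFinite _

/-- The actions of the canonical MDP: the pairs of a state and an action of the MDP after the first
step, as is customary in a quotient by end components, and the fresh action `tau`. -/
inductive CanAct (S A : Type*) where
  | move (s : MMState S) (α : MMAct A)
  | tau
  deriving Fintype

open Classical in
/-- The state of the canonical MDP into which a state is collapsed. (Different maximal end
components have no state in common, so no choice is made here.) -/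
def collapse (M : MDP S A) (C E : Set S) : MMState S → M.CanState C E
  | .TP => .TP
  | .FP => .FP
  | .orig s =>
    if hE : s ∈ E then .FN
    else if hT : (M.minmax C E).Terminal (.orig s) then .TN
    else if hm : ∃ e : (M.minmax C E).MEC, MMState.orig s ∈ e.states then .mec hm.choose
    else .keep ⟨s, hE, hT, hm⟩

open Classical in
/-- The transition probabilities of the canonical MDP. The action `move s α` belongs to the state
into which `s` is collapsed, unless `(s, α)` is a state-action pair of a maximal end component; it
inherits the transition probabilities of `(s, α)`. In each state that represents a maximal end
component, `tau` leads to `TN`. -/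
def canonicalP (M : MDP S A) (C E : Set S) :
    M.CanState C E → CanAct S A → M.CanState C E → ℝ≥0∞
  | x, .move s α, y =>
    if M.collapse C E s = x ∧ ¬ ∃ e : (M.minmax C E).MEC, (s, α) ∈ e.pairs then
      ∑ t, if M.collapse C E t = y then (M.minmax C E).P s α t else 0
    else 0
  | .mec _, .tau, .TN => 1
  | _, .tau, _ => 0

/-- The canonical MDP of `M` with respect to `C` (and `E`). -/
def canonical [Finite A] (M : MDP S A) (C E : Set S) :
    MDP (M.CanState C E) (CanAct S A) where
  P := M.canonicalP C E
  sum_P x a := by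
    classical
    rcases a with ⟨s, α⟩ | _
    · by_cases h : M.collapse C E s = x ∧ ¬ ∃ e : (M.minmax C E).MEC, (s, α) ∈ e.pairs
      · have : ∑ y, M.canonicalP C E x (.move s α) y = ∑ t, (M.minmax C E).P s α t := by
          simp only [canonicalP, if_pos h]
          rw [Finset.sum_comm]
          refine Finset.sum_congr rfl fun t _ => ?_
          simp
        rw [this]
        exact (M.minmax C E).sum_P s α
      · left
        simp only [canonicalP, if_neg h, Finset.sum_const_zero]
    · rcases x with _ | e | _ | _ | _ | _
      · left; simp [canonicalP]
      · right
        rw [Finset.sum_eq_single .TN]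
        · rfl
        · rintro (_ | _ | _ | _ | _ | _) _ h <;> first | rfl | exact absurd rfl h
        · simp
      all_goals left; simp [canonicalP]
  init := M.collapse C E (.orig M.init)

/-- The policy `σ` of `M` and the policy `υ` of the canonical MDP yield the same confusion matrix:
its entries for `σ` are the probabilities to reach the four terminal states under `υ`. -/
def SameConfusion [Finite A] (M : MDP S A) (C E : Set S) (σ : M.Policy)
    (υ : (M.canonical C E).Policy) : Prop :=
  M.tp C E σ = (M.canonical C E).Pr υ (M.canonical C E).init (ev {CanState.TP}) ∧
  M.fp C E σ = (M.canonical C E).Pr υ (M.canonical C E).init (ev {CanState.FP}) ∧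
  M.fn C E σ = (M.canonical C E).Pr υ (M.canonical C E).init (ev {CanState.FN}) ∧
  M.tn C E σ = (M.canonical C E).Pr υ (M.canonical C E).init (ev {CanState.TN})

end MDP

end

/-! ### Laws of Markov chains on the space of sequences, and first-step analysis. -/

section Markov

variable {X : Type*} [MeasurableSpace X] [DiscreteMeasurableSpace X]

/-! All probabilities in question are Green functions. Let `K` be the one-step operator of a policy
on finite paths, killed in `C`. Then fn is `∑ K ^ n` applied to the indicator of `E`, and tp is `∑ K
^ n` applied to the residual probability of reaching `E`, restricted to paths ending in `C`
(`fn_eq_green`, `tp_eq_green`). A Green function is the least solution of `f = F + K f`: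
supersolutions bound it from above (`IsPosOp.green_le`), partial sums from below. This replaces
measure theory on path spaces almost everywhere.

The canonical MDP has no end component: together with the pairs inside the collapsed components it
would pull back to an end component containing a pair that lies in no maximal one
(`canonical_not_closed`). Hence every policy of it terminates almost surely, both sets of outcomes
have total probability 1, and three entries of the confusion matrix determine the fourth
(`sameConfusion_of_three`).

From the MDP to the canonical MDP: when a path first enters `C`, only the residual probability of
`E` still matters. It lies between `prMin` and `prMax`, so it is reproduced by randomizing between
`amin` and `amax`. Inside a maximal end component only the exiting pair matters. One records the
expected mass with which the collapsed process enters each state at its `k`-th step and the mass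
with which it leaves by each pair; what never leaves is assigned to `tau`. Playing actions with the
resulting conditional probabilities, given only the time and the current state, reproduces all these
masses (`Policy.exists_projection`).

From the canonical MDP to the MDP: a policy with memory stores the simulated history and the next
simulated action. In an end component it wanders by a memoryless policy until it is in the state
that owns this action; for `tau` it wanders forever. On entering `C` it samples `amin` or `amax` and
then follows a memoryless optimal policy (`exists_optimal_rules`). Kuhn's theorem removes the memory
(`exists_policy_of_memory`). The expected reward is bounded above by an explicit supersolution and
below by induction on the simulated steps; a minimum principle on end components
(`IsNav.le_of_superharmonic`) shows that wandering costs nothing. -/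

theorem PMF.lintegral_toMeasure (p : PMF X) (f : X → ℝ≥0∞) :
    ∫⁻ x, f x ∂p.toMeasure = ∑' x, p x * f x := by
  have h : p.toMeasure = Measure.sum (fun x => p x • Measure.dirac x) := by
    ext s hs
    rw [PMF.toMeasure_apply p hs, Measure.sum_apply _ hs]
    refine tsum_congr fun x => ?_
    simp [Set.indicator, hs, Measure.dirac_apply']
  rw [h, lintegral_sum_measure]
  refine tsum_congr fun x => ?_
  rw [lintegral_smul_measure, lintegral_dirac' _ Measurable.of_discrete, smul_eq_mul]

instance (step : X → PMF X) (x : X) : IsProbabilityMeasure (markovMeasure step x) := by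
  unfold markovMeasure
  infer_instance

theorem lintegral_markovMeasure_zero (step : X → PMF X) (x : X) (f : X → ℝ≥0∞) :
    ∫⁻ ω, f (ω 0) ∂markovMeasure step x = f x := by
  unfold markovMeasure
  rw [Kernel.lintegral_traj (X := fun _ => X) (f := fun ω => f (ω 0)) _
    (Measurable.of_discrete.comp (measurable_pi_apply 0))]
  simp [Function.updateFinset]

theorem lintegral_markovMeasure_succ (step : X → PMF X) (x : X) (b : ℕ)
    (F : (((_ : Finset.Iic b) → X) × X) → ℝ≥0∞) (hF : Measurable F) :
    ∫⁻ ω, F (Preorder.frestrictLe b ω, ω (b + 1)) ∂markovMeasure step x =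
      ∫⁻ ω, ∫⁻ y, F (Preorder.frestrictLe b ω, y) ∂markovKernel step b (Preorder.frestrictLe b ω)
        ∂markovMeasure step x := by
  have h := Kernel.partialTraj_compProd_eq_map_traj (X := fun _ => X) (κ := markovKernel step)
    (Nat.zero_le b) (x₀ := fun _ => x)
  have h2 := Kernel.traj_map_frestrictLe_apply (κ := markovKernel step) (X := fun _ => X) 0 b
    (fun _ => x)
  rw [← h2] at h
  unfold markovMeasure
  have h3 := congrArg (fun m => ∫⁻ z, F z ∂m) h
  simp only at h3
  rw [lintegral_map hF (by fun_prop), Measure.lintegral_compProd hF,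
    lintegral_map hF.lintegral_kernel_prod_right' (by fun_prop)] at h3
  exact h3.symm

/-- The initial value and the one-step conditional laws determine the law of each initial segment by
induction on its length. These laws determine all finite-dimensional marginals, and a projective
limit is unique. -/
theorem eq_markovMeasure (step : X → PMF X) (x : X) (ν : Measure (ℕ → X)) [IsFiniteMeasure ν]
    (h0 : ∀ f : X → ℝ≥0∞, ∫⁻ ω, f (ω 0) ∂ν = f x)
    (hs : ∀ (b : ℕ) (F : (((_ : Finset.Iic b) → X) × X) → ℝ≥0∞), Measurable F →
      ∫⁻ ω, F (Preorder.frestrictLe b ω, ω (b + 1)) ∂ν =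
      ∫⁻ ω, ∫⁻ y, F (Preorder.frestrictLe b ω, y) ∂markovKernel step b (Preorder.frestrictLe b ω)
        ∂ν) :
    ν = markovMeasure step x := by
  have key : ∀ (b : ℕ) (F : ((_ : Finset.Iic b) → X) → ℝ≥0∞), Measurable F →
      ∫⁻ ω, F (Preorder.frestrictLe b ω) ∂ν =
      ∫⁻ ω, F (Preorder.frestrictLe b ω) ∂markovMeasure step x := by
    intro b
    induction b with
    | zero =>
      intro F hF
      have e : ∀ ω : ℕ → X, Preorder.frestrictLe (π := fun _ => X) 0 ω = fun _ => ω 0 := by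
        intro ω; ext ⟨i, hi⟩
        have : i = 0 := by simpa using hi
        subst this; rfl
      simp only [e]
      rw [h0 (fun y => F fun _ => y), lintegral_markovMeasure_zero step x (fun y => F fun _ => y)]
    | succ b ih =>
      intro F hF
      let g : (((_ : Finset.Iic b) → X) × X) → ((_ : Finset.Iic (b + 1)) → X) := fun z i =>
        if h : i.1 ≤ b then z.1 ⟨i.1, Finset.mem_Iic.2 h⟩ else z.2
      have hg : Measurable g := by
        refine measurable_pi_lambda _ fun i => ?_
        by_cases h : i.1 ≤ b
        · simp only [g, h, dite_true]; fun_prop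
        · simp only [g, h, dite_false]; fun_prop
      have e : ∀ ω : ℕ → X, Preorder.frestrictLe (π := fun _ => X) (b + 1) ω =
          g (Preorder.frestrictLe b ω, ω (b + 1)) := by
        intro ω; ext ⟨i, hi⟩
        have hi' : i ≤ b + 1 := by simpa using hi
        by_cases h : i ≤ b
        · simp [g, h]
        · have : i = b + 1 := by omega
          subst this; simp [g]
      simp only [e]
      have hm : Measurable fun z => F (g z) := hF.comp hg
      rw [hs b _ hm, lintegral_markovMeasure_succ step x b _ hm]
      exact ih _ hm.lintegral_kernel_prod_right'
  refine MeasureTheory.IsProjectiveLimit.unique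
    (α := fun _ => X) (P := fun I => (markovMeasure step x).map (I.restrict (π := fun _ => X))) ?_ (fun I => rfl)
  intro I
  have hI : I ⊆ Finset.Iic (I.sup id) := I.subset_Iic_sup_id
  have hr : I.restrict (π := fun _ => X) =
      (Finset.restrict₂ (π := fun _ => X) hI) ∘ Preorder.frestrictLe (π := fun _ => X) (I.sup id) := rfl
  have hm : Measurable (Finset.restrict₂ (π := fun _ => X) hI) :=
    Finset.measurable_restrict₂ hI
  change ν.map I.restrict = (markovMeasure step x).map I.restrict
  rw [hr, ← Measure.map_map hm (by fun_prop), ← Measure.map_map hm (by fun_prop)]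
  congr 1
  refine Measure.ext_of_lintegral _ fun F hF => ?_
  rw [lintegral_map hF (by fun_prop), lintegral_map hF (by fun_prop)]
  exact key _ F hF

/-- The sequence that starts with `x` and continues with `ω`. -/
def consSeq (x : X) (ω : ℕ → X) : ℕ → X
  | 0 => x
  | n + 1 => ω n

theorem measurable_consSeq {X : Type*} [MeasurableSpace X] (x : X) : Measurable (consSeq x) := by
  refine measurable_pi_lambda _ fun n => ?_
  cases n with
  | zero => exact measurable_const
  | succ n => exact measurable_pi_apply n

/-- The Markov property at time `1`. -/
theorem markovMeasure_eq_bind (step : X → PMF X) (x : X) :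
    markovMeasure step x =
      (step x).toMeasure.bind fun y => (markovMeasure step y).map (consSeq x) := by
  symm
  have hm : AEMeasurable (fun y => (markovMeasure step y).map (consSeq x)) (step x).toMeasure :=
    Measurable.of_discrete.aemeasurable
  have : IsProbabilityMeasure
      ((step x).toMeasure.bind fun y => (markovMeasure step y).map (consSeq x)) := by
    have := PMF.toMeasure.isProbabilityMeasure (step x)
    refine ⟨?_⟩
    rw [Measure.bind_apply .univ hm]
    have : ∀ y, ((markovMeasure step y).map (consSeq x)) Set.univ = 1 := fun y => by
      rw [Measure.map_apply (measurable_consSeq x) .univ]; simp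
    simp [this]
  refine eq_markovMeasure step x _ (fun f => ?_) (fun b F hF => ?_)
  · have hf : Measurable fun ω : ℕ → X => f (ω 0) :=
      Measurable.of_discrete.comp (measurable_pi_apply 0)
    rw [Measure.lintegral_bind hm hf.aemeasurable]
    simp only [lintegral_map hf (measurable_consSeq x), consSeq]
    have := PMF.toMeasure.isProbabilityMeasure (step x)
    simp
  · have h1 : Measurable fun ω : ℕ → X =>
        F (Preorder.frestrictLe (π := fun _ => X) b ω, ω (b + 1)) := hF.comp (by fun_prop)
    have h2 : Measurable fun ω : ℕ → X =>
        ∫⁻ y, F (Preorder.frestrictLe (π := fun _ => X) b ω, y)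
          ∂markovKernel step b (Preorder.frestrictLe b ω) :=
      hF.lintegral_kernel_prod_right'.comp (Preorder.measurable_frestrictLe b)
    rw [Measure.lintegral_bind hm h1.aemeasurable, Measure.lintegral_bind hm h2.aemeasurable]
    simp only [lintegral_map h1 (measurable_consSeq x), lintegral_map h2 (measurable_consSeq x)]
    -- At time 0 the past is the constant `x` and the next value is drawn from `step x`. At time `b
    -- + 1` the one-step property at time `b` of the chain started in `y` is used, with the past
    -- shifted by `g`.
    cases b with
    | zero =>
      have e : ∀ ω : ℕ → X, Preorder.frestrictLe (π := fun _ => X) 0 (consSeq x ω) =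
          fun _ => x := by
        intro ω; ext ⟨i, hi⟩
        have : i = 0 := by simpa using hi
        subst this; rfl
      simp only [e]
      have e2 : ∀ y, ∫⁻ ω : ℕ → X, F (fun _ => x, consSeq x ω (0 + 1)) ∂markovMeasure step y =
          F (fun _ => x, y) := fun y =>
        lintegral_markovMeasure_zero step y (fun z => F (fun _ => x, z))
      simp only [e2]
      have := PMF.toMeasure.isProbabilityMeasure (step x)
      simp [markovKernel]
    | succ b =>
      refine lintegral_congr fun y => ?_
      let g : ((_ : Finset.Iic b) → X) → ((_ : Finset.Iic (b + 1)) → X) := fun z i =>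
        if h : i.1 = 0 then x else z ⟨i.1 - 1, Finset.mem_Iic.2 (by
          have := Finset.mem_Iic.1 i.2; omega)⟩
      have hg : Measurable g := by
        refine measurable_pi_lambda _ fun i => ?_
        by_cases h : i.1 = 0
        · simp only [g, h, dite_true]; fun_prop
        · simp only [g, h, dite_false]; fun_prop
      have e : ∀ ω : ℕ → X, Preorder.frestrictLe (π := fun _ => X) (b + 1) (consSeq x ω) =
          g (Preorder.frestrictLe b ω) := by
        intro ω; ext ⟨i, hi⟩
        cases i with
        | zero => rfl
        | succ i => simp [g, consSeq]
      simp only [e]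
      have hG : Measurable fun z : (((_ : Finset.Iic b) → X) × X) => F (g z.1, z.2) :=
        hF.comp (by fun_prop)
      have := lintegral_markovMeasure_succ step y b _ hG
      simp only at this
      refine this.trans (lintegral_congr fun ω => ?_)
      -- The kernel looks only at the last coordinate, which the shift preserves.
      have : markovKernel step (b + 1) (g (Preorder.frestrictLe b ω)) =
          markovKernel step b (Preorder.frestrictLe b ω) := by
        simp [markovKernel, g]
      rw [this]

theorem markovMeasure_apply (step : X → PMF X) (x : X) {B : Set (ℕ → X)} (hB : MeasurableSet B) :
    markovMeasure step x B = ∑' y, step x y * markovMeasure step y (consSeq x ⁻¹' B) := by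
  conv_lhs => rw [markovMeasure_eq_bind]
  rw [Measure.bind_apply hB Measurable.of_discrete.aemeasurable, PMF.lintegral_toMeasure]
  refine tsum_congr fun y => ?_
  rw [Measure.map_apply (measurable_consSeq x) hB]

end Markov

/-! ### Positive operators on `ℝ≥0∞`-valued functions and their Green operators -/

section PosOp

variable {X : Type*}

/-- A monotone, countably additive operator. -/
structure IsPosOp (K : (X → ℝ≥0∞) → X → ℝ≥0∞) : Prop where
  zero : K 0 = 0
  add : ∀ F G, K (F + G) = K F + K G
  mono : Monotone K
  smul : ∀ (c : ℝ≥0∞) (F : X → ℝ≥0∞), K (fun x => c * F x) = fun x => c * K F x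
  tsum : ∀ F : ℕ → X → ℝ≥0∞, K (fun x => ∑' n, F n x) = fun x => ∑' n, K (F n) x

/-- The Green operator `1 + K + K ^ 2 + …`. -/
noncomputable def green (K : (X → ℝ≥0∞) → X → ℝ≥0∞) (F : X → ℝ≥0∞) (x : X) : ℝ≥0∞ :=
  ∑' n, K^[n] F x

variable {K : (X → ℝ≥0∞) → X → ℝ≥0∞}

theorem green_eq_add_green (F : X → ℝ≥0∞) (x : X) : green K F x = F x + green K (K F) x := by
  unfold green
  rw [tsum_eq_zero_add' ENNReal.summable]
  rfl

theorem IsPosOp.green_apply (hK : IsPosOp K) (F : X → ℝ≥0∞) :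
    K (green K F) = green K (K F) := by
  have := hK.tsum (fun n => K^[n] F)
  unfold green
  rw [this]
  funext x
  refine tsum_congr fun n => ?_
  rw [← Function.iterate_succ_apply' K, Function.iterate_succ_apply]

theorem IsPosOp.green_eq (hK : IsPosOp K) (F : X → ℝ≥0∞) (x : X) :
    green K F x = F x + K (green K F) x := by
  rw [hK.green_apply, green_eq_add_green]

theorem IsPosOp.sum_iterate_succ (hK : IsPosOp K) (F : X → ℝ≥0∞) (n : ℕ) :
    (∑ i ∈ Finset.range (n + 1), K^[i] F) = F + K (∑ i ∈ Finset.range n, K^[i] F) := by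
  induction n with
  | zero => simp [hK.zero]
  | succ n ih =>
    conv_rhs => rw [Finset.sum_range_succ, hK.add]
    rw [Finset.sum_range_succ, ih, add_assoc, Function.iterate_succ_apply']

theorem green_eq_iSup (F : X → ℝ≥0∞) (x : X) :
    green K F x = ⨆ n, (∑ i ∈ Finset.range n, K^[i] F) x := by
  unfold green
  rw [ENNReal.tsum_eq_iSup_nat]
  simp

theorem IsPosOp.sum_iterate_le (hK : IsPosOp K) {F f : X → ℝ≥0∞} (h : ∀ x, F x + K f x ≤ f x)
    (n : ℕ) : (∑ i ∈ Finset.range n, K^[i] F) ≤ f := by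
  induction n with
  | zero => simp
  | succ n ih =>
    rw [hK.sum_iterate_succ]
    intro x
    exact (add_le_add le_rfl (hK.mono ih x)).trans (h x)

/-- A supersolution dominates every partial sum of the series, by induction. So the Green function
is the least solution of its equation; this is the source of nearly all upper bounds below. -/
theorem IsPosOp.green_le (hK : IsPosOp K) {F f : X → ℝ≥0∞} (h : ∀ x, F x + K f x ≤ f x) (x : X) :
    green K F x ≤ f x := by
  rw [green_eq_iSup]
  exact iSup_le fun n => hK.sum_iterate_le h n x

theorem IsPosOp.iterate_add (hK : IsPosOp K) (F G : X → ℝ≥0∞) (n : ℕ) :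
    K^[n] (F + G) = K^[n] F + K^[n] G := by
  induction n with
  | zero => rfl
  | succ n ih => simp only [Function.iterate_succ_apply', ih, hK.add]

theorem IsPosOp.iterate_zero (hK : IsPosOp K) (n : ℕ) : K^[n] 0 = 0 := by
  induction n with
  | zero => rfl
  | succ n ih => simp only [Function.iterate_succ_apply', ih, hK.zero]

theorem IsPosOp.green_add (hK : IsPosOp K) (F G : X → ℝ≥0∞) (x : X) :
    green K (F + G) x = green K F x + green K G x := by
  unfold green
  rw [← ENNReal.tsum_add]
  refine tsum_congr fun n => ?_
  rw [hK.iterate_add]; rfl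

theorem IsPosOp.iterate_tsum (hK : IsPosOp K) (F : ℕ → X → ℝ≥0∞) (n : ℕ) :
    K^[n] (fun x => ∑' k, F k x) = fun x => ∑' k, K^[n] (F k) x := by
  induction n with
  | zero => rfl
  | succ n ih => simp only [Function.iterate_succ_apply', ih, hK.tsum]

theorem IsPosOp.green_tsum (hK : IsPosOp K) (F : ℕ → X → ℝ≥0∞) (x : X) :
    green K (fun x => ∑' k, F k x) x = ∑' k, green K (F k) x := by
  unfold green
  rw [ENNReal.tsum_comm]
  refine tsum_congr fun n => ?_
  rw [hK.iterate_tsum]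

theorem IsPosOp.green_sum (hK : IsPosOp K) {ι : Type*} (s : Finset ι) (F : ι → X → ℝ≥0∞) (x : X) :
    green K (fun x => ∑ i ∈ s, F i x) x = ∑ i ∈ s, green K (F i) x := by
  classical
  induction s using Finset.induction_on with
  | empty =>
    simp only [Finset.sum_empty]
    unfold green
    have : (fun _ : X => (0 : ℝ≥0∞)) = 0 := rfl
    simp [this, hK.iterate_zero]
  | insert i s hi ih =>
    simp only [Finset.sum_insert hi]
    rw [← ih, ← hK.green_add]
    rfl

theorem IsPosOp.green_const_mul (hK : IsPosOp K) (c : ℝ≥0∞) (F : X → ℝ≥0∞) (x : X) :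
    green K (fun x => c * F x) x = c * green K F x := by
  unfold green
  rw [← ENNReal.tsum_mul_left]
  refine tsum_congr fun n => ?_
  have : K^[n] (fun x => c * F x) = fun x => c * K^[n] F x := by
    induction n with
    | zero => rfl
    | succ n ih => simp only [Function.iterate_succ_apply', ih, hK.smul]
  rw [this]

theorem IsPosOp.green_eq_zero (hK : IsPosOp K) {F : X → ℝ≥0∞} (hF : ∀ x, F x = 0) (x : X) :
    green K F x = 0 := by
  have : F = 0 := funext hF
  simp [green, this, hK.iterate_zero]

/-- If `K b` consists of the mass `I` that stays in `b` and of a source `T`, then the mass `Y` that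
leaves `b` is at most the total mass that enters `b`. -/
theorem IsPosOp.green_exit_le (hK : IsPosOp K) {b I Y T : X → ℝ≥0∞} (h1 : K b = I + T)
    (h2 : I + Y ≤ b) (x : X) : green K Y x ≤ b x + green K T x := by
  -- Telescoping without subtraction: `K^[n] b` is the mass that is still in `b` after `n` steps.
  -- Keeping it on the left makes the induction work even when values are infinite.
  have key : ∀ n, (∑ i ∈ Finset.range n, K^[i] Y) x + K^[n] b x ≤
      b x + (∑ i ∈ Finset.range n, K^[i] T) x := by
    intro n
    induction n with
    | zero => simp
    | succ n ih =>
      have h3 : K^[n + 1] b x = K^[n] I x + K^[n] T x := by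
        rw [Function.iterate_succ_apply, h1, hK.iterate_add]; rfl
      have h4 : K^[n] Y x + K^[n] I x ≤ K^[n] b x := by
        have := hK.mono.iterate n h2 x
        rw [hK.iterate_add] at this
        rwa [add_comm]
      rw [Finset.sum_range_succ, Finset.sum_range_succ, Pi.add_apply, Pi.add_apply, h3, ← add_assoc,
        ← add_assoc]
      refine add_le_add ?_ le_rfl
      rw [add_assoc]
      exact (add_le_add le_rfl h4).trans ih
  rw [green_eq_iSup, green_eq_iSup]
  refine iSup_le fun n => le_trans le_self_add ((key n).trans (add_le_add le_rfl ?_))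
  exact le_iSup (fun n => (∑ i ∈ Finset.range n, K^[i] T) x) n

/-- Green functions are preserved by maps that intertwine the operators. -/
theorem green_comp {Y : Type*} {L : (Y → ℝ≥0∞) → Y → ℝ≥0∞} (f : X → Y)
    (h : ∀ F, K (F ∘ f) = L F ∘ f) (F : Y → ℝ≥0∞) (x : X) :
    green K (F ∘ f) x = green L F (f x) := by
  unfold green
  refine tsum_congr fun n => ?_
  have : K^[n] (F ∘ f) = L^[n] F ∘ f := by
    induction n with
    | zero => rfl
    | succ n ih => simp only [Function.iterate_succ_apply', ih, h]
  rw [this]; rfl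

/-- The operators of policies, of memoryless rules and of policies with memory all have this shape,
with `I` indexing the possible transitions. -/
theorem isPosOp_kernel {I : Type*} (w : X → I → ℝ≥0∞) (nx : X → I → X) :
    IsPosOp fun (F : X → ℝ≥0∞) x => ∑' i, w x i * F (nx x i) where
  zero := by funext x; simp
  add F G := by funext x; simp [mul_add, ENNReal.tsum_add]
  mono F G h x := ENNReal.tsum_le_tsum fun i => mul_le_mul_right (h _) _
  smul c F := by
    funext x
    simp_rw [← ENNReal.tsum_mul_left, mul_left_comm]
  tsum F := by
    funext x
    simp_rw [← ENNReal.tsum_mul_left]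
    exact ENNReal.tsum_comm

end PosOp

/-! ### Policies as action probabilities, and their transition operators. -/

namespace MDP

open Classical

variable {S A : Type*} [Fintype S] {M : MDP S A}

/-- The probability that the policy `σ` chooses `α` after `π` (`0` if `π` is maximal). -/
noncomputable def Policy.act (σ : M.Policy) (π : History S A) (α : A) : ℝ≥0∞ :=
  if h : ¬ M.Terminal π.last ∧ M.Enabled π.last α then σ.choice π h.1 ⟨α, h.2⟩ else 0

theorem Policy.act_enabled {σ : M.Policy} {π : History S A} {α : A} (h : σ.act π α ≠ 0) :
    M.Enabled π.last α := by
  by_contra h'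
  exact h (dif_neg fun h'' => h' h''.2)

theorem tsum_subtype_enabled (s : S) (f : {α // M.Enabled s α} → ℝ≥0∞) :
    ∑' α, f α = ∑' α, if h : M.Enabled s α then f ⟨α, h⟩ else 0 := by
  have := tsum_subtype {α | M.Enabled s α} (fun α => if h : M.Enabled s α then f ⟨α, h⟩ else 0)
  rw [show (∑' α, if h : M.Enabled s α then f ⟨α, h⟩ else 0) =
    ∑' α, Set.indicator {α | M.Enabled s α}
      (fun α => if h : M.Enabled s α then f ⟨α, h⟩ else 0) α from ?_, ← this]
  · refine tsum_congr fun α => ?_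
    have : M.Enabled s α.1 := α.2
    simp [this]
  · refine tsum_congr fun α => ?_
    by_cases h : M.Enabled s α <;> simp [h]

theorem Policy.tsum_act (σ : M.Policy) {π : History S A} (h : ¬ M.Terminal π.last) :
    ∑' α, σ.act π α = 1 := by
  rw [← (σ.choice π h).tsum_coe, tsum_subtype_enabled]
  refine tsum_congr fun α => ?_
  simp [act, h]

theorem Policy.act_terminal (σ : M.Policy) {π : History S A} (h : M.Terminal π.last) (α : A) :
    σ.act π α = 0 := dif_neg fun h' => h'.1 h

/-- Policies can be given by their action probabilities. -/
theorem exists_policy (c : History S A → A → ℝ≥0∞)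
    (h1 : ∀ π, ¬ M.Terminal π.last → ∑' α, c π α = 1)
    (h2 : ∀ π α, c π α ≠ 0 → M.Enabled π.last α) :
    ∃ σ : M.Policy, ∀ π α, σ.act π α = c π α := by
  have hs : ∀ π, ¬ M.Terminal π.last → ∑' α : {α // M.Enabled π.last α}, c π α.1 = 1 := by
    intro π h
    rw [← h1 π h, tsum_subtype_enabled (M := M) π.last (fun α => c π α.1)]
    refine tsum_congr fun α => ?_
    by_cases hα : M.Enabled π.last α
    · simp [hα]
    · have : c π α = 0 := by by_contra h'; exact hα (h2 π α h')
      simp [this]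
  refine ⟨⟨fun π h => ⟨fun α => c π α.1, ?_⟩⟩, fun π α => ?_⟩
  · rw [← hs π h]
    exact ENNReal.summable.hasSum
  · by_cases h : ¬ M.Terminal π.last ∧ M.Enabled π.last α
    · simp only [Policy.act, h]
      simp [DFunLike.coe]
    · simp only [Policy.act, h, dif_neg, not_false_eq_true]
      symm
      by_contra hc
      exact h ⟨fun ht => ht α (h2 π α hc), h2 π α hc⟩

/-- The transition operator of the Markov chain induced by a policy, killed in `D` and at the end
of maximal paths. -/
noncomputable def Policy.op (σ : M.Policy) (D : Set S) (F : History S A → ℝ≥0∞)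
    (π : History S A) : ℝ≥0∞ :=
  if π.last ∈ D then 0 else ∑' α, σ.act π α * ∑' t, M.P π.last α t * F (π.snoc α t)

theorem Policy.isPosOp_op (σ : M.Policy) (D : Set S) : IsPosOp (σ.op D) := by
  have : σ.op D = fun F π => ∑' i : A × S,
      (if π.last ∈ D then 0 else σ.act π i.1 * M.P π.last i.1 i.2) * F (π.snoc i.1 i.2) := by
    funext F π
    unfold op
    split_ifs with h
    · simp
    · rw [ENNReal.tsum_prod']
      refine tsum_congr fun α => ?_
      rw [← ENNReal.tsum_mul_left]
      simp only [mul_assoc]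
  rw [this]
  exact isPosOp_kernel _ _

theorem Policy.op_terminal (σ : M.Policy) (D : Set S) (F : History S A → ℝ≥0∞) {π : History S A}
    (h : M.Terminal π.last) : σ.op D F π = 0 := by
  simp [op, σ.act_terminal h]

theorem Policy.op_mem (σ : M.Policy) {D : Set S} (F : History S A → ℝ≥0∞) {π : History S A}
    (h : π.last ∈ D) : σ.op D F π = 0 := by
  simp [op, h]

theorem Policy.op_congr (σ : M.Policy) {D D' : Set S} (F : History S A → ℝ≥0∞) {π : History S A}
    (h : π.last ∉ D) (h' : π.last ∉ D') : σ.op D F π = σ.op D' F π := by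
  simp [op, h, h']

theorem _root_.PMF.tsum_map_mul {X Y : Type*} (p : PMF X) (f : X → Y) (F : Y → ℝ≥0∞) :
    ∑' y, p.map f y * F y = ∑' x, p x * F (f x) := by
  simp only [PMF.map_apply, ← ENNReal.tsum_mul_right]
  rw [ENNReal.tsum_comm]
  refine tsum_congr fun x => ?_
  rw [tsum_eq_single (f x)]
  · simp
  · intro y hy; simp [hy]

theorem _root_.PMF.tsum_bind_mul {X Y : Type*} (p : PMF X) (f : X → PMF Y) (F : Y → ℝ≥0∞) :
    ∑' y, p.bind f y * F y = ∑' x, p x * ∑' y, f x y * F y := by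
  simp only [PMF.bind_apply, ← ENNReal.tsum_mul_right, ← ENNReal.tsum_mul_left]
  rw [ENNReal.tsum_comm]
  simp only [mul_assoc]

/-- The chain loops in a maximal path, whereas `op` vanishes there. The two agree only before
termination, so first-step arguments treat terminal states separately. -/
theorem Policy.tsum_step_terminal (σ : M.Policy) {π : History S A} (h : M.Terminal π.last)
    (F : History S A → ℝ≥0∞) : ∑' π', σ.step π π' * F π' = F π := by
  rw [tsum_eq_single π]
  · simp [step, h]
  · intro π' h'; simp [step, h, h']

theorem Policy.tsum_step (σ : M.Policy) {π : History S A} (h : ¬ M.Terminal π.last)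
    {D : Set S} (hD : π.last ∉ D) (F : History S A → ℝ≥0∞) :
    ∑' π', σ.step π π' * F π' = σ.op D F π := by
  simp only [step, h, dif_neg, not_false_eq_true, op, hD, if_false]
  rw [PMF.tsum_bind_mul, tsum_subtype_enabled (M := M) π.last
    (fun α => σ.choice π h α * ∑' y, (M.next π.last α).map (π.snoc α.1) y * F y)]
  refine tsum_congr fun α => ?_
  by_cases hα : M.Enabled π.last α
  · rw [dif_pos hα, PMF.tsum_map_mul]
    simp only [act, h, hα, not_false_eq_true, and_self, dif_pos]
    rfl
  · simp [act, hα]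

/-! ### Probabilities of the four events -/

/-- The probability to reach `T` if the path starts with `π`, counted from the end of `π` on. -/
noncomputable def Policy.reach (σ : M.Policy) (T : Set S) (π : History S A) : ℝ≥0∞ :=
  markovMeasure σ.step π (ev T)

theorem measurableSet_ev {S A : Type*} (T : Set S) : MeasurableSet (ev T : Set (ℕ → History S A)) := by
  have : (ev T : Set (ℕ → History S A)) = ⋃ n, (fun ω => ω n) ⁻¹' {π | π.last ∈ T} := by
    ext ω; simp [ev]
  rw [this]
  exact MeasurableSet.iUnion fun n => measurable_pi_apply n (MeasurableSet.of_discrete)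

theorem consSeq_preimage_ev_of_mem {S A : Type*} {T : Set S} {π : History S A} (h : π.last ∈ T) :
    consSeq π ⁻¹' ev T = Set.univ :=
  Set.eq_univ_of_forall fun _ => ⟨0, h⟩

theorem consSeq_preimage_ev_of_notMem {S A : Type*} {T : Set S} {π : History S A} (h : π.last ∉ T) :
    consSeq π ⁻¹' ev T = ev T := by
  ext ω
  constructor
  · rintro ⟨n, hn⟩
    cases n with
    | zero => exact absurd hn h
    | succ n => exact ⟨n, hn⟩
  · rintro ⟨n, hn⟩
    exact ⟨n + 1, hn⟩

/-- By first-step analysis, the sum of the first `n` terms of the series is the probability of a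
visit to `T` before time `n`. Continuity from below gives the limit. -/
theorem Policy.reach_eq_green (σ : M.Policy) (T : Set S) (π : History S A) :
    σ.reach T π = green (σ.op T) (fun π => if π.last ∈ T then 1 else 0) π := by
  let B : ℕ → Set (ℕ → History S A) := fun n => {ω | ∃ k < n, (ω k).last ∈ T}
  have hB : ∀ n, MeasurableSet (B n) := by
    intro n
    have : B n = ⋃ k, ⋃ (_ : k < n), (fun ω => ω k) ⁻¹' {π | π.last ∈ T} := by
      ext ω; simp [B]
    rw [this]
    exact MeasurableSet.iUnion fun n => MeasurableSet.iUnion fun _ =>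
      measurable_pi_apply n (MeasurableSet.of_discrete)
  have hmem : ∀ n {π : History S A}, π.last ∈ T → consSeq π ⁻¹' B (n + 1) = Set.univ :=
    fun n π h => Set.eq_univ_of_forall fun _ => ⟨0, n.succ_pos, h⟩
  have hnot : ∀ n {π : History S A}, π.last ∉ T → consSeq π ⁻¹' B (n + 1) = B n := by
    intro n π h
    ext ω
    constructor
    · rintro ⟨k, hk, hk'⟩
      cases k with
      | zero => exact absurd hk' h
      | succ k => exact ⟨k, by omega, hk'⟩
    · rintro ⟨k, hk, hk'⟩
      exact ⟨k + 1, by omega, hk'⟩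
  have key : ∀ n π, markovMeasure σ.step π (B n) =
      (∑ i ∈ Finset.range n, (σ.op T)^[i] (fun π => if π.last ∈ T then 1 else 0)) π := by
    intro n
    induction n with
    | zero => intro π; simp [B]
    | succ n ih =>
      intro π
      rw [(σ.isPosOp_op T).sum_iterate_succ, markovMeasure_apply _ _ (hB _)]
      by_cases h : π.last ∈ T
      · simp [hmem n h, h, σ.op_mem _ h, (σ.step π).tsum_coe]
      · rw [hnot n h]
        by_cases ht : M.Terminal π.last
        · rw [σ.tsum_step_terminal ht (fun π' => markovMeasure σ.step π' (B n)), ih]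
          -- In a terminal state outside of `T` the chain loops, so the induction hypothesis relates
          -- the same path for `n`; all partial sums vanish there.
          have : ∀ n, (∑ i ∈ Finset.range n,
              (σ.op T)^[i] (fun π => if π.last ∈ T then (1 : ℝ≥0∞) else 0)) π = 0 := by
            intro n
            cases n with
            | zero => simp
            | succ n =>
              rw [(σ.isPosOp_op T).sum_iterate_succ]
              simp [h, σ.op_terminal _ _ ht]
          simp [this, h, σ.op_terminal _ _ ht]
        · rw [σ.tsum_step ht h (fun π' => markovMeasure σ.step π' (B n)), funext ih]
          simp [h]
  have hU : ev T = ⋃ n, B n := by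
    ext ω
    simp only [ev, B, Set.mem_ofPred_eq, Set.mem_iUnion]
    exact ⟨fun ⟨n, h⟩ => ⟨n + 1, n, by omega, h⟩, fun ⟨_, k, _, h⟩ => ⟨k, h⟩⟩
  have hmono : Monotone B := fun m n hmn ω ⟨k, hk, h⟩ => ⟨k, by omega, h⟩
  unfold reach
  rw [hU, hmono.measure_iUnion, green_eq_iSup]
  exact iSup_congr fun n => key n π

theorem Policy.reach_le_one (σ : M.Policy) (T : Set S) (π : History S A) : σ.reach T π ≤ 1 :=
  prob_le_one

theorem Policy.reach_of_mem (σ : M.Policy) {T : Set S} {π : History S A} (h : π.last ∈ T) :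
    σ.reach T π = 1 := by
  rw [reach_eq_green, (σ.isPosOp_op T).green_eq]
  simp [h, σ.op_mem _ h]

theorem Policy.reach_of_notMem (σ : M.Policy) {T : Set S} {π : History S A} (h : π.last ∉ T) :
    σ.reach T π = σ.op T (σ.reach T) π := by
  rw [reach_eq_green, (σ.isPosOp_op T).green_eq, ← funext (σ.reach_eq_green T)]
  simp [h]

theorem Policy.reach_le (σ : M.Policy) {T : Set S} {f : History S A → ℝ≥0∞}
    (h1 : ∀ π, π.last ∈ T → 1 ≤ f π) (h2 : ∀ π, π.last ∉ T → σ.op T f π ≤ f π)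
    (π : History S A) : σ.reach T π ≤ f π := by
  rw [reach_eq_green]
  refine (σ.isPosOp_op T).green_le (fun π => ?_) π
  by_cases h : π.last ∈ T
  · simpa [h, σ.op_mem _ h] using h1 π h
  · simpa [h] using h2 π h

section Confusion

variable {C E : Set S} (σ : M.Policy)

/-- A path to `E` either meets `C`, and is cut at its first visit there, or avoids `C`. Both
inequalities come from minimality: `reach` solves the equation killed in `C`, and the right-hand
side is a supersolution of the equation killed in `E`. -/
theorem Policy.reach_split (hE : ∀ e ∈ E, M.Terminal e) (hC : Disjoint C E) (π : History S A) :
    σ.reach E π = green (σ.op C) (fun π => if π.last ∈ C then σ.reach E π else 0) π +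
      green (σ.op C) (fun π => if π.last ∈ E then 1 else 0) π := by
  set F₁ : History S A → ℝ≥0∞ := fun π => if π.last ∈ C then σ.reach E π else 0
  set F₂ : History S A → ℝ≥0∞ := fun π => if π.last ∈ E then 1 else 0
  have hK := σ.isPosOp_op C
  rw [← hK.green_add]
  have hup : ∀ π, green (σ.op C) (F₁ + F₂) π ≤ σ.reach E π := by
    refine hK.green_le fun π => ?_
    by_cases hc : π.last ∈ C
    · have he : π.last ∉ E := fun he => Set.disjoint_left.1 hC hc he
      simp [F₁, F₂, hc, he, σ.op_mem _ hc]
    · by_cases he : π.last ∈ E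
      · simp [F₁, F₂, hc, he, σ.op_terminal _ _ (hE _ he), σ.reach_of_mem he]
      · rw [σ.reach_of_notMem he, σ.op_congr _ hc he]
        simp [F₁, F₂, hc, he]
  refine le_antisymm (σ.reach_le (fun π he => ?_) (fun π he => ?_) π) (hup π)
  · rw [hK.green_eq]
    refine le_add_right ?_
    simp [F₂, he]
  · conv_rhs => rw [hK.green_eq]
    by_cases hc : π.last ∈ C
    · refine le_add_right ?_
      simp only [F₁, Pi.add_apply, hc, if_true]
      refine le_add_right ?_
      -- On `C` the Green function is no longer harmonic for `op E`, but the first inequality bounds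
      -- it by `reach`, which is.
      rw [σ.reach_of_notMem he]
      exact (σ.isPosOp_op E).mono hup π
    · rw [σ.op_congr _ hc he]
      exact le_add_self

/-- First-step analysis makes each probability a supersolution, which gives one inequality for each.
Both pairs add up to `reach E`, which is finite, so the two inequalities must be equalities. -/
theorem Policy.outcomes_eq_green (hE : ∀ e ∈ E, M.Terminal e) (hC : Disjoint C E) (π : History S A) :
    markovMeasure σ.step π (ev C ∩ ev E) =
        green (σ.op C) (fun π => if π.last ∈ C then σ.reach E π else 0) π ∧
      markovMeasure σ.step π ((ev C)ᶜ ∩ ev E) =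
        green (σ.op C) (fun π => if π.last ∈ E then 1 else 0) π := by
  have hK := σ.isPosOp_op C
  have mC := measurableSet_ev (A := A) C
  have mE := measurableSet_ev (A := A) E
  have hn : ∀ π : History S A, π.last ∈ E → π.last ∉ C := fun π he hc =>
    Set.disjoint_left.1 hC hc he
  have h1 : ∀ π, green (σ.op C) (fun π => if π.last ∈ C then σ.reach E π else 0) π ≤
      markovMeasure σ.step π (ev C ∩ ev E) := by
    refine hK.green_le fun π => ?_
    by_cases hc : π.last ∈ C
    · have he : π.last ∉ E := fun he => hn _ he hc
      simp only [hc, if_true, σ.op_mem _ hc, add_zero, reach]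
      rw [markovMeasure_apply _ _ mE, markovMeasure_apply _ _ (mC.inter mE)]
      simp [consSeq_preimage_ev_of_mem hc]
    · by_cases ht : M.Terminal π.last
      · simp [hc, σ.op_terminal _ _ ht]
      · have he : π.last ∉ E := fun he => ht (hE _ he)
        rw [markovMeasure_apply _ _ (mC.inter mE), Set.preimage_inter,
          consSeq_preimage_ev_of_notMem hc, consSeq_preimage_ev_of_notMem he,
          σ.tsum_step ht hc (fun π => markovMeasure σ.step π (ev C ∩ ev E))]
        simp [hc]
  have h2 : ∀ π, green (σ.op C) (fun π => if π.last ∈ E then 1 else 0) π ≤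
      markovMeasure σ.step π ((ev C)ᶜ ∩ ev E) := by
    refine hK.green_le fun π => ?_
    by_cases he : π.last ∈ E
    · have hc := hn _ he
      have ht := hE _ he
      -- `E` is terminal, so a path that is in `E` can never visit `C` afterwards.
      have hz : σ.reach C π = 0 := by
        rw [σ.reach_of_notMem hc, σ.op_terminal _ _ ht]
      have hone := σ.reach_of_mem he
      unfold reach at hz hone
      simp only [he, if_true, σ.op_terminal _ _ ht, add_zero]
      rw [Set.inter_comm, ← Set.sdiff_eq, measure_sdiff_null hz, hone]
    · by_cases hc : π.last ∈ C
      · simp [he, σ.op_mem _ hc]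
      · by_cases ht : M.Terminal π.last
        · simp [he, σ.op_terminal _ _ ht]
        · rw [markovMeasure_apply _ _ (mC.compl.inter mE), Set.preimage_inter, Set.preimage_compl,
            consSeq_preimage_ev_of_notMem hc, consSeq_preimage_ev_of_notMem he,
            σ.tsum_step ht hc (fun π => markovMeasure σ.step π ((ev C)ᶜ ∩ ev E))]
          simp [he]
  have hs := σ.reach_split hE hC π
  have hm : σ.reach E π = markovMeasure σ.step π (ev C ∩ ev E) +
      markovMeasure σ.step π ((ev C)ᶜ ∩ ev E) := by
    unfold reach
    rw [← measure_inter_add_sdiff (ev E) mC, Set.inter_comm, Set.sdiff_eq, Set.inter_comm (ev E)]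
  have hfin : σ.reach E π ≠ ⊤ := ((σ.reach_le_one E π).trans_lt ENNReal.one_lt_top).ne
  rw [hm] at hs hfin
  rw [ENNReal.add_ne_top] at hfin
  constructor
  · refine le_antisymm ?_ (h1 π)
    refine (ENNReal.add_le_add_iff_right hfin.2).1 ?_
    rw [hs]
    exact add_le_add le_rfl (h2 π)
  · refine le_antisymm ?_ (h2 π)
    refine (ENNReal.add_le_add_iff_left hfin.1).1 ?_
    rw [hs]
    exact add_le_add (h1 π) le_rfl

theorem tp_eq_green (hE : ∀ e ∈ E, M.Terminal e) (hC : Disjoint C E) :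
    M.tp C E σ = green (σ.op C) (fun π => if π.last ∈ C then σ.reach E π else 0) (.start M.init) :=
  (σ.outcomes_eq_green hE hC _).1

theorem fn_eq_green (hE : ∀ e ∈ E, M.Terminal e) (hC : Disjoint C E) :
    M.fn C E σ = green (σ.op C) (fun π => if π.last ∈ E then 1 else 0) (.start M.init) :=
  (σ.outcomes_eq_green hE hC _).2

theorem fp_eq_green (hE : ∀ e ∈ E, M.Terminal e) (hC : Disjoint C E) :
    M.fp C E σ =
      green (σ.op C) (fun π => if π.last ∈ C then 1 - σ.reach E π else 0) (.start M.init) := by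
  have h1 := σ.reach_eq_green C (.start M.init)
  have h2 : M.tp C E σ + M.fp C E σ = σ.reach C (.start M.init) :=
    measure_inter_add_sdiff (ev C) (measurableSet_ev E)
  have hfin : M.tp C E σ ≠ ⊤ := measure_ne_top (M.Pr σ M.init) _
  refine (ENNReal.add_right_inj hfin).1 ?_
  rw [h2, h1]
  conv_rhs => rw [tp_eq_green σ hE hC]
  rw [← (σ.isPosOp_op C).green_add]
  congr 1
  funext π
  by_cases h : π.last ∈ C
  · simp [h, add_tsub_cancel_of_le (σ.reach_le_one E π)]
  · simp [h]

theorem confusion_sum (C E : Set S) :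
    M.tp C E σ + M.fp C E σ + M.fn C E σ + M.tn C E σ = 1 := by
  have h2 : M.tp C E σ + M.fp C E σ = M.Pr σ M.init (ev C) :=
    measure_inter_add_sdiff (ev C) (measurableSet_ev E)
  have h3 : M.fn C E σ + M.tn C E σ = M.Pr σ M.init (ev C)ᶜ :=
    measure_inter_add_sdiff (ev C)ᶜ (measurableSet_ev E)
  rw [add_assoc, h2, h3, measure_add_measure_compl (measurableSet_ev C), measure_univ]

end Confusion

end MDP

/-! ### Discounted Green functions. -/

section PosOp

variable {X : Type*} {K : (X → ℝ≥0∞) → X → ℝ≥0∞}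

theorem IsPosOp.const_mul (hK : IsPosOp K) (c : ℝ≥0∞) :
    IsPosOp fun (F : X → ℝ≥0∞) x => c * K F x where
  zero := by funext x; simp [hK.zero]
  add F G := by funext x; simp [hK.add, mul_add]
  mono F G h x := mul_le_mul_right (hK.mono h x) _
  smul b F := by funext x; simp [hK.smul, mul_left_comm]
  tsum F := by funext x; simp [hK.tsum, ENNReal.tsum_mul_left]

/-- Abel summation: Green functions are limits of discounted Green functions. -/
theorem IsPosOp.green_le_of_discounted (hK : IsPosOp K) {F : X → ℝ≥0∞} {x : X} {v : ℝ≥0∞}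
    (r : ℕ → ℝ≥0∞) (hr1 : ∀ j, r j ≤ 1) (hr : Filter.Tendsto r Filter.atTop (nhds 1))
    (h : ∀ j, green (fun F x => r j * K F x) F x ≤ v) : green K F x ≤ v := by
  rw [green_eq_iSup]
  refine iSup_le fun n => ?_
  -- For `i < n` the discount `r j ^ i` of the `i`-th term is at least `r j ^ n`.
  have key : ∀ j n, ∀ x, r j ^ n * (∑ i ∈ Finset.range n, K^[i] F) x ≤
      green (fun F x => r j * K F x) F x := by
    intro j n
    induction n with
    | zero => intro x; simp
    | succ n ih =>
      intro x
      rw [hK.sum_iterate_succ, (hK.const_mul (r j)).green_eq, Pi.add_apply, mul_add]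
      refine add_le_add (mul_le_of_le_one_left' (pow_le_one' (hr1 j) _)) ?_
      rw [pow_succ', mul_assoc]
      refine mul_le_mul_right ?_ _
      have := hK.smul (r j ^ n) (∑ i ∈ Finset.range n, K^[i] F)
      rw [← congrFun this x]
      exact hK.mono ih x
  have ht : Filter.Tendsto (fun j => r j ^ n * (∑ i ∈ Finset.range n, K^[i] F) x)
      Filter.atTop (nhds (1 ^ n * (∑ i ∈ Finset.range n, K^[i] F) x)) := by
    refine ENNReal.Tendsto.mul_const (ENNReal.Tendsto.pow hr) (Or.inl ?_)
    simp
  rw [one_pow, one_mul] at ht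
  exact le_of_tendsto' ht fun j => (key j n x).trans (h j)

end PosOp

/-! ### Memoryless policies and optimal reachability probabilities. -/

namespace MDP

open Classical

variable {S A : Type*} [Fintype S]

theorem tsum_P_of_enabled {M : MDP S A} {s : S} {α : A} (h : M.Enabled s α) :
    ∑' t, M.P s α t = 1 := by
  rw [tsum_fintype]; exact h

theorem P_of_not_enabled {M : MDP S A} {s : S} {α : A} (h : ¬ M.Enabled s α) (t : S) :
    M.P s α t = 0 := by
  have := (M.sum_P s α).resolve_right h
  exact (Finset.sum_eq_zero_iff.1 this) t (Finset.mem_univ t)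

theorem tsum_P_le_one (M : MDP S A) (s : S) (α : A) : ∑' t, M.P s α t ≤ 1 := by
  rw [tsum_fintype]
  rcases M.sum_P s α with h | h <;> simp [h]

/-- `d` is a memoryless policy, given by its action probabilities. -/
structure IsRule (M : MDP S A) (d : S → A → ℝ≥0∞) : Prop where
  sum : ∀ s, ¬ M.Terminal s → ∑' α, d s α = 1
  enabled : ∀ s α, d s α ≠ 0 → M.Enabled s α

theorem IsRule.terminal {M : MDP S A} {d : S → A → ℝ≥0∞} (hd : M.IsRule d) {s : S}
    (h : M.Terminal s) (α : A) : d s α = 0 := by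
  by_contra h'
  exact h α (hd.enabled s α h')

theorem IsRule.sum_le_one {M : MDP S A} {d : S → A → ℝ≥0∞} (hd : M.IsRule d) (s : S) :
    ∑' α, d s α ≤ 1 := by
  by_cases h : M.Terminal s
  · simp [hd.terminal h]
  · exact (hd.sum s h).le

theorem Policy.sum_act_le_one {M : MDP S A} (σ : M.Policy) (π : History S A) :
    ∑' α, σ.act π α ≤ 1 := by
  by_cases h : M.Terminal π.last
  · simp [σ.act_terminal h]
  · exact (σ.tsum_act h).le

/-- The transition operator of a memoryless policy, killed in `D`. -/
noncomputable def ruleOp (M : MDP S A) (d : S → A → ℝ≥0∞) (D : Set S) (F : S → ℝ≥0∞) (s : S) :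
    ℝ≥0∞ :=
  if s ∈ D then 0 else ∑' α, d s α * ∑' t, M.P s α t * F t

theorem isPosOp_ruleOp (M : MDP S A) (d : S → A → ℝ≥0∞) (D : Set S) :
    IsPosOp (M.ruleOp d D) := by
  have : M.ruleOp d D = fun F s => ∑' i : A × S,
      (if s ∈ D then 0 else d s i.1 * M.P s i.1 i.2) * F i.2 := by
    funext F s
    unfold ruleOp
    split_ifs with h
    · simp
    · rw [ENNReal.tsum_prod']
      refine tsum_congr fun α => ?_
      rw [← ENNReal.tsum_mul_left]
      simp only [mul_assoc]
  rw [this]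
  exact isPosOp_kernel _ _

/-- The probability to reach `E` under a memoryless policy. -/
noncomputable def value (M : MDP S A) (d : S → A → ℝ≥0∞) (E : Set S) (s : S) : ℝ≥0∞ :=
  green (M.ruleOp d E) (fun s => if s ∈ E then 1 else 0) s

theorem IsRule.exists_policy {M : MDP S A} {d : S → A → ℝ≥0∞} (hd : M.IsRule d) :
    ∃ σ : M.Policy, ∀ (E : Set S) (π : History S A), σ.reach E π = M.value d E π.last := by
  obtain ⟨σ, hσ⟩ := MDP.exists_policy (M := M) (fun π α => d π.last α)
    (fun π h => hd.sum _ h) (fun π α h => hd.enabled _ _ h)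
  refine ⟨σ, fun E π => ?_⟩
  rw [σ.reach_eq_green]
  unfold value
  rw [← green_comp (K := σ.op E) (L := M.ruleOp d E) History.last]
  · rfl
  · intro F
    funext π
    simp [Policy.op, ruleOp, hσ, History.last]

/-- The rule that belongs to a choice function. -/
noncomputable def detRule (f : S → Option A) (s : S) (α : A) : ℝ≥0∞ := if f s = some α then 1 else 0

theorem tsum_detRule_mul {S A : Type*} {f : S → Option A} {s : S} {α : A} (h : f s = some α) (F : A → ℝ≥0∞) :
    ∑' β, detRule f s β * F β = F α := by
  rw [tsum_eq_single α]
  · simp [detRule, h]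
  · intro β hβ
    have : ¬ α = β := fun h => hβ h.symm
    simp [detRule, h, this]

theorem exists_choice (M : MDP S A) (p : S → A → Prop)
    (h : ∀ s, ¬ M.Terminal s → ∃ α, M.Enabled s α ∧ p s α) :
    ∃ f : S → Option A, M.IsRule (detRule f) ∧ ∀ s, ¬ M.Terminal s →
      ∃ α, f s = some α ∧ M.Enabled s α ∧ p s α := by
  choose g hg using h
  let f : S → Option A := fun s => if h : M.Terminal s then none else some (g s h)
  have hf : ∀ s (h : ¬ M.Terminal s), f s = some (g s h) := fun s h => by simp [f, h]
  refine ⟨f, ⟨fun s h => ?_, fun s α h => ?_⟩, fun s h => ⟨g s h, hf s h, hg s h⟩⟩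
  · have := tsum_detRule_mul (hf s h) (fun _ => 1)
    simpa using this
  · by_cases ht : M.Terminal s
    · simp [detRule, f, ht] at h
    · have : g s ht = α := by
        by_contra h'
        simp [detRule, hf s ht, h'] at h
      rw [← this]
      exact (hg s ht).1

section Optimal

variable [Finite A] (M : MDP S A) (E : Set S)

/-- The minimal reachability probabilities are attained by a memoryless policy. -/
theorem exists_min_rule : ∃ d, M.IsRule d ∧ ∀ (σ : M.Policy) (π : History S A),
    M.value d E π.last ≤ σ.reach E π := by
  -- The Bellman operator. For minimization its least fixed point is the right value, and a greedy
  -- choice is optimal without discounting.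
  let T : (S → ℝ≥0∞) →o (S → ℝ≥0∞) :=
    { toFun := fun V s => if s ∈ E then 1 else if M.Terminal s then 0 else
        ⨅ α : {α // M.Enabled s α}, ∑' t, M.P s α.1 t * V t
      monotone' := by
        intro V W h s
        dsimp only
        split_ifs
        · rfl
        · rfl
        · exact iInf_mono fun α => ENNReal.tsum_le_tsum fun t => mul_le_mul_right (h t) _ }
  have hT : ∀ W s, T W s = if s ∈ E then 1 else if M.Terminal s then 0 else
      ⨅ α : {α // M.Enabled s α}, ∑' t, M.P s α.1 t * W t := fun _ _ => rfl
  set V := T.lfp with hV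
  have hfix : ∀ s, V s = T V s := fun s => (congrFun T.map_lfp s).symm
  obtain ⟨f, hf, hf'⟩ := M.exists_choice
    (fun s α => ∑' t, M.P s α t * V t = ⨅ α : {α // M.Enabled s α}, ∑' t, M.P s α.1 t * V t) (by
      intro s hs
      have : Nonempty {α // M.Enabled s α} := by
        unfold Terminal at hs
        push Not at hs
        obtain ⟨α, hα⟩ := hs
        exact ⟨α, hα⟩
      obtain ⟨α, hα⟩ := exists_eq_ciInf_of_finite
        (f := fun α : {α // M.Enabled s α} => ∑' t, M.P s α.1 t * V t)
      exact ⟨α, α.2, hα⟩)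
  refine ⟨detRule f, hf, fun σ π => ?_⟩
  have h1 : M.value (detRule f) E π.last ≤ V π.last := by
    refine (M.isPosOp_ruleOp _ E).green_le (fun s => ?_) _
    rw [hfix s]
    by_cases hs : s ∈ E
    · simp [hs, T, ruleOp]
    · by_cases ht : M.Terminal s
      · simp [hs, ruleOp, hf.terminal ht]
      · obtain ⟨α, hα, -, hα'⟩ := hf' s ht
        simp only [hs, if_false, zero_add, ruleOp]
        rw [tsum_detRule_mul hα (fun α => ∑' t, M.P s α t * V t)]
        rw [hT, if_neg hs, if_neg ht, hα']
  refine h1.trans ?_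
  -- The infimum over all histories that end in `s` makes the value of a history-dependent policy a
  -- function of the state. It is a prefixed point of `T`, hence above the least fixed point.
  let g : S → ℝ≥0∞ := fun s => ⨅ π : {π : History S A // π.last = s}, σ.reach E π.1
  have hg : T.lfp ≤ g := by
    refine T.lfp_le fun s => le_iInf ?_
    rintro ⟨π, rfl⟩
    dsimp only
    by_cases hs : π.last ∈ E
    · simp [hT, hs, σ.reach_of_mem]
    · by_cases ht : M.Terminal π.last
      · simp [hT, hs, ht]
      · rw [σ.reach_of_notMem hs]
        rw [hT, if_neg hs, if_neg ht]
        simp only [hs, if_false, Policy.op]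
        calc _ = ∑' α, σ.act π α * ⨅ α : {α // M.Enabled π.last α},
              ∑' t, M.P π.last α.1 t * g t := by
              rw [ENNReal.tsum_mul_right, σ.tsum_act ht, one_mul]
          _ ≤ _ := by
              refine ENNReal.tsum_le_tsum fun α => ?_
              by_cases hα : σ.act π α = 0
              · simp [hα]
              · refine mul_le_mul_right ?_ _
                refine (iInf_le _ ⟨α, Policy.act_enabled hα⟩).trans ?_
                refine ENNReal.tsum_le_tsum fun t => mul_le_mul_right ?_ _
                exact iInf_le _ (⟨π.snoc α t, rfl⟩ : {π : History S A // π.last = t})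
  exact (hg π.last).trans (iInf_le _ (⟨π, rfl⟩ : {π' : History S A // π'.last = π.last}))

/-- Without a discount, a greedy action for the maximum may preserve the value while circling
forever. With `r < 1` the postponed value after `n` steps is at most `r ^ n`, so the greedy rule
attains the discounted optimum; dropping the discount only increases its value. -/
theorem exists_discounted_max_rule {r : ℝ≥0∞} (hr : r < 1) :
    ∃ f : S → Option A, M.IsRule (detRule f) ∧ ∀ (σ : M.Policy) (π : History S A),
      green (fun F π => r * σ.op E F π) (fun π => if π.last ∈ E then 1 else 0) π ≤
        M.value (detRule f) E π.last := by
  let T : (S → ℝ≥0∞) →o (S → ℝ≥0∞) :=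
    { toFun := fun V s => if s ∈ E then 1 else r * ⨆ α, ∑' t, M.P s α t * V t
      monotone' := by
        intro V W h s
        dsimp only
        split_ifs
        · rfl
        · exact mul_le_mul_right (iSup_mono fun α => ENNReal.tsum_le_tsum fun t =>
            mul_le_mul_right (h t) _) _ }
  have hT : ∀ W s, T W s = if s ∈ E then 1 else r * ⨆ α, ∑' t, M.P s α t * W t :=
    fun _ _ => rfl
  set V := T.lfp with hV
  have hfix : ∀ s, V s = T V s := fun s => (congrFun T.map_lfp s).symm
  have hV1 : V ≤ fun _ => 1 := by
    refine T.lfp_le fun s => ?_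
    rw [hT]
    split_ifs
    · rfl
    · refine mul_le_one' hr.le (iSup_le fun α => ?_)
      simpa using M.tsum_P_le_one s α
  obtain ⟨f, hf, hf'⟩ := M.exists_choice
    (fun s α => ∑' t, M.P s α t * V t = ⨆ α, ∑' t, M.P s α t * V t) (by
      intro s hs
      have : ∃ α, M.Enabled s α := by
        unfold Terminal at hs
        push Not at hs
        exact hs
      obtain ⟨β, hβ⟩ := this
      have : Nonempty A := ⟨β⟩
      obtain ⟨α, hα⟩ := exists_eq_ciSup_of_finite
        (f := fun α => ∑' t, M.P s α t * V t)
      by_cases he : M.Enabled s α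
      · exact ⟨α, he, hα⟩
      · refine ⟨β, hβ, le_antisymm (le_iSup (fun α => ∑' t, M.P s α t * V t) β) ?_⟩
        rw [← hα]
        simp [P_of_not_enabled he])
  refine ⟨f, hf, fun σ π => ?_⟩
  set K : (S → ℝ≥0∞) → S → ℝ≥0∞ := fun F s => r * M.ruleOp (detRule f) E F s
  have hK : IsPosOp K := (M.isPosOp_ruleOp _ E).const_mul r
  set F₀ : S → ℝ≥0∞ := fun s => if s ∈ E then 1 else 0
  have hVle : ∀ s, V s ≤ F₀ s + K V s := by
    intro s
    conv_lhs => rw [hfix s]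
    by_cases hs : s ∈ E
    · simp [hT, hs, F₀]
    · by_cases ht : M.Terminal s
      · simp [hT, hs, P_of_not_enabled (ht _)]
      · obtain ⟨α, hα, -, hα'⟩ := hf' s ht
        simp only [hs, if_false, zero_add, ruleOp, F₀, K]
        rw [tsum_detRule_mul hα (fun α => ∑' t, M.P s α t * V t)]
        rw [hT, if_neg hs, hα']
  have hconst : ∀ (c : ℝ≥0∞) s, K (fun _ => c) s ≤ r * c := by
    intro c s
    refine mul_le_mul_right ?_ _
    unfold ruleOp
    split_ifs
    · simp
    · calc ∑' α, detRule f s α * ∑' t, M.P s α t * c ≤ ∑' α, detRule f s α * c := by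
            refine ENNReal.tsum_le_tsum fun α => mul_le_mul_right ?_ _
            rw [ENNReal.tsum_mul_right]
            exact mul_le_of_le_one_left' (M.tsum_P_le_one s α)
        _ ≤ c := by
            rw [ENNReal.tsum_mul_right]
            exact mul_le_of_le_one_left' (hf.sum_le_one s)
  -- Unfolding `V ≤ F₀ + K V` `n` times leaves the remainder `K^[n] V ≤ r ^ n`.
  have happ : ∀ n s, V s ≤ green K F₀ s + r ^ n := by
    intro n
    induction n with
    | zero => intro s; exact le_add_left (by simpa using hV1 s)
    | succ n ih =>
      intro s
      refine (hVle s).trans ?_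
      rw [hK.green_eq, add_assoc]
      refine add_le_add le_rfl ?_
      refine (hK.mono (show V ≤ green K F₀ + fun _ => r ^ n from ih) s).trans ?_
      rw [hK.add, pow_succ']
      exact add_le_add le_rfl (hconst _ s)
  have hVg : ∀ s, V s ≤ green K F₀ s := by
    intro s
    have ht : Filter.Tendsto (fun n => green K F₀ s + r ^ n) Filter.atTop
        (nhds (green K F₀ s + 0)) :=
      tendsto_const_nhds.add (ENNReal.tendsto_pow_atTop_nhds_zero_of_lt_one hr)
    rw [add_zero] at ht
    exact ge_of_tendsto' ht fun n => happ n s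
  have hgv : ∀ s, green K F₀ s ≤ M.value (detRule f) E s := by
    refine hK.green_le fun s => ?_
    have hR := M.isPosOp_ruleOp (detRule f) E
    conv_rhs => rw [value, hR.green_eq]
    refine add_le_add le_rfl ?_
    exact mul_le_of_le_one_left' hr.le
  refine le_trans ?_ ((hVg _).trans (hgv _))
  -- The optimal discounted value is a supersolution for every policy.
  refine ((σ.isPosOp_op E).const_mul r).green_le (f := fun π => V π.last) (fun π => ?_) π
  rw [hfix π.last, hT]
  by_cases hs : π.last ∈ E
  · simp [hs, Policy.op]
  · simp only [hs, if_false, zero_add, Policy.op]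
    refine mul_le_mul_right ?_ _
    calc _ ≤ ∑' α, σ.act π α * ⨆ α, ∑' t, M.P π.last α t * V t :=
          ENNReal.tsum_le_tsum fun α => mul_le_mul_right
            (le_iSup (fun α => ∑' t, M.P π.last α t * V t) α) _
      _ ≤ _ := by
          rw [ENNReal.tsum_mul_right]
          exact mul_le_of_le_one_left' (σ.sum_act_le_one π)

/-- The maximal reachability probabilities are attained by a memoryless policy. -/
theorem exists_max_rule : ∃ d, M.IsRule d ∧ ∀ (σ : M.Policy) (π : History S A),
    σ.reach E π ≤ M.value d E π.last := by
  let r : ℕ → ℝ≥0∞ := fun j => 1 - ((j + 1 : ℕ) : ℝ≥0∞)⁻¹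
  have hr1 : ∀ j, r j < 1 := fun j => ENNReal.sub_lt_self (by simp) (by simp) (by simp)
  have hmono : Monotone r := fun i j h => by
    refine tsub_le_tsub_left (ENNReal.inv_le_inv.2 ?_) _
    exact_mod_cast Nat.succ_le_succ h
  have hlim : Filter.Tendsto r Filter.atTop (nhds 1) := by
    have h : Filter.Tendsto (fun j : ℕ => ((j + 1 : ℕ) : ℝ≥0∞)⁻¹) Filter.atTop (nhds 0) :=
      ENNReal.tendsto_inv_nat_nhds_zero.comp (Filter.tendsto_add_atTop_nat 1)
    have := ENNReal.Tendsto.sub (tendsto_const_nhds (x := (1 : ℝ≥0∞))) h (Or.inl (by simp))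
    simpa [r] using this
  choose f hf hf' using fun j => M.exists_discounted_max_rule E (hr1 j)
  -- There are finitely many choice functions, so one of them serves infinitely many discounts
  -- tending to 1. Each discount `r j` lies below a later one served by `g`; Abel summation then
  -- removes the discount.
  obtain ⟨g, hg⟩ := Finite.exists_infinite_fiber f
  rw [Set.infinite_coe_iff] at hg
  obtain ⟨j₀, hj₀⟩ := hg.nonempty
  refine ⟨detRule g, ?_, fun σ π => ?_⟩
  · have : f j₀ = g := hj₀
    rw [← this]
    exact hf j₀
  · rw [σ.reach_eq_green]
    refine (σ.isPosOp_op E).green_le_of_discounted r (fun j => (hr1 j).le) hlim fun j => ?_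
    obtain ⟨i, hi, hij⟩ := hg.exists_gt j
    have hi' : f i = g := hi
    have h := hf' i σ π
    rw [hi'] at h
    refine le_trans ?_ h
    refine ((σ.isPosOp_op E).const_mul (r j)).green_le (fun π => ?_) π
    conv_rhs => rw [((σ.isPosOp_op E).const_mul (r i)).green_eq]
    exact add_le_add le_rfl (mul_le_mul_left (hmono hij.le) _)

/-- The bounds are needed after every history `π`, not only from a starting state: they are applied
to the residual probability at the entrance to `C`. -/
theorem exists_optimal_rules : ∃ dmin dmax, M.IsRule dmin ∧ M.IsRule dmax ∧
    (∀ s, M.prMin E s = M.value dmin E s) ∧ (∀ s, M.prMax E s = M.value dmax E s) ∧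
    ∀ (σ : M.Policy) (π : History S A),
      M.prMin E π.last ≤ σ.reach E π ∧ σ.reach E π ≤ M.prMax E π.last := by
  obtain ⟨d₁, h₁, h₁'⟩ := M.exists_min_rule E
  obtain ⟨d₂, h₂, h₂'⟩ := M.exists_max_rule E
  obtain ⟨σ₁, hσ₁⟩ := h₁.exists_policy
  obtain ⟨σ₂, hσ₂⟩ := h₂.exists_policy
  have e₁ : ∀ s, M.prMin E s = M.value d₁ E s := fun s =>
    le_antisymm (iInf_le_of_le σ₁ (hσ₁ E (.start s)).le) (le_iInf fun σ => h₁' σ (.start s))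
  have e₂ : ∀ s, M.prMax E s = M.value d₂ E s := fun s =>
    le_antisymm (iSup_le fun σ => h₂' σ (.start s)) (le_iSup_of_le σ₂ (hσ₂ E (.start s)).ge)
  exact ⟨d₁, d₂, h₁, h₂, e₁, e₂, fun σ π => ⟨(e₁ _).trans_le (h₁' σ π),
    (h₂' σ π).trans (e₂ _).ge⟩⟩

end Optimal

end MDP

namespace MDP

open Classical

/-! ### End components -/

section EC

variable {S A : Type*} [Fintype S] {M : MDP S A}

theorem IsEC.exists_pair {T : Set S} {B : Set (S × A)} (h : M.IsEC T B) {s : S} (hs : s ∈ T) :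
    ∃ α, (s, α) ∈ B := by
  obtain ⟨⟨u, β⟩, hu⟩ := h.nonempty
  rcases Relation.ReflTransGen.cases_head (h.connected s hs u (h.mem _ _ hu)) with rfl | ⟨_, hr, -⟩
  · exact ⟨β, hu⟩
  · exact ⟨hr.choose, hr.choose_spec.1⟩

theorem IsEC.union {T₁ T₂ : Set S} {B₁ B₂ : Set (S × A)} (h₁ : M.IsEC T₁ B₁) (h₂ : M.IsEC T₂ B₂)
    {s : S} (hs₁ : s ∈ T₁) (hs₂ : s ∈ T₂) : M.IsEC (T₁ ∪ T₂) (B₁ ∪ B₂) where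
  mem u α h := h.imp (h₁.mem u α) (h₂.mem u α)
  enabled u α h := h.elim (h₁.enabled u α) (h₂.enabled u α)
  closed u α h t ht := h.imp (fun h => h₁.closed u α h t ht) (fun h => h₂.closed u α h t ht)
  nonempty := h₁.nonempty.inl
  connected := by
    have m₁ : ∀ u ∈ T₁, ∀ v ∈ T₁, Relation.ReflTransGen
        (fun u v => ∃ α, (u, α) ∈ B₁ ∪ B₂ ∧ M.P u α v ≠ 0) u v := fun u hu v hv =>
      Relation.ReflTransGen.mono (fun _ _ ⟨α, h, h'⟩ => ⟨α, Or.inl h, h'⟩) _ _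
        (h₁.connected u hu v hv)
    have m₂ : ∀ u ∈ T₂, ∀ v ∈ T₂, Relation.ReflTransGen
        (fun u v => ∃ α, (u, α) ∈ B₁ ∪ B₂ ∧ M.P u α v ≠ 0) u v := fun u hu v hv =>
      Relation.ReflTransGen.mono (fun _ _ ⟨α, h, h'⟩ => ⟨α, Or.inr h, h'⟩) _ _
        (h₂.connected u hu v hv)
    rintro u (hu | hu) v (hv | hv)
    · exact m₁ u hu v hv
    · exact (m₁ u hu s hs₁).trans (m₂ s hs₂ v hv)
    · exact (m₂ u hu s hs₂).trans (m₁ s hs₁ v hv)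
    · exact m₂ u hu v hv

theorem MEC.isEC (e : M.MEC) : M.IsEC e.states e.pairs := e.2.prop

theorem MEC.eq_of_mem {e₁ e₂ : M.MEC} {s : S} (h₁ : s ∈ e₁.states) (h₂ : s ∈ e₂.states) :
    e₁ = e₂ := by
  have hu := e₁.isEC.union e₂.isEC h₁ h₂
  have l₁ : e₁.1 = (e₁.states ∪ e₂.states, e₁.pairs ∪ e₂.pairs) :=
    e₁.2.eq_of_le hu ⟨Set.subset_union_left, Set.subset_union_left⟩
  have l₂ : e₂.1 = (e₁.states ∪ e₂.states, e₁.pairs ∪ e₂.pairs) :=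
    e₂.2.eq_of_le hu ⟨Set.subset_union_right, Set.subset_union_right⟩
  exact Subtype.ext (l₁.trans l₂.symm)

theorem IsEC.exists_mec [Finite A] {T : Set S} {B : Set (S × A)} (h : M.IsEC T B) :
    ∃ e : M.MEC, B ⊆ e.pairs := by
  obtain ⟨e, hle, he⟩ := Set.Finite.exists_le_maximal
    (s := {e : Set S × Set (S × A) | M.IsEC e.1 e.2}) (Set.toFinite _) (a := (T, B)) h
  exact ⟨⟨e, he⟩, hle.2⟩

/-- The state-action pair `(s, α)` belongs to an end component. -/
def Inner (M : MDP S A) (s : S) (α : A) : Prop := ∃ e : M.MEC, (s, α) ∈ e.pairs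

end EC

/-! ### The MDP after the first step, and its end components. -/

section Minmax

variable {S A : Type*} [Fintype S] {M : MDP S A} {C E : Set S}

theorem minmax_P_orig {s t : S} {α : A} (hs : s ∉ C) :
    (M.minmax C E).P (.orig s) (.orig α) (.orig t) = M.P s α t := if_neg hs

theorem tsum_MMState (f : MMState S → ℝ≥0∞) :
    ∑' x, f x = (∑' s, f (.orig s)) + f .TP + f .FP := by
  rw [tsum_fintype, tsum_fintype, sum_MMState]

theorem tsum_minmax_orig {s : S} (hs : s ∉ C) (α : A) (F : MMState S → ℝ≥0∞) :
    ∑' t, (M.minmax C E).P (.orig s) (.orig α) t * F t = ∑' t, M.P s α t * F (.orig t) := by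
  rw [tsum_MMState]
  simp only [minmax_P_orig hs]
  simp [minmax, minmaxP]

theorem tsum_minmax_amin {s : S} (hs : s ∈ C) (F : MMState S → ℝ≥0∞) :
    ∑' t, (M.minmax C E).P (.orig s) .amin t * F t =
      M.prMin E s * F .TP + (1 - M.prMin E s) * F .FP := by
  rw [tsum_MMState]
  simp [minmax, minmaxP, hs]

theorem tsum_minmax_amax {s : S} (hs : s ∈ C) (F : MMState S → ℝ≥0∞) :
    ∑' t, (M.minmax C E).P (.orig s) .amax t * F t =
      M.prMax E s * F .TP + (1 - M.prMax E s) * F .FP := by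
  rw [tsum_MMState]
  simp [minmax, minmaxP, hs]

theorem enabled_iff_tsum {M : MDP S A} {s : S} {α : A} :
    M.Enabled s α ↔ ∑' t, M.P s α t * 1 = 1 := by
  simp [Enabled, tsum_fintype]

theorem minmax_enabled_orig {s : S} {α : A} :
    (M.minmax C E).Enabled (.orig s) (.orig α) ↔ s ∉ C ∧ M.Enabled s α := by
  by_cases hs : s ∈ C
  · have : ∀ t, (M.minmax C E).P (.orig s) (.orig α) t = 0 := by
      rintro (_ | _ | _) <;> simp [minmax, minmaxP, hs]
    simp [Enabled, this, hs]
  · rw [enabled_iff_tsum, tsum_minmax_orig hs α (fun _ => 1), ← enabled_iff_tsum]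
    simp [hs]

theorem minmax_enabled_amin {s : S} : (M.minmax C E).Enabled (.orig s) .amin ↔ s ∈ C := by
  by_cases hs : s ∈ C
  · rw [enabled_iff_tsum, tsum_minmax_amin hs (fun _ => 1)]
    simp [hs, add_tsub_cancel_of_le (M.prMin_le_one E s)]
  · have : ∀ t, (M.minmax C E).P (.orig s) .amin t = 0 := by
      rintro (_ | _ | _) <;> simp [minmax, minmaxP, hs]
    simp [Enabled, this, hs]

theorem minmax_enabled_amax {s : S} : (M.minmax C E).Enabled (.orig s) .amax ↔ s ∈ C := by
  by_cases hs : s ∈ C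
  · rw [enabled_iff_tsum, tsum_minmax_amax hs (fun _ => 1)]
    simp [hs, add_tsub_cancel_of_le (M.prMax_le_one E s)]
  · have : ∀ t, (M.minmax C E).P (.orig s) .amax t = 0 := by
      rintro (_ | _ | _) <;> simp [minmax, minmaxP, hs]
    simp [Enabled, this, hs]

theorem minmax_terminal_TP : (M.minmax C E).Terminal .TP := fun α => by
  have : ∀ t, (M.minmax C E).P .TP α t = 0 := by
    rintro (_ | _ | _) <;> simp [minmax, minmaxP]
  simp [Enabled, this]

theorem minmax_terminal_FP : (M.minmax C E).Terminal .FP := fun α => by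
  have : ∀ t, (M.minmax C E).P .FP α t = 0 := by
    rintro (_ | _ | _) <;> simp [minmax, minmaxP]
  simp [Enabled, this]

theorem minmax_terminal_orig {s : S} :
    (M.minmax C E).Terminal (.orig s) ↔ s ∉ C ∧ M.Terminal s := by
  constructor
  · intro h
    have hs : s ∉ C := fun hs => h .amin (minmax_enabled_amin.2 hs)
    exact ⟨hs, fun α hα => h (.orig α) (minmax_enabled_orig.2 ⟨hs, hα⟩)⟩
  · rintro ⟨hs, ht⟩ (α | _ | _)
    · exact fun h => ht α (minmax_enabled_orig.1 h).2
    · exact fun h => hs (minmax_enabled_amin.1 h)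
    · exact fun h => hs (minmax_enabled_amax.1 h)

theorem mec_not_terminal {M : MDP S A} (e : M.MEC) {s : S} (hs : s ∈ e.states) :
    ¬ M.Terminal s := fun h => by
  obtain ⟨α, hα⟩ := e.isEC.exists_pair hs
  exact h α (e.isEC.enabled _ _ hα)

/-- The fresh actions lead only to `TP` and `FP`, with total probability 1, so a closed set
containing such a pair contains a terminal state. End components have none. In particular they avoid
`C`. -/
theorem mec_pair_orig (e : (M.minmax C E).MEC) {s : MMState S} {α : MMAct A}
    (h : (s, α) ∈ e.pairs) : ∃ s' α', s = .orig s' ∧ α = .orig α' ∧ s' ∉ C := by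
  have hen := e.isEC.enabled _ _ h
  have hTP : MMState.TP ∉ e.states := fun h => mec_not_terminal e h minmax_terminal_TP
  have hFP : MMState.FP ∉ e.states := fun h => mec_not_terminal e h minmax_terminal_FP
  have hc := e.isEC.closed _ _ h
  have hz : (M.minmax C E).P s α .TP = 0 ∧ (M.minmax C E).P s α .FP = 0 :=
    ⟨by by_contra h; exact hTP (hc _ h), by by_contra h; exact hFP (hc _ h)⟩
  rcases s with s | _ | _
  · rcases α with α | _ | _
    · exact ⟨s, α, rfl, rfl, (minmax_enabled_orig.1 hen).1⟩
    · have hs := minmax_enabled_amin.1 hen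
      have := tsum_minmax_amin (M := M) (E := E) hs (fun _ => 1)
      simp only [minmax, minmaxP, hs, if_true] at hz
      rw [← enabled_iff_tsum.1 hen, tsum_minmax_amin hs] at this
      have := add_tsub_cancel_of_le (M.prMin_le_one E s)
      rw [hz.2, hz.1] at this
      simp at this
    · have hs := minmax_enabled_amax.1 hen
      simp only [minmax, minmaxP, hs, if_true] at hz
      have := add_tsub_cancel_of_le (M.prMax_le_one E s)
      rw [hz.2, hz.1] at this
      simp at this
  · exact absurd hen (minmax_terminal_TP α)
  · exact absurd hen (minmax_terminal_FP α)

theorem mec_state_orig (e : (M.minmax C E).MEC) {s : MMState S} (h : s ∈ e.states) :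
    ∃ s', s = .orig s' ∧ s' ∉ C ∧ ¬ M.Terminal s' := by
  obtain ⟨α, hα⟩ := e.isEC.exists_pair h
  obtain ⟨s', α', rfl, rfl, hs⟩ := mec_pair_orig e hα
  exact ⟨s', rfl, hs, fun ht => ht α' (minmax_enabled_orig.1 (e.isEC.enabled _ _ hα)).2⟩

/-! ### The canonical MDP -/

theorem collapse_mec (hE : ∀ e ∈ E, M.Terminal e) {e : (M.minmax C E).MEC} {s : MMState S}
    (h : s ∈ e.states) : M.collapse C E s = .mec e := by
  obtain ⟨s', rfl, hs, ht⟩ := mec_state_orig e h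
  have h1 : s' ∉ E := fun h => ht (hE _ h)
  have h2 : ¬ (M.minmax C E).Terminal (.orig s') := fun h => ht (minmax_terminal_orig.1 h).2
  have h3 : ∃ e : (M.minmax C E).MEC, MMState.orig s' ∈ e.states := ⟨e, h⟩
  simp only [collapse, h1, h2, h3, dif_pos, dif_neg, not_false_eq_true]
  rw [MEC.eq_of_mem h3.choose_spec h]

theorem mem_of_collapse_mec {e : (M.minmax C E).MEC} {s : MMState S}
    (h : M.collapse C E s = .mec e) : s ∈ e.states := by
  rcases s with s | _ | _
  · simp only [collapse] at h
    split_ifs at h with h1 h2 h3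
    have := h3.choose_spec
    simp only [CanState.mec.injEq] at h
    rwa [h] at this
  · simp [collapse] at h
  · simp [collapse] at h

theorem eq_of_collapse_keep {k : {s : S // M.Kept C E s}} {s : MMState S}
    (h : M.collapse C E s = .keep k) : s = .orig k := by
  rcases s with s | _ | _
  · simp only [collapse] at h
    split_ifs at h with h1 h2 h3
    simp only [CanState.keep.injEq] at h
    rw [← h]
  · simp [collapse] at h
  · simp [collapse] at h

theorem collapse_eq_FN {s : S} : M.collapse C E (.orig s) = .FN ↔ s ∈ E := by
  simp only [collapse]
  split_ifs with h1 h2 h3 <;> simp [h1]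

theorem collapse_of_mem {s : S} (hs : s ∈ E) : M.collapse C E (.orig s) = .FN :=
  collapse_eq_FN.2 hs

theorem collapse_of_terminal {s : S} (hs : s ∉ E) (hc : s ∉ C) (ht : M.Terminal s) :
    M.collapse C E (.orig s) = .TN := by
  have := minmax_terminal_orig (M := M) (E := E).2 ⟨hc, ht⟩
  simp [collapse, hs, this]

theorem terminal_of_collapse_TN {s : MMState S} (h : M.collapse C E s = .TN) :
    (M.minmax C E).Terminal s := by
  rcases s with s | _ | _
  · simp only [collapse] at h
    split_ifs at h with h1 h2 h3
    exact h2
  · simp [collapse] at h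
  · simp [collapse] at h

theorem collapse_orig_ne_TP {s : S} : M.collapse C E (.orig s) ≠ .TP := by
  simp only [collapse]
  split_ifs <;> simp

theorem collapse_orig_ne_FP {s : S} : M.collapse C E (.orig s) ≠ .FP := by
  simp only [collapse]
  split_ifs <;> simp

theorem not_terminal_of_collapse {s : MMState S} {x : M.CanState C E}
    (h : M.collapse C E s = x) (hTP : x ≠ .TP) (hFP : x ≠ .FP) (hFN : x ≠ .FN) (hTN : x ≠ .TN) :
    ¬ (M.minmax C E).Terminal s := by
  subst h
  rcases s with s | _ | _
  · simp only [collapse] at hFN hTN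
    split_ifs at hFN hTN with h1 h2 h3
    all_goals first | exact absurd rfl hFN | exact absurd rfl hTN | assumption
  · exact absurd rfl hTP
  · exact absurd rfl hFP

theorem collapse_eq_of_inner (hE : ∀ e ∈ E, M.Terminal e) {s t : MMState S} {α : MMAct A}
    (h : (M.minmax C E).Inner s α) (ht : (M.minmax C E).P s α t ≠ 0) :
    M.collapse C E t = M.collapse C E s := by
  obtain ⟨e, he⟩ := h
  rw [collapse_mec hE (e.isEC.mem _ _ he), collapse_mec hE (e.isEC.closed _ _ he _ ht)]

theorem collapse_keep (k : {s : S // M.Kept C E s}) : M.collapse C E (.orig k) = .keep k := by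
  obtain ⟨s, h1, h2, h3⟩ := k
  simp only [collapse, h1, h2, h3, dif_neg, not_false_eq_true]

theorem terminal_of_collapse (hE : ∀ e ∈ E, M.Terminal e) (hC : Disjoint C E) {s : MMState S}
    (h : M.collapse C E s = .TP ∨ M.collapse C E s = .FP ∨ M.collapse C E s = .FN ∨
      M.collapse C E s = .TN) : (M.minmax C E).Terminal s := by
  rcases s with s | _ | _
  · rcases h with h | h | h | h
    · exact absurd h collapse_orig_ne_TP
    · exact absurd h collapse_orig_ne_FP
    · have := collapse_eq_FN.1 h
      exact minmax_terminal_orig.2 ⟨fun hc => Set.disjoint_left.1 hC hc this, hE _ this⟩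
    · exact terminal_of_collapse_TN h
  · exact minmax_terminal_TP
  · exact minmax_terminal_FP

variable [Finite A]

theorem tsum_canonical_move {x : M.CanState C E} {s : MMState S} {α : MMAct A}
    (hs : M.collapse C E s = x) (hα : ¬ (M.minmax C E).Inner s α) (F : M.CanState C E → ℝ≥0∞) :
    ∑' y, (M.canonical C E).P x (.move s α) y * F y =
      ∑' t, (M.minmax C E).P s α t * F (M.collapse C E t) := by
  have h : M.collapse C E s = x ∧ ¬ ∃ e : (M.minmax C E).MEC, (s, α) ∈ e.pairs := ⟨hs, hα⟩
  have : ∀ y, (M.canonical C E).P x (.move s α) y =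
      ∑' t, if M.collapse C E t = y then (M.minmax C E).P s α t else 0 := by
    intro y
    rw [tsum_fintype]
    simp only [canonical, canonicalP, if_pos h]
  simp only [this, ← ENNReal.tsum_mul_right]
  rw [ENNReal.tsum_comm]
  refine tsum_congr fun t => ?_
  rw [tsum_eq_single (M.collapse C E t)]
  · simp
  · intro y hy; simp [hy.symm]

theorem canonical_P_move_eq_zero {x y : M.CanState C E} {s : MMState S} {α : MMAct A}
    (h : ¬ (M.collapse C E s = x ∧ ¬ (M.minmax C E).Inner s α)) :
    (M.canonical C E).P x (.move s α) y = 0 := by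
  have h : ¬ (M.collapse C E s = x ∧ ¬ ∃ e : (M.minmax C E).MEC, (s, α) ∈ e.pairs) := h
  simp only [canonical, canonicalP, if_neg h]

theorem canonical_P_move_ne_zero {x : M.CanState C E} {s t : MMState S} {α : MMAct A}
    (hs : M.collapse C E s = x) (hα : ¬ (M.minmax C E).Inner s α)
    (ht : (M.minmax C E).P s α t ≠ 0) :
    (M.canonical C E).P x (.move s α) (M.collapse C E t) ≠ 0 := by
  intro h
  have h1 := tsum_canonical_move hs hα (fun y => if y = M.collapse C E t then 1 else 0)
  rw [tsum_eq_single (M.collapse C E t) (by intro y hy; simp [hy]), h] at h1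
  simp only [zero_mul] at h1
  have := ENNReal.tsum_eq_zero.1 h1.symm t
  simp [ht] at this

theorem exists_of_canonical_P_move {x y : M.CanState C E} {s : MMState S} {α : MMAct A}
    (h : (M.canonical C E).P x (.move s α) y ≠ 0) :
    ∃ t, M.collapse C E t = y ∧ (M.minmax C E).P s α t ≠ 0 := by
  by_contra! hc
  apply h
  simp only [canonical, canonicalP]
  split_ifs
  · refine Finset.sum_eq_zero fun t _ => ?_
    split_ifs with ht
    · exact hc t ht
    · rfl
  · rfl

theorem canonical_enabled_move {x : M.CanState C E} {s : MMState S} {α : MMAct A} :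
    (M.canonical C E).Enabled x (.move s α) ↔
      M.collapse C E s = x ∧ ¬ (M.minmax C E).Inner s α ∧ (M.minmax C E).Enabled s α := by
  by_cases h : M.collapse C E s = x ∧ ¬ (M.minmax C E).Inner s α
  · rw [enabled_iff_tsum, tsum_canonical_move h.1 h.2 (fun _ => 1), ← enabled_iff_tsum]
    simp [h]
  · simp only [Enabled, canonical_P_move_eq_zero h]
    simp only [Finset.sum_const_zero, zero_ne_one, false_iff]
    exact fun h' => h ⟨h'.1, h'.2.1⟩

theorem tsum_canonical_tau (e : (M.minmax C E).MEC) (F : M.CanState C E → ℝ≥0∞) :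
    ∑' y, (M.canonical C E).P (.mec e) .tau y * F y = F .TN := by
  rw [tsum_eq_single .TN]
  · simp [canonical, canonicalP]
  · rintro (_ | _ | _ | _ | _ | _) h <;> first | exact absurd rfl h | simp [canonical, canonicalP]

theorem canonical_enabled_tau {x : M.CanState C E} :
    (M.canonical C E).Enabled x .tau ↔ ∃ e, x = .mec e := by
  rcases x with _ | e | _ | _ | _ | _
  case mec =>
    simp only [CanState.mec.injEq, exists_eq', iff_true]
    rw [enabled_iff_tsum, tsum_canonical_tau]
  all_goals simp [Enabled, canonical, canonicalP]

theorem canonical_terminal_iff (hE : ∀ e ∈ E, M.Terminal e) (hC : Disjoint C E)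
    {x : M.CanState C E} :
    (M.canonical C E).Terminal x ↔ x = .TP ∨ x = .FP ∨ x = .FN ∨ x = .TN := by
  constructor
  · intro h
    rcases x with k | e | _ | _ | _ | _
    · exfalso
      have h2 := k.2.2.1
      unfold Terminal at h2
      push Not at h2
      obtain ⟨α, hα⟩ := h2
      refine h (.move (.orig k) α) (canonical_enabled_move.2 ⟨collapse_keep k, ?_, hα⟩)
      rintro ⟨e, he⟩
      exact k.2.2.2 ⟨e, e.isEC.mem _ _ he⟩
    · exact absurd (canonical_enabled_tau.2 ⟨e, rfl⟩) (h .tau)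
    all_goals simp
  · rintro h (⟨s, α⟩ | _) hen
    · obtain ⟨rfl, -, hα⟩ := canonical_enabled_move.1 hen
      exact terminal_of_collapse hE hC h α hα
    · obtain ⟨e, rfl⟩ := canonical_enabled_tau.1 hen
      simp at h

/-- The canonical MDP has no end components: no nonempty set of states is closed. -/
theorem canonical_not_closed (hE : ∀ e ∈ E, M.Terminal e) (hC : Disjoint C E)
    {Z : Set (M.CanState C E)} (hZ : Z.Nonempty)
    (h : ∀ x ∈ Z, ∃ a, (M.canonical C E).Enabled x a ∧
      ∀ y, (M.canonical C E).P x a y ≠ 0 → y ∈ Z) : False := by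
  have : Nonempty (CanAct S A) := ⟨.tau⟩
  choose! g hg using h
  -- A minimal nonempty set closed under the fixed choice `g` is strongly connected, because what is
  -- reachable from one of its states is again closed.
  obtain ⟨W, hWZ, hW⟩ := Set.Finite.exists_le_minimal
    (s := {W : Set (M.CanState C E) | W ⊆ Z ∧ W.Nonempty ∧
      ∀ x ∈ W, ∀ y, (M.canonical C E).P x (g x) y ≠ 0 → y ∈ W}) (Set.toFinite _) (a := Z)
    ⟨subset_rfl, hZ, fun x hx => (hg x hx).2⟩
  obtain ⟨-, hne, hcl⟩ := hW.prop
  have hen : ∀ x ∈ W, (M.canonical C E).Enabled x (g x) := fun x hx => (hg x (hWZ hx)).1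
  have hnt : ∀ x ∈ W, ¬ (x = .TP ∨ x = .FP ∨ x = .FN ∨ x = .TN) := fun x hx hx' =>
    (canonical_terminal_iff hE hC).2 hx' _ (hen x hx)
  set R : M.CanState C E → M.CanState C E → Prop :=
    fun u v => (M.canonical C E).P u (g u) v ≠ 0
  have hR : ∀ x ∈ W, ∀ y, Relation.ReflTransGen R x y → y ∈ W := by
    intro x hx y hxy
    induction hxy with
    | refl => exact hx
    | tail _ h ih => exact hcl _ ih _ h
  have hconn : ∀ x ∈ W, ∀ y ∈ W, Relation.ReflTransGen R x y := by
    intro x hx y hy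
    have hsub : {y | Relation.ReflTransGen R x y} ⊆ W := fun y hxy => hR x hx y hxy
    have := hW.le_of_le (y := {y | Relation.ReflTransGen R x y})
      ⟨hsub.trans hWZ, ⟨x, .refl⟩, fun u hu v huv => Relation.ReflTransGen.tail hu huv⟩ hsub
    exact this hy
  have hmove : ∀ x ∈ W, ∃ s α, g x = .move s α ∧ M.collapse C E s = x ∧
      ¬ (M.minmax C E).Inner s α ∧ (M.minmax C E).Enabled s α := by
    intro x hx
    have hx' := hen x hx
    rcases hgx : g x with ⟨s, α⟩ | _
    · rw [hgx] at hx'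
      exact ⟨s, α, rfl, canonical_enabled_move.1 hx'⟩
    · exfalso
      rw [hgx] at hx'
      obtain ⟨e, rfl⟩ := canonical_enabled_tau.1 hx'
      refine hnt .TN (hcl _ hx _ ?_) (by simp)
      rw [hgx]
      simp [canonical, canonicalP]
  -- The pull-back of `W`: all states collapsed into `W`, with the pairs chosen by `g` and all pairs
  -- of maximal end components among them. It will be an end component.
  let T : Set (MMState S) := {s | M.collapse C E s ∈ W}
  let B : Set (MMState S × MMAct A) := {p | M.collapse C E p.1 ∈ W ∧
    (g (M.collapse C E p.1) = .move p.1 p.2 ∨ (M.minmax C E).Inner p.1 p.2)}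
  let Q : MMState S → MMState S → Prop :=
    fun u v => ∃ α, (u, α) ∈ B ∧ (M.minmax C E).P u α v ≠ 0
  -- Two states collapsed into one state of `W` either coincide or lie in a common maximal end
  -- component, which connects them by inner pairs.
  have hsame : ∀ s t, M.collapse C E s ∈ W → M.collapse C E s = M.collapse C E t →
      Relation.ReflTransGen Q s t := by
    intro s t hs hst
    rcases hx : M.collapse C E s with k | e | _ | _ | _ | _
    · rw [eq_of_collapse_keep hx, eq_of_collapse_keep (hst.symm.trans hx)]
    · refine Relation.ReflTransGen.mono ?_ _ _ (e.isEC.connected s (mem_of_collapse_mec hx) t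
        (mem_of_collapse_mec (hst.symm.trans hx)))
      rintro u v ⟨α, hα, hP⟩
      refine ⟨α, ⟨?_, Or.inr ⟨e, hα⟩⟩, hP⟩
      change M.collapse C E u ∈ W
      rw [collapse_mec hE (e.isEC.mem _ _ hα), ← hx]
      exact hs
    all_goals exact absurd hs (fun h => hnt _ h (by simp [hx]))
  have hpath : ∀ x ∈ W, ∀ y, Relation.ReflTransGen R x y → ∀ s t, M.collapse C E s = x →
      M.collapse C E t = y → Relation.ReflTransGen Q s t := by
    intro x hx y hxy
    induction hxy with
    | refl =>
      intro s t hs ht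
      exact hsame s t (hs ▸ hx) (hs.trans ht.symm)
    | @tail y z hxy hyz ih =>
      intro s t hs ht
      have hy := hR x hx y hxy
      have hz := hcl y hy z hyz
      obtain ⟨s', α, hgy, hs', hα, hαe⟩ := hmove y hy
      have hyz' := hyz
      simp only [R, hgy] at hyz'
      obtain ⟨t', ht', hP⟩ := exists_of_canonical_P_move hyz'
      refine (ih s s' hs hs').trans (.head (b := t') ⟨α, ⟨?_, Or.inl ?_⟩, hP⟩ ?_)
      · simpa [hs'] using hy
      · simpa [hs'] using hgy
      · exact hsame t' t (ht' ▸ hz) (ht'.trans ht.symm)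
  obtain ⟨x, hx⟩ := hne
  obtain ⟨s, α, hgx, hs, hα, hαe⟩ := hmove x hx
  have hsB : (s, α) ∈ B := ⟨by simpa [hs] using hx, Or.inl (by simpa [hs] using hgx)⟩
  have hEC : (M.minmax C E).IsEC T B := by
    refine ⟨fun u β h => h.1, ?_, ?_, ?_, ⟨_, hsB⟩⟩
    · rintro u β ⟨hu, h | ⟨e, he⟩⟩
      · have h' := hen _ hu
        rw [h] at h'
        exact (canonical_enabled_move.1 h').2.2
      · exact e.isEC.enabled _ _ he
    · rintro u β ⟨hu, h | h⟩ t ht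
      · have h' := hen _ hu
        simp only at h
        rw [h] at h'
        have h' := canonical_enabled_move.1 h'
        refine hcl _ hu _ ?_
        rw [h]
        exact canonical_P_move_ne_zero rfl h'.2.1 ht
      · change M.collapse C E t ∈ W
        rw [collapse_eq_of_inner hE h ht]
        exact hu
    · intro u hu v hv
      exact hpath _ hu _ (hconn _ hu _ hv) u v rfl rfl
  have : Finite (MMAct A) := by
    have := Fintype.ofFinite A
    infer_instance
  -- A chosen pair is outside of all maximal end components, yet the pull-back containing it extends
  -- to one.
  obtain ⟨e, he⟩ := hEC.exists_mec
  exact hα ⟨e, he hsB⟩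

end Minmax

/-! ### Termination of the canonical MDP -/

section Termination

variable {S A : Type*} [Fintype S]

theorem eq_of_le_tsum_mul {Y : Type*} {p f : Y → ℝ≥0∞} {m : ℝ≥0∞} (hp : ∑' y, p y = 1)
    (hm : m ≠ ⊤) (hf : ∀ y, f y ≤ m) (h : m ≤ ∑' y, p y * f y) {y : Y} (hy : p y ≠ 0) :
    f y = m := by
  by_contra hne
  have hlt : f y < m := lt_of_le_of_ne (hf y) hne
  have hpy : p y ≠ ⊤ := by
    have : p y ≤ 1 := hp ▸ ENNReal.le_tsum y
    exact (this.trans_lt ENNReal.one_lt_top).ne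
  have hs : ∑' y, p y * m = m := by rw [ENNReal.tsum_mul_right, hp, one_mul]
  have hle : ∀ y, p y * f y ≤ p y * m := fun y => mul_le_mul_right (hf y) _
  have hfin : ∑' y, p y * f y ≠ ⊤ :=
    ((ENNReal.tsum_le_tsum hle).trans_lt (hs.trans_lt hm.lt_top)).ne
  have := ENNReal.tsum_lt_tsum hfin hle
    ((ENNReal.mul_lt_mul_iff_right hy hpy).2 hlt)
  rw [hs] at this
  exact absurd h (not_le.2 this)

theorem Policy.reach_eq_green_empty {M : MDP S A} (σ : M.Policy) {T : Set S}
    (hT : ∀ s ∈ T, M.Terminal s) (π : History S A) :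
    σ.reach T π = green (σ.op ∅) (fun π => if π.last ∈ T then 1 else 0) π := by
  have : σ.op T = σ.op ∅ := by
    funext F π
    by_cases h : π.last ∈ T
    · rw [σ.op_mem _ h, σ.op_terminal _ _ (hT _ h)]
    · exact σ.op_congr F h (by simp)
  rw [σ.reach_eq_green, this]

variable {M : MDP S A} {C E : Set S} [Finite A]

/-- Consider, for each state, the supremum `U` of the non-termination probability over all histories
ending there. If its maximum were positive, the states where it is attained would be closed under a
suitable action, by the maximum principle. -/
theorem reach_terminal_eq_one {N : MDP S A} (hN : ∀ Z : Set S, Z.Nonempty →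
      ¬ ∀ x ∈ Z, ∃ a, N.Enabled x a ∧ ∀ y, N.P x a y ≠ 0 → y ∈ Z)
    (υ : N.Policy) (h : History S A) :
    υ.reach {x | N.Terminal x} h = 1 := by
  set r := υ.reach {x | N.Terminal x} with hr
  have hr1 : ∀ h, r h ≤ 1 := υ.reach_le_one _
  let z : History S A → ℝ≥0∞ := fun h => 1 - r h
  have hz : ∀ h, ¬ N.Terminal h.last → z h = υ.op ∅ z h := by
    intro h hh
    have h1 : r h = υ.op ∅ r h := by
      rw [hr, υ.reach_of_notMem (T := {x | N.Terminal x}) hh]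
      exact υ.op_congr _ hh (by simp)
    have h2 : υ.op ∅ (r + z) h = 1 := by
      have : r + z = fun _ => 1 := by
        funext h; exact add_tsub_cancel_of_le (hr1 h)
      rw [this]
      simp only [Policy.op, Set.mem_empty_iff_false, if_false, mul_one]
      rw [← υ.tsum_act hh]
      refine tsum_congr fun a => ?_
      by_cases ha : υ.act h a = 0
      · simp [ha]
      · rw [tsum_P_of_enabled (Policy.act_enabled ha), mul_one]
    rw [(υ.isPosOp_op ∅).add, Pi.add_apply, ← h1] at h2
    have hfin : r h ≠ ⊤ := ((hr1 h).trans_lt ENNReal.one_lt_top).ne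
    refine (ENNReal.add_right_inj hfin).1 ?_
    rw [h2]
    exact add_tsub_cancel_of_le (hr1 h)
  let U : S → ℝ≥0∞ := fun x => ⨆ h : {h : History _ A // h.last = x}, z h.1
  have hzU : ∀ h, z h ≤ U h.last := fun h =>
    le_iSup (fun h' : {h' : History _ A // h'.last = h.last} => z h'.1) ⟨h, rfl⟩
  have hUle : ∀ x, U x ≤ 1 := fun x => iSup_le fun h => tsub_le_self
  have : Nonempty S := ⟨h.last⟩
  obtain ⟨x₀, hx₀⟩ := Finite.exists_max U
  suffices hm : U x₀ = 0 by
    have : z h = 0 := le_antisymm ((hzU h).trans ((hx₀ _).trans hm.le)) zero_le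
    exact le_antisymm (hr1 h) (tsub_eq_zero_iff_le.1 this)
  by_contra hm
  refine hN {x | U x = U x₀} ⟨x₀, rfl⟩ fun x hx => ?_
  have hx : U x = U x₀ := hx
  have hnt : ¬ N.Terminal x := by
    intro ht
    apply hm
    rw [← hx]
    refine le_antisymm (iSup_le fun h => ?_) zero_le
    have : r h.1 = 1 := υ.reach_of_mem (T := {x | N.Terminal x}) (by
      change N.Terminal h.1.last
      rw [h.2]; exact ht)
    simp [z, this]
  have : Nonempty {a // N.Enabled x a} := by
    unfold Terminal at hnt
    push Not at hnt
    obtain ⟨a, ha⟩ := hnt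
    exact ⟨a, ha⟩
  -- The supremum over histories need not be attained, so the action is chosen independently of the
  -- history, to maximize the mean of `U` after one step.
  obtain ⟨⟨a, ha⟩, hmax⟩ := Finite.exists_max
    (fun a : {a // N.Enabled x a} => ∑' y, N.P x a.1 y * U y)
  refine ⟨a, ha, fun y hy => ?_⟩
  refine eq_of_le_tsum_mul (tsum_P_of_enabled ha) ((hUle x₀).trans_lt ENNReal.one_lt_top).ne hx₀
    ?_ hy
  rw [← hx]
  refine iSup_le ?_
  rintro ⟨h, rfl⟩
  dsimp only
  rw [hz h hnt]
  simp only [Policy.op, Set.mem_empty_iff_false, if_false]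
  calc _ ≤ ∑' b, υ.act h b * ∑' y, N.P h.last a y * U y := by
        refine ENNReal.tsum_le_tsum fun b => ?_
        by_cases hb : υ.act h b = 0
        · simp [hb]
        · refine mul_le_mul_right ?_ _
          refine (ENNReal.tsum_le_tsum fun y => mul_le_mul_right ?_ _).trans
            (hmax ⟨b, Policy.act_enabled hb⟩)
          exact hzU (h.snoc b y)
    _ ≤ _ := by
        rw [ENNReal.tsum_mul_right]
        exact mul_le_of_le_one_left' (υ.sum_act_le_one h)

theorem canonical_reach_terminal (hE : ∀ e ∈ E, M.Terminal e) (hC : Disjoint C E)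
    (υ : (M.canonical C E).Policy) (h : History (M.CanState C E) (CanAct S A)) :
    υ.reach {x | (M.canonical C E).Terminal x} h = 1 := by
  have : Finite (CanAct S A) := by
    have := Fintype.ofFinite A
    infer_instance
  exact reach_terminal_eq_one (fun Z hZ h => canonical_not_closed hE hC hZ h) υ h

theorem canonical_outcome_sum (hE : ∀ e ∈ E, M.Terminal e) (hC : Disjoint C E)
    (υ : (M.canonical C E).Policy) (h : History (M.CanState C E) (CanAct S A)) :
    υ.reach {.TP} h + υ.reach {.FP} h + υ.reach {.FN} h + υ.reach {.TN} h = 1 := by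
  have ht : ∀ x : M.CanState C E, (x = .TP ∨ x = .FP ∨ x = .FN ∨ x = .TN) →
      ∀ y ∈ ({x} : Set (M.CanState C E)), (M.canonical C E).Terminal y := by
    rintro x hx y rfl
    exact (canonical_terminal_iff hE hC).2 hx
  rw [← canonical_reach_terminal hE hC υ h, υ.reach_eq_green_empty (T := {x | (M.canonical C E).Terminal x}) (fun x hx => hx),
    υ.reach_eq_green_empty (ht .TP (by simp)), υ.reach_eq_green_empty (ht .FP (by simp)),
    υ.reach_eq_green_empty (ht .FN (by simp)), υ.reach_eq_green_empty (ht .TN (by simp)),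
    ← (υ.isPosOp_op ∅).green_add, ← (υ.isPosOp_op ∅).green_add, ← (υ.isPosOp_op ∅).green_add]
  congr 1
  funext h
  simp only [Pi.add_apply, Set.mem_ofPred_eq, canonical_terminal_iff hE hC,
    Set.mem_singleton_iff]
  rcases h.last <;> simp

end Termination

end MDP

/-! ### Sums over the action types, and convex combinations. -/

theorem ENNReal.tsum_sum_type {α β : Type*} (f : α ⊕ β → ℝ≥0∞) :
    ∑' x, f x = ∑' a, f (.inl a) + ∑' b, f (.inr b) :=
  (HasSum.sum (f := f) ENNReal.summable.hasSum ENNReal.summable.hasSum).tsum_eq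

theorem tsum_MMAct {A : Type*} (f : MMAct A → ℝ≥0∞) :
    ∑' β, f β = (∑' α, f (.orig α)) + (f .amin + f .amax) := by
  let e : A ⊕ Bool ≃ MMAct A :=
    { toFun := fun x => match x with
        | .inl α => .orig α
        | .inr false => .amin
        | .inr true => .amax
      invFun := fun x => match x with
        | .orig α => .inl α
        | .amin => .inr false
        | .amax => .inr true
      left_inv := by rintro (_ | _ | _) <;> rfl
      right_inv := by rintro (_ | _ | _) <;> rfl }
  rw [← e.tsum_eq, ENNReal.tsum_sum_type, tsum_fintype (L := .unconditional Bool)]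
  simp [e, add_comm]

theorem MDP.tsum_CanAct {S A : Type*} (f : MDP.CanAct S A → ℝ≥0∞) :
    ∑' a, f a = (∑' s, ∑' β, f (.move s β)) + f .tau := by
  let e : (MMState S × MMAct A) ⊕ Unit ≃ MDP.CanAct S A :=
    { toFun := fun x => match x with
        | .inl p => .move p.1 p.2
        | .inr _ => .tau
      invFun := fun x => match x with
        | .move s β => .inl (s, β)
        | .tau => .inr ()
      left_inv := by rintro (_ | _) <;> rfl
      right_inv := by rintro (_ | _) <;> rfl }
  rw [← e.tsum_eq, ENNReal.tsum_sum_type, ENNReal.tsum_prod']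
  simp [e]

theorem ENNReal.exists_convex_combination {a b q : ℝ≥0∞} (h1 : a ≤ q) (h2 : q ≤ b) (hb : b ≠ ⊤) :
    ∃ u v : ℝ≥0∞, u + v = 1 ∧ u * a + v * b = q := by
  have hq : q ≠ ⊤ := (h2.trans_lt hb.lt_top).ne
  have ha : a ≠ ⊤ := (h1.trans_lt hq.lt_top).ne
  lift a to NNReal using ha
  lift b to NNReal using hb
  lift q to NNReal using hq
  have h1 : a ≤ q := by exact_mod_cast h1
  have h2 : q ≤ b := by exact_mod_cast h2
  have h : (q : ℝ) ∈ segment ℝ (a : ℝ) (b : ℝ) := by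
    rw [segment_eq_Icc (by exact_mod_cast h1.trans h2)]
    exact ⟨by exact_mod_cast h1, by exact_mod_cast h2⟩
  obtain ⟨u, v, hu, hv, huv, h⟩ := h
  lift u to NNReal using hu
  lift v to NNReal using hv
  simp only [smul_eq_mul] at h
  exact ⟨u, v, by exact_mod_cast huv, by exact_mod_cast h⟩

theorem History.last_start {S A : Type*} (s : S) : (History.start s : History S A).last = s := rfl

theorem History.last_snoc {S A : Type*} (π : History S A) (α : A) (t : S) :
    (π.snoc α t).last = t := rfl

namespace MDP

open Classical

variable {S A : Type*} [Fintype S] {M : MDP S A} {C E : Set S}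

/-! ### From the MDP to its canonical MDP -/

section Project

/-- The action probabilities, in the MDP after the first step, that correspond to `σ`, where
`u π` and `v π` are the probabilities of the minimizing and of the maximizing action. -/
noncomputable def Policy.minmaxAct (σ : M.Policy) (C : Set S) (u v : History S A → ℝ≥0∞)
    (π : History S A) : MMAct A → ℝ≥0∞
  | .orig α => if π.last ∈ C then 0 else σ.act π α
  | .amin => if π.last ∈ C then u π else 0
  | .amax => if π.last ∈ C then v π else 0

variable {σ : M.Policy} {u v : History S A → ℝ≥0∞}

theorem Policy.minmaxAct_enabled {π : History S A} {β : MMAct A}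
    (h : σ.minmaxAct C u v π β ≠ 0) : (M.minmax C E).Enabled (.orig π.last) β := by
  rcases β with α | _ | _ <;> simp only [minmaxAct, ne_eq, ite_eq_left_iff, ite_eq_right_iff,
    Classical.not_imp] at h
  · exact minmax_enabled_orig.2 ⟨h.1, Policy.act_enabled h.2⟩
  · exact minmax_enabled_amin.2 h.1
  · exact minmax_enabled_amax.2 h.1

theorem Policy.tsum_minmaxAct (huv : ∀ π, u π + v π = 1) {π : History S A}
    (h : ¬ (M.minmax C E).Terminal (.orig π.last)) : ∑' β, σ.minmaxAct C u v π β = 1 := by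
  rw [tsum_MMAct]
  by_cases hc : π.last ∈ C
  · simp [minmaxAct, hc, huv]
  · rw [minmax_terminal_orig, not_and] at h
    simp [minmaxAct, hc, σ.tsum_act (h hc)]

variable (M C E) in
/-- The number of steps of `π` that do not belong to end components. -/
noncomputable def level : History S A → ℕ
  | .start _ => 0
  | .snoc π α _ => level π + if (M.minmax C E).Inner (.orig π.last) (.orig α) then 0 else 1

theorem level_snoc (π : History S A) (α : A) (t : S) : level M C E (π.snoc α t) =
    level M C E π + if (M.minmax C E).Inner (.orig π.last) (.orig α) then 0 else 1 := rfl

/-- The `g`-weighted probability that the next step does not belong to an end component. -/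
noncomputable def Policy.exitSum (σ : M.Policy) (C E : Set S) (u v : History S A → ℝ≥0∞)
    (g : MMState S → MMAct A → ℝ≥0∞) (π : History S A) : ℝ≥0∞ :=
  ∑' β, if (M.minmax C E).Inner (.orig π.last) β then 0
    else σ.minmaxAct C u v π β * g (.orig π.last) β

/-- The probability that the next step belongs to an end component. -/
noncomputable def Policy.innerSum (σ : M.Policy) (C E : Set S) (u v : History S A → ℝ≥0∞)
    (π : History S A) : ℝ≥0∞ :=
  ∑' β, if (M.minmax C E).Inner (.orig π.last) β then σ.minmaxAct C u v π β else 0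

variable (M C E) in
/-- The expected value of `φ` at the state into which the successor is collapsed. -/
noncomputable def nextSum (φ : M.CanState C E → ℝ≥0∞) (s : MMState S) (β : MMAct A) : ℝ≥0∞ :=
  ∑' t, (M.minmax C E).P s β t * φ (M.collapse C E t)

variable (M C E) in
/-- The indicator function of the histories with `k` exits whose last state is collapsed
into `x`. -/
noncomputable def levelState (k : ℕ) (x : M.CanState C E) (π : History S A) : ℝ≥0∞ :=
  if level M C E π = k ∧ M.collapse C E (.orig π.last) = x then 1 else 0

theorem not_inner_of_mem {s : S} (hs : s ∈ C) (β : MMAct A) :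
    ¬ (M.minmax C E).Inner (.orig s) β := by
  rintro ⟨e, he⟩
  obtain ⟨s', α', h, -, hs'⟩ := mec_pair_orig e he
  cases h
  exact hs' hs

theorem not_inner_amin {s : MMState S} : ¬ (M.minmax C E).Inner s .amin := by
  rintro ⟨e, he⟩
  obtain ⟨s', α', -, h, -⟩ := mec_pair_orig e he
  cases h

theorem not_inner_amax {s : MMState S} : ¬ (M.minmax C E).Inner s .amax := by
  rintro ⟨e, he⟩
  obtain ⟨s', α', -, h, -⟩ := mec_pair_orig e he
  cases h

theorem Policy.exitSum_of_mem {π : History S A} (h : π.last ∈ C) (φ : M.CanState C E → ℝ≥0∞) :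
    σ.exitSum C E u v (M.nextSum C E φ) π =
      u π * (M.prMin E π.last * φ .TP + (1 - M.prMin E π.last) * φ .FP) +
      v π * (M.prMax E π.last * φ .TP + (1 - M.prMax E π.last) * φ .FP) := by
  simp only [exitSum, not_inner_of_mem h, if_false]
  rw [tsum_MMAct]
  simp only [minmaxAct, h, if_true, zero_mul, tsum_zero, zero_add, nextSum,
    tsum_minmax_amin h, tsum_minmax_amax h, collapse]

theorem Policy.exitSum_of_notMem {π : History S A} (h : π.last ∉ C) (φ : M.CanState C E → ℝ≥0∞) :
    σ.exitSum C E u v (M.nextSum C E φ) π =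
      ∑' α, if (M.minmax C E).Inner (.orig π.last) (.orig α) then 0
        else σ.act π α * ∑' t, M.P π.last α t * φ (M.collapse C E (.orig t)) := by
  unfold exitSum
  rw [tsum_MMAct]
  simp only [minmaxAct, h, if_false, zero_mul, ite_self, add_zero, nextSum, tsum_minmax_orig h]

theorem Policy.innerSum_add_exitSum_le (huv : ∀ π, u π + v π = 1) (π : History S A) :
    σ.innerSum C E u v π + σ.exitSum C E u v (fun _ _ => 1) π ≤ 1 := by
  have : σ.innerSum C E u v π + σ.exitSum C E u v (fun _ _ => 1) π =
      ∑' β, σ.minmaxAct C u v π β := by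
    unfold innerSum exitSum
    rw [← ENNReal.tsum_add]
    refine tsum_congr fun β => ?_
    split_ifs <;> simp
  rw [this]
  by_cases h : (M.minmax C E).Terminal (.orig π.last)
  · have : ∀ β, σ.minmaxAct C u v π β = 0 := fun β => by
      by_contra hβ
      exact h β (Policy.minmaxAct_enabled hβ)
    simp [this]
  · exact (Policy.tsum_minmaxAct huv h).le

theorem Policy.exitSum_one_eq (huv : ∀ π, u π + v π = 1) {π : History S A}
    (h : ¬ (M.minmax C E).Terminal (.orig π.last))
    (hi : ∀ β, ¬ (M.minmax C E).Inner (.orig π.last) β) :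
    σ.exitSum C E u v (fun _ _ => 1) π = 1 := by
  simpa [exitSum, hi] using Policy.tsum_minmaxAct (σ := σ) huv h

theorem Policy.exitSum_nextSum_one (π : History S A) :
    σ.exitSum C E u v (M.nextSum C E fun _ => 1) π = σ.exitSum C E u v (fun _ _ => 1) π := by
  unfold exitSum
  refine tsum_congr fun β => ?_
  split_ifs
  · rfl
  · by_cases hβ : σ.minmaxAct C u v π β = 0
    · simp [hβ]
    · simp only [nextSum, mul_one, tsum_P_of_enabled (Policy.minmaxAct_enabled (E := E) hβ)]

/-- One step of the collapsed process. -/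
theorem Policy.op_levelState (hE : ∀ e ∈ E, M.Terminal e) (k : ℕ) {x : M.CanState C E}
    (h1 : x ≠ .TP) (h2 : x ≠ .FP) :
    σ.op C (levelState M C E k x) = (fun π => levelState M C E k x π * σ.innerSum C E u v π) +
      fun π => if level M C E π + 1 = k then
        σ.exitSum C E u v (M.nextSum C E fun y => if y = x then 1 else 0) π else 0 := by
  funext π
  rw [Pi.add_apply]
  -- In `C` the operator is killed, while `exitSum` moves everything to `TP` and `FP`; both sides
  -- vanish since `x` is neither.
  by_cases hc : π.last ∈ C
  · rw [σ.op_mem _ hc, Policy.exitSum_of_mem hc]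
    simp [innerSum, not_inner_of_mem hc, h1.symm, h2.symm]
  · rw [Policy.exitSum_of_notMem hc]
    simp only [op, hc, if_false, innerSum]
    rw [tsum_MMAct]
    simp only [not_inner_amin, not_inner_amax, if_false, add_zero, minmaxAct, hc]
    rw [← ENNReal.tsum_mul_left, show (if level M C E π + 1 = k then ∑' α,
      if (M.minmax C E).Inner (.orig π.last) (.orig α) then 0
        else σ.act π α * ∑' t, M.P π.last α t *
          (if M.collapse C E (.orig t) = x then (1 : ℝ≥0∞) else 0) else 0) =
        ∑' α, if level M C E π + 1 = k then if (M.minmax C E).Inner (.orig π.last) (.orig α) then 0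
          else σ.act π α * ∑' t, M.P π.last α t *
            (if M.collapse C E (.orig t) = x then (1 : ℝ≥0∞) else 0) else 0 by
        split_ifs <;> simp, ← ENNReal.tsum_add]
    refine tsum_congr fun α => ?_
    by_cases ha : σ.act π α = 0
    · simp [ha]
    -- An inner step changes neither the level nor the collapsed state; any other step raises the
    -- level by one and enters the collapsed state of its target.
    by_cases hi : (M.minmax C E).Inner (.orig π.last) (.orig α)
    · have ht : ∀ t, M.P π.last α t * levelState M C E k x (π.snoc α t) =
          M.P π.last α t * levelState M C E k x π := by
        intro t
        by_cases hP : M.P π.last α t = 0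
        · simp [hP]
        · have := collapse_eq_of_inner (t := .orig t) hE hi (by rwa [minmax_P_orig hc])
          simp [levelState, level_snoc, hi, History.last_snoc, this]
      simp only [ht, hi, if_true, ite_self, add_zero]
      rw [ENNReal.tsum_mul_right, tsum_P_of_enabled (Policy.act_enabled ha), one_mul, mul_comm]
    · simp only [hi, if_false, mul_zero, zero_add, levelState, level_snoc, History.last_snoc]
      by_cases hk : level M C E π + 1 = k <;> simp [hk]

end Project

end MDP

/-! ### Masses of the collapsed process, and the projected policy. -/

namespace History

/-- The number of steps of a finite path. -/
def length {S A : Type*} : History S A → ℕ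
  | start _ => 0
  | snoc π _ _ => π.length + 1

end History

namespace MDP

open Classical

variable {S A : Type*} [Fintype S] {M : MDP S A} {C E : Set S}

section Project

variable {σ : M.Policy} {u v : History S A → ℝ≥0∞}

/-- The probability that the collapsed process enters `x` with its `k`-th step. -/
noncomputable def Policy.mass (σ : M.Policy) (C E : Set S) (u v : History S A → ℝ≥0∞) (k : ℕ)
    (x : M.CanState C E) : ℝ≥0∞ :=
  levelState M C E k x (.start M.init) + green (σ.op C) (fun π =>
    if level M C E π + 1 = k then
      σ.exitSum C E u v (M.nextSum C E fun y => if y = x then 1 else 0) π else 0) (.start M.init)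

/-- The probability that `(s, β)` is taken as the exit from `x` after `k` steps of the collapsed
process. -/
noncomputable def Policy.moveMass (σ : M.Policy) (C E : Set S) (u v : History S A → ℝ≥0∞) (k : ℕ)
    (x : M.CanState C E) (s : MMState S) (β : MMAct A) : ℝ≥0∞ :=
  if M.collapse C E s = x ∧ ¬ (M.minmax C E).Inner s β then
    green (σ.op C) (fun π => if level M C E π = k ∧ .orig π.last = s then
      σ.minmaxAct C u v π β else 0) (.start M.init)
  else 0

theorem levelState_eq_zero {k : ℕ} {x : M.CanState C E} (h : x = .TP ∨ x = .FP)
    (π : History S A) : levelState M C E k x π = 0 := by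
  rcases h with rfl | rfl
  · simp [levelState, collapse_orig_ne_TP]
  · simp [levelState, collapse_orig_ne_FP]

theorem Policy.innerSum_eq_zero (hE : ∀ e ∈ E, M.Terminal e) {π : History S A}
    (h : ∀ e, M.collapse C E (.orig π.last) ≠ .mec e) : σ.innerSum C E u v π = 0 := by
  have : ∀ β, ¬ (M.minmax C E).Inner (.orig π.last) β := by
    rintro β ⟨e, he⟩
    exact h e (collapse_mec hE (e.isEC.mem _ _ he))
  simp [innerSum, this]

theorem Policy.tsum_moveMass [Finite A] (k : ℕ) (x : M.CanState C E)
    (g : MMState S → MMAct A → ℝ≥0∞) :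
    ∑' s, ∑' β, σ.moveMass C E u v k x s β * g s β =
      green (σ.op C) (fun π => levelState M C E k x π * σ.exitSum C E u v g π)
        (.start M.init) := by
  have := Fintype.ofFinite A
  have hK := σ.isPosOp_op C
  have key : (fun π => levelState M C E k x π * σ.exitSum C E u v g π) = fun π =>
      ∑ s, ∑ β, (if M.collapse C E s = x ∧ ¬ (M.minmax C E).Inner s β then g s β else 0) *
        (if level M C E π = k ∧ .orig π.last = s then σ.minmaxAct C u v π β else 0) := by
    funext π
    rw [Finset.sum_eq_single (MMState.orig π.last)]
    · simp only [levelState, exitSum, tsum_fintype, Finset.mul_sum]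
      refine Finset.sum_congr rfl fun β _ => ?_
      by_cases h1 : level M C E π = k <;> by_cases h2 : M.collapse C E (.orig π.last) = x <;>
        by_cases h3 : (M.minmax C E).Inner (.orig π.last) β <;> simp [h1, h2, h3, mul_comm]
    · intro s _ hs
      simp [hs.symm]
    · simp
  rw [key, hK.green_sum, tsum_fintype]
  refine Finset.sum_congr rfl fun s _ => ?_
  rw [hK.green_sum, tsum_fintype]
  refine Finset.sum_congr rfl fun β _ => ?_
  rw [hK.green_const_mul, moveMass]
  split_ifs <;> simp [mul_comm]

/-- Conservation of mass: the mass inside `x` at level `k` changes only by entries and exits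
(`IsPosOp.green_exit_le`). The difference is the mass that stays forever. -/
theorem Policy.exit_le_mass (hE : ∀ e ∈ E, M.Terminal e) (huv : ∀ π, u π + v π = 1) (k : ℕ)
    (x : M.CanState C E) :
    green (σ.op C) (fun π => levelState M C E k x π * σ.exitSum C E u v (fun _ _ => 1) π)
      (.start M.init) ≤ σ.mass C E u v k x := by
  by_cases hx : x = .TP ∨ x = .FP
  · rw [(σ.isPosOp_op C).green_eq_zero fun π => by simp [levelState_eq_zero hx]]
    exact zero_le
  · rw [not_or] at hx
    refine (σ.isPosOp_op C).green_exit_le (σ.op_levelState (u := u) (v := v) hE k hx.1 hx.2) ?_ _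
    intro π
    rw [Pi.add_apply, ← mul_add]
    exact mul_le_of_le_one_right' (Policy.innerSum_add_exitSum_le huv π)

/-- Outside of the end components every step raises the level, so a stay at level `k` consists of a
single visit, and entries and visits have the same mass. -/
theorem Policy.mass_eq_green (hE : ∀ e ∈ E, M.Terminal e) (k : ℕ) {x : M.CanState C E}
    (h1 : x ≠ .TP) (h2 : x ≠ .FP) (h3 : ∀ e, x ≠ .mec e) :
    σ.mass C E u v k x = green (σ.op C) (levelState M C E k x) (.start M.init) := by
  rw [green_eq_add_green, σ.op_levelState (u := u) (v := v) hE k h1 h2, mass]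
  congr 2
  rw [show (fun π => levelState M C E k x π * σ.innerSum C E u v π) = 0 from ?_, zero_add]
  funext π
  by_cases hx : M.collapse C E (.orig π.last) = x
  · rw [Policy.innerSum_eq_zero hE (fun e => by rw [hx]; exact h3 e)]
    simp
  · simp [levelState, hx]

theorem Policy.mass_zero (x : M.CanState C E) : σ.mass C E u v 0 x =
    if x = M.collapse C E (.orig M.init) then 1 else 0 := by
  rw [mass, (σ.isPosOp_op C).green_eq_zero fun π => by simp]
  simp [levelState, level, History.last_start, eq_comm]

theorem exists_rule (N : MDP S A) : ∃ d, N.IsRule d := by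
  obtain ⟨f, hf, -⟩ := N.exists_choice (fun _ _ => True) (fun s hs => by
    unfold Terminal at hs
    push Not at hs
    obtain ⟨α, hα⟩ := hs
    exact ⟨α, hα, trivial⟩)
  exact ⟨_, hf⟩

variable [Finite A]

theorem sum_levelState_mul (k : ℕ) (π : History S A) (f : ℝ≥0∞) :
    ∑ x, levelState M C E k x π * f = if level M C E π = k then f else 0 := by
  rw [Finset.sum_eq_single (M.collapse C E (.orig π.last))]
  · simp [levelState]
  · intro x _ hx; simp [levelState, hx.symm]
  · simp

theorem nextSum_eq_sum (φ : M.CanState C E → ℝ≥0∞) (s : MMState S) (β : MMAct A) :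
    M.nextSum C E φ s β = ∑ x, M.nextSum C E (fun y => if y = x then 1 else 0) s β * φ x := by
  simp only [nextSum, tsum_fintype, Finset.sum_mul]
  rw [Finset.sum_comm]
  refine Finset.sum_congr rfl fun t _ => ?_
  simp

theorem Policy.exitSum_eq_sum (φ : M.CanState C E → ℝ≥0∞) (π : History S A) :
    σ.exitSum C E u v (M.nextSum C E φ) π =
      ∑ x, σ.exitSum C E u v (M.nextSum C E (fun y => if y = x then 1 else 0)) π * φ x := by
  have := Fintype.ofFinite A
  simp only [exitSum, tsum_fintype, Finset.sum_mul]
  rw [Finset.sum_comm]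
  refine Finset.sum_congr rfl fun β _ => ?_
  split_ifs
  · simp
  · rw [nextSum_eq_sum, Finset.mul_sum]
    refine Finset.sum_congr rfl fun x _ => ?_
    rw [mul_assoc]

theorem Policy.sum_mass_succ (k : ℕ) (φ : M.CanState C E → ℝ≥0∞) :
    ∑ x, σ.mass C E u v (k + 1) x * φ x = green (σ.op C) (fun π =>
      if level M C E π = k then σ.exitSum C E u v (M.nextSum C E φ) π else 0)
      (.start M.init) := by
  have hK := σ.isPosOp_op C
  have : (fun π => if level M C E π = k then σ.exitSum C E u v (M.nextSum C E φ) π else 0) =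
      fun π => ∑ x, φ x * (if level M C E π + 1 = k + 1 then
        σ.exitSum C E u v (M.nextSum C E fun y => if y = x then 1 else 0) π else 0) := by
    funext π
    by_cases h : level M C E π = k
    · simp [h, Policy.exitSum_eq_sum φ, mul_comm]
    · simp [h]
  rw [this, hK.green_sum]
  refine Finset.sum_congr rfl fun x _ => ?_
  rw [hK.green_const_mul, mass]
  simp [levelState, level, mul_comm]

/-- What enters at step `k + 1` has left at level `k`, and no more leaves than has entered. The
resulting finiteness permits dividing by the masses. -/
theorem Policy.sum_mass_le_one (hE : ∀ e ∈ E, M.Terminal e) (huv : ∀ π, u π + v π = 1) (k : ℕ) :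
    ∑ x, σ.mass C E u v k x ≤ 1 := by
  induction k with
  | zero => simp [Policy.mass_zero]
  | succ k ih =>
    have h := σ.sum_mass_succ (u := u) (v := v) k (fun _ : M.CanState C E => 1)
    simp only [mul_one] at h
    rw [h]
    refine le_trans ?_ ih
    have : (fun π => if level M C E π = k then σ.exitSum C E u v (M.nextSum C E fun _ => 1) π
        else 0) = fun π => ∑ x, levelState M C E k x π * σ.exitSum C E u v (fun _ _ => 1) π := by
      funext π
      rw [sum_levelState_mul, Policy.exitSum_nextSum_one]
    rw [this, (σ.isPosOp_op C).green_sum]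
    exact Finset.sum_le_sum fun x _ => Policy.exit_le_mass hE huv k x

theorem Policy.mass_ne_top (hE : ∀ e ∈ E, M.Terminal e) (huv : ∀ π, u π + v π = 1) (k : ℕ)
    (x : M.CanState C E) : σ.mass C E u v k x ≠ ⊤ := by
  have h : σ.mass C E u v k x ≤ 1 :=
    (Finset.single_le_sum (f := fun x => σ.mass C E u v k x) (fun _ _ => zero_le)
      (Finset.mem_univ x)).trans (Policy.sum_mass_le_one hE huv k)
  exact (h.trans_lt ENNReal.one_lt_top).ne

/-- The probability that the collapsed process is in `x` after `k` steps and takes the action `a`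
there; the action `tau` represents staying forever. -/
noncomputable def Policy.actMass (σ : M.Policy) (C E : Set S) (u v : History S A → ℝ≥0∞) (k : ℕ)
    (x : M.CanState C E) : CanAct S A → ℝ≥0∞
  | .move s β => σ.moveMass C E u v k x s β
  | .tau => if ∃ e, x = .mec e then
      σ.mass C E u v k x - ∑' s, ∑' β, σ.moveMass C E u v k x s β else 0

theorem Policy.tsum_moveMass_le (hE : ∀ e ∈ E, M.Terminal e) (huv : ∀ π, u π + v π = 1) (k : ℕ)
    (x : M.CanState C E) :
    ∑' s, ∑' β, σ.moveMass C E u v k x s β ≤ σ.mass C E u v k x := by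
  have h := σ.tsum_moveMass (u := u) (v := v) k x (fun _ _ => 1)
  simp only [mul_one] at h
  rw [h]
  exact Policy.exit_le_mass hE huv k x

theorem Policy.actMass_le (hE : ∀ e ∈ E, M.Terminal e) (huv : ∀ π, u π + v π = 1) (k : ℕ)
    (x : M.CanState C E) (a : CanAct S A) : σ.actMass C E u v k x a ≤ σ.mass C E u v k x := by
  rcases a with ⟨s, β⟩ | _
  · refine le_trans ?_ (Policy.tsum_moveMass_le hE huv k x)
    exact (ENNReal.le_tsum (f := fun β => σ.moveMass C E u v k x s β) β).trans
      (ENNReal.le_tsum (f := fun s => ∑' β, σ.moveMass C E u v k x s β) s)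
  · simp only [actMass]
    split_ifs
    · exact tsub_le_self
    · exact zero_le

theorem Policy.tsum_actMass (hE : ∀ e ∈ E, M.Terminal e) (hC : Disjoint C E)
    (huv : ∀ π, u π + v π = 1) (k : ℕ)
    {x : M.CanState C E} (hx : ¬ (M.canonical C E).Terminal x) :
    ∑' a, σ.actMass C E u v k x a = σ.mass C E u v k x := by
  rw [canonical_terminal_iff hE hC] at hx
  push Not at hx
  rw [tsum_CanAct]
  by_cases he : ∃ e, x = .mec e
  · simp only [actMass, he, if_true]
    exact add_tsub_cancel_of_le (Policy.tsum_moveMass_le hE huv k x)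
  · simp only [actMass, he, if_false, add_zero]
    have h := σ.tsum_moveMass (u := u) (v := v) k x (fun _ _ => 1)
    simp only [mul_one] at h
    rw [h, Policy.mass_eq_green hE k hx.1 hx.2.1 (fun e h => he ⟨e, h⟩)]
    congr 1
    funext π
    by_cases hπ : M.collapse C E (.orig π.last) = x
    · rw [Policy.exitSum_one_eq huv (not_terminal_of_collapse hπ hx.1 hx.2.1 hx.2.2.1 hx.2.2.2),
        mul_one]
      rintro β ⟨e, h⟩
      exact he ⟨e, by rw [← hπ, collapse_mec hE (e.isEC.mem _ _ h)]⟩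
    · simp [levelState, hπ]

theorem Policy.actMass_enabled {k : ℕ} {x : M.CanState C E} {a : CanAct S A}
    (h : σ.actMass C E u v k x a ≠ 0) : (M.canonical C E).Enabled x a := by
  rcases a with ⟨s, β⟩ | _
  · simp only [actMass, moveMass, ne_eq, ite_eq_right_iff, Classical.not_imp] at h
    refine canonical_enabled_move.2 ⟨h.1.1, h.1.2, ?_⟩
    by_contra hen
    refine h.2 ((σ.isPosOp_op C).green_eq_zero (fun π => ?_) _)
    split_ifs with h'
    · by_contra hβ
      exact hen (h'.2 ▸ Policy.minmaxAct_enabled hβ)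
    · rfl
  · simp only [actMass, ne_eq, ite_eq_right_iff, Classical.not_imp] at h
    exact canonical_enabled_tau.2 h.1

/-- The masses evolve by the transitions of the canonical MDP, except that `tau` sends to `TN` a
mass that `mass` does not record. Hence the condition at `TN`. -/
theorem Policy.sum_actMass_mul (k : ℕ) (Φ : M.CanState C E → ℝ≥0∞) (hΦ : Φ .TN = 0) :
    ∑ x, ∑' a, σ.actMass C E u v k x a * ∑' y, (M.canonical C E).P x a y * Φ y =
      ∑ y, σ.mass C E u v (k + 1) y * Φ y := by
  have h1 : ∀ x, ∑' a, σ.actMass C E u v k x a * ∑' y, (M.canonical C E).P x a y * Φ y =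
      green (σ.op C) (fun π => levelState M C E k x π * σ.exitSum C E u v (M.nextSum C E Φ) π)
        (.start M.init) := by
    intro x
    rw [tsum_CanAct, ← Policy.tsum_moveMass]
    have htau : σ.actMass C E u v k x .tau * ∑' y, (M.canonical C E).P x .tau y * Φ y = 0 := by
      by_cases he : ∃ e, x = .mec e
      · obtain ⟨e, rfl⟩ := he
        rw [tsum_canonical_tau, hΦ, mul_zero]
      · simp [actMass, he]
    rw [htau, add_zero]
    refine tsum_congr fun s => tsum_congr fun β => ?_
    by_cases h : M.collapse C E s = x ∧ ¬ (M.minmax C E).Inner s β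
    · rw [tsum_canonical_move h.1 h.2]
      rfl
    · simp [actMass, moveMass, h]
  simp only [h1]
  rw [← (σ.isPosOp_op C).green_sum, Policy.sum_mass_succ]
  simp only [sum_levelState_mul]

/-- The policy looks only at the time `k` and the current state `x`, and plays `a` with the
conditional probability `actMass / mass`. Then its law at time `k` is `mass k`, up to the value at
`TN`. -/
theorem Policy.exists_projection (hE : ∀ e ∈ E, M.Terminal e) (hC : Disjoint C E)
    (huv : ∀ π, u π + v π = 1) :
    ∃ υ : (M.canonical C E).Policy, ∀ x : M.CanState C E, x ≠ .TN →
      (M.canonical C E).Terminal x →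
      υ.reach {x} (.start (M.canonical C E).init) = ∑' k, σ.mass C E u v k x := by
  set N := M.canonical C E with hN
  obtain ⟨d, hd⟩ := exists_rule N
  -- Where no mass arrives the quotient is meaningless, and an arbitrary rule fills the gap.
  let c : ℕ → M.CanState C E → CanAct S A → ℝ≥0∞ := fun k x a =>
    if σ.mass C E u v k x = 0 then d x a else σ.actMass C E u v k x a / σ.mass C E u v k x
  have hc : ∀ k x a, σ.mass C E u v k x * c k x a = σ.actMass C E u v k x a := by
    intro k x a
    by_cases h : σ.mass C E u v k x = 0
    · rw [h, zero_mul]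
      exact (le_antisymm ((Policy.actMass_le hE huv k x a).trans h.le) zero_le).symm
    · simp only [c, h, if_false]
      exact ENNReal.mul_div_cancel h (Policy.mass_ne_top hE huv k x)
  have hc1 : ∀ k x, ¬ N.Terminal x → ∑' a, c k x a = 1 := by
    intro k x hx
    by_cases h : σ.mass C E u v k x = 0
    · simp only [c, h, if_true]
      exact hd.sum x hx
    · simp only [c, h, if_false, div_eq_mul_inv]
      rw [ENNReal.tsum_mul_right, Policy.tsum_actMass hE hC huv k hx]
      exact ENNReal.mul_inv_cancel h (Policy.mass_ne_top hE huv k x)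
  have hc2 : ∀ k x a, c k x a ≠ 0 → N.Enabled x a := by
    intro k x a h
    by_cases h' : σ.mass C E u v k x = 0
    · simp only [c, h', if_true] at h
      exact hd.enabled x a h
    · simp only [c, h', if_false] at h
      refine Policy.actMass_enabled (σ := σ) (u := u) (v := v) (k := k) fun h0 => h ?_
      rw [h0, ENNReal.zero_div]
  obtain ⟨υ, hυ⟩ := MDP.exists_policy (M := N) (fun h a => c h.length h.last a)
    (fun h hh => hc1 _ _ hh) (fun h a ha => hc2 _ _ _ ha)
  -- The policy depends only on length and last state, so the chain on histories projects onto `ℕ ×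
  -- CanState`, with operator `L`.
  let L : (ℕ × M.CanState C E → ℝ≥0∞) → ℕ × M.CanState C E → ℝ≥0∞ := fun Φ p =>
    ∑' a, c p.1 p.2 a * ∑' y, N.P p.2 a y * Φ (p.1 + 1, y)
  have hL : ∀ Φ, υ.op ∅ (Φ ∘ fun h => (h.length, h.last)) = L Φ ∘ fun h => (h.length, h.last) := by
    intro Φ
    funext h
    simp only [Policy.op, Set.mem_empty_iff_false, if_false, hυ]
    rfl
  -- `TN` is terminal, so vanishing at `TN` survives the iteration of `L`.
  have hTN : ∀ Φ k, L Φ (k, .TN) = 0 := by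
    intro Φ k
    have : ∀ a, c k .TN a = 0 := by
      intro a
      by_contra h
      exact (canonical_terminal_iff hE hC).2 (by simp) a (hc2 k .TN a h)
    simp [L, this]
  have hstep : ∀ Φ k, (∀ k, Φ (k, .TN) = 0) → ∑ x, σ.mass C E u v k x * L Φ (k, x) =
      ∑ x, σ.mass C E u v (k + 1) x * Φ (k + 1, x) := by
    intro Φ k hΦ
    rw [← Policy.sum_actMass_mul k (fun y => Φ (k + 1, y)) (hΦ _)]
    refine Finset.sum_congr rfl fun x _ => ?_
    rw [← ENNReal.tsum_mul_left]
    refine tsum_congr fun a => ?_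
    rw [← mul_assoc, hc]
  have hiter : ∀ j Φ k, (∀ k, Φ (k, .TN) = 0) → ∑ x, σ.mass C E u v k x * L^[j] Φ (k, x) =
      ∑ x, σ.mass C E u v (k + j) x * Φ (k + j, x) := by
    intro j
    induction j with
    | zero => intro Φ k _; rfl
    | succ j ih =>
      intro Φ k hΦ
      rw [Function.iterate_succ_apply, ih _ _ (fun k => hTN Φ k), hstep _ _ hΦ]
      rfl
  refine ⟨υ, fun x hx hxt => ?_⟩
  rw [υ.reach_eq_green_empty (by rintro y rfl; exact hxt)]
  trans green (υ.op ∅) ((fun p : ℕ × M.CanState C E => if p.2 = x then (1 : ℝ≥0∞) else 0) ∘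
    fun h => (h.length, h.last)) (.start N.init)
  · congr 1
  rw [green_comp _ hL]
  unfold green
  refine tsum_congr fun j => ?_
  have h := hiter j (fun p => if p.2 = x then 1 else 0) 0 (fun k => by simp [hx.symm])
  simp only [Policy.mass_zero, ite_mul, one_mul, zero_mul, Finset.sum_ite_eq', Finset.mem_univ,
    if_true, zero_add, mul_ite, mul_one, mul_zero] at h
  exact h

end Project

theorem tsum_level_eq (π : History S A) (f : ℝ≥0∞) :
    ∑' k, (if level M C E π = k then f else 0) = f := by
  rw [tsum_eq_single (level M C E π) (fun k hk => by simp [hk.symm])]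
  simp

variable [Finite A]

theorem Policy.tsum_mass_of_no_level {σ : M.Policy} {u v : History S A → ℝ≥0∞}
    {x : M.CanState C E} (hx : x = .TP ∨ x = .FP) :
    ∑' k, σ.mass C E u v k x = green (σ.op C)
      (σ.exitSum C E u v (M.nextSum C E fun y => if y = x then 1 else 0)) (.start M.init) := by
  have h0 : σ.mass C E u v 0 x = 0 := by
    rw [Policy.mass_zero, if_neg]
    rintro rfl
    exact hx.elim collapse_orig_ne_TP collapse_orig_ne_FP
  rw [tsum_eq_zero_add' ENNReal.summable, h0, zero_add]
  have : σ.exitSum C E u v (M.nextSum C E fun y => if y = x then 1 else 0) = fun π =>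
      ∑' k, (if level M C E π = k then
        σ.exitSum C E u v (M.nextSum C E fun y => if y = x then 1 else 0) π else 0) := by
    funext π
    rw [tsum_level_eq]
  conv_rhs => rw [this]
  rw [(σ.isPosOp_op C).green_tsum]
  refine tsum_congr fun k => ?_
  rw [← Policy.sum_mass_succ]
  simp

/-- Equality of three entries of the confusion matrices suffices. -/
theorem sameConfusion_of_three (hE : ∀ e ∈ E, M.Terminal e) (hC : Disjoint C E)
    {σ : M.Policy} {υ : (M.canonical C E).Policy}
    (h1 : M.tp C E σ = υ.reach {.TP} (.start (M.canonical C E).init))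
    (h2 : M.fp C E σ = υ.reach {.FP} (.start (M.canonical C E).init))
    (h3 : M.fn C E σ = υ.reach {.FN} (.start (M.canonical C E).init)) :
    M.SameConfusion C E σ υ := by
  refine ⟨h1, h2, h3, ?_⟩
  have s1 := confusion_sum σ C E
  have s2 := canonical_outcome_sum hE hC υ (.start (M.canonical C E).init)
  rw [← h1, ← h2, ← h3, ← s1] at s2
  refine (ENNReal.add_right_inj ?_).1 s2.symm
  exact (((le_self_add.trans s1.le)).trans_lt ENNReal.one_lt_top).ne

/-- The weights `u π`, `v π` are chosen so that the randomized fresh action leads to `TP` with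
exactly the residual probability of `E` after `π`. Summing the masses over all levels then returns
the Green functions for tp, fp and fn. -/
theorem exists_canonical_policy (hE : ∀ e ∈ E, M.Terminal e) (hC : Disjoint C E) (σ : M.Policy) :
    ∃ υ : (M.canonical C E).Policy, M.SameConfusion C E σ υ := by
  obtain ⟨-, -, -, -, -, -, hopt⟩ := M.exists_optimal_rules E
  have hcomb : ∀ π : History S A, ∃ u v : ℝ≥0∞, u + v = 1 ∧
      u * M.prMin E π.last + v * M.prMax E π.last = σ.reach E π := fun π =>
    ENNReal.exists_convex_combination (hopt σ π).1 (hopt σ π).2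
      ((M.prMax_le_one E _).trans_lt ENNReal.one_lt_top).ne
  choose u v huv hq using hcomb
  obtain ⟨υ, hυ⟩ := σ.exists_projection (u := u) (v := v) hE hC huv
  have hterm : ∀ x : M.CanState C E, (x = .TP ∨ x = .FP ∨ x = .FN ∨ x = .TN) →
    (M.canonical C E).Terminal x := fun x => (canonical_terminal_iff hE hC).2
  refine ⟨υ, sameConfusion_of_three hE hC ?_ ?_ ?_⟩
  · rw [hυ .TP (by simp) (hterm _ (by simp)), Policy.tsum_mass_of_no_level (Or.inl rfl),
      tp_eq_green σ hE hC]
    congr 1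
    funext π
    by_cases hc : π.last ∈ C
    · rw [Policy.exitSum_of_mem hc]
      simp [hc, hq]
    · rw [Policy.exitSum_of_notMem hc]
      simp [hc, collapse_orig_ne_TP]
  · rw [hυ .FP (by simp) (hterm _ (by simp)), Policy.tsum_mass_of_no_level (Or.inr rfl),
      fp_eq_green σ hE hC]
    congr 1
    funext π
    by_cases hc : π.last ∈ C
    · rw [Policy.exitSum_of_mem hc]
      simp only [hc, if_true, reduceCtorEq, if_false, mul_zero, zero_add, mul_one]
      refine (ENNReal.eq_sub_of_add_eq
        ((σ.reach_le_one E π).trans_lt ENNReal.one_lt_top).ne ?_).symm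
      rw [← hq π]
      conv_rhs => rw [← huv π]
      calc _ = u π * (M.prMin E π.last + (1 - M.prMin E π.last)) +
            v π * (M.prMax E π.last + (1 - M.prMax E π.last)) := by ring
        _ = _ := by rw [add_tsub_cancel_of_le (M.prMin_le_one E _),
            add_tsub_cancel_of_le (M.prMax_le_one E _), mul_one, mul_one]
    · rw [Policy.exitSum_of_notMem hc]
      simp [hc, collapse_orig_ne_FP]
  · rw [hυ .FN (by simp) (hterm _ (by simp)), fn_eq_green σ hE hC]
    have : (fun π : History S A => if π.last ∈ E then (1 : ℝ≥0∞) else 0) =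
        fun π => ∑' k, levelState M C E k .FN π := by
      funext π
      rw [← tsum_level_eq (M := M) (C := C) (E := E) π (if π.last ∈ E then (1 : ℝ≥0∞) else 0)]
      refine tsum_congr fun k => ?_
      simp only [levelState, collapse_eq_FN]
      by_cases h1 : level M C E π = k <;> by_cases h2 : π.last ∈ E <;> simp [h1, h2]
    rw [this, (σ.isPosOp_op C).green_tsum]
    refine tsum_congr fun k => ?_
    rw [Policy.mass_eq_green hE k (by simp) (by simp) (by simp)]

end MDP

namespace MDP

open Classical

/-! ### Policies with memory -/

section Memory

variable {S A Z : Type*} [Fintype S]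

/-- The transition operator, killed in `D`, of the Markov chain on states and memory contents in
which `a s z` is the distribution of the action and `upd s z α t` the distribution of the next
memory content. -/
noncomputable def memOp (M : MDP S A) (a : S → Z → A → ℝ≥0∞) (upd : S → Z → A → S → Z → ℝ≥0∞)
    (D : Set S) (F : S × Z → ℝ≥0∞) (p : S × Z) : ℝ≥0∞ :=
  if p.1 ∈ D then 0 else ∑' α, a p.1 p.2 α * ∑' t, M.P p.1 α t *
    ∑' z, upd p.1 p.2 α t z * F (t, z)

theorem isPosOp_memOp (M : MDP S A) (a : S → Z → A → ℝ≥0∞) (upd : S → Z → A → S → Z → ℝ≥0∞)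
    (D : Set S) : IsPosOp (M.memOp a upd D) := by
  have : M.memOp a upd D = fun F p => ∑' i : A × S × Z,
      (if p.1 ∈ D then 0 else a p.1 p.2 i.1 * (M.P p.1 i.1 i.2.1 *
        upd p.1 p.2 i.1 i.2.1 i.2.2)) * F (i.2.1, i.2.2) := by
    funext F p
    unfold memOp
    split_ifs with h
    · simp
    · simp only [ENNReal.tsum_prod', ← ENNReal.tsum_mul_left, mul_assoc]
  rw [this]
  exact isPosOp_kernel _ _

/-- The joint weights of the finite paths and the memory contents. -/
noncomputable def memWeight (M : MDP S A) (a : S → Z → A → ℝ≥0∞)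
    (upd : S → Z → A → S → Z → ℝ≥0∞) (ι : Z → ℝ≥0∞) : History S A → Z → ℝ≥0∞
  | .start _, z => ι z
  | .snoc π α t, z' => ∑' z, memWeight M a upd ι π z * a π.last z α * M.P π.last α t *
      upd π.last z α t z'

theorem memWeight_snoc (M : MDP S A) (a : S → Z → A → ℝ≥0∞) (upd : S → Z → A → S → Z → ℝ≥0∞)
    (ι : Z → ℝ≥0∞) (π : History S A) (α : A) (t : S) (z' : Z) :
    M.memWeight a upd ι (π.snoc α t) z' = ∑' z, M.memWeight a upd ι π z * a π.last z α *
      M.P π.last α t * upd π.last z α t z' := rfl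

/-- Kuhn's theorem: a policy with memory is realized by a policy. -/
theorem exists_policy_of_memory (M : MDP S A) (a : S → Z → A → ℝ≥0∞)
    (upd : S → Z → A → S → Z → ℝ≥0∞) (ι : Z → ℝ≥0∞)
    (ha1 : ∀ s z, ¬ M.Terminal s → ∑' α, a s z α = 1)
    (ha2 : ∀ s z α, a s z α ≠ 0 → M.Enabled s α)
    (hupd : ∀ s z α t, ∑' z', upd s z α t z' = 1) (hι : ∑' z, ι z = 1) :
    ∃ σ : M.Policy,
      (∀ (D : Set S) (f : S → ℝ≥0∞) (s : S), green (σ.op D) (fun π => f π.last) (.start s) =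
        ∑' z, ι z * green (M.memOp a upd D) (fun p => f p.1) (s, z)) ∧
      ∀ (C E : Set S) (s : S),
        green (σ.op C) (fun π => if π.last ∈ C then σ.reach E π else 0) (.start s) =
          ∑' z, ι z * green (M.memOp a upd C) (fun p => if p.1 ∈ C then
            green (M.memOp a upd E) (fun p => if p.1 ∈ E then 1 else 0) p else 0) (s, z) := by
  set W := M.memWeight a upd ι with hW
  -- `w π` is the total weight of the path and `m π α` its weight together with the next action. The
  -- policy plays the conditional probability `m π α / w π`.
  let w : History S A → ℝ≥0∞ := fun π => ∑' z, W π z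
  let m : History S A → A → ℝ≥0∞ := fun π α => ∑' z, W π z * a π.last z α
  have hw_snoc : ∀ π α t, w (π.snoc α t) = m π α * M.P π.last α t := by
    intro π α t
    simp only [w, m, hW, memWeight_snoc]
    rw [ENNReal.tsum_comm]
    simp only [ENNReal.tsum_mul_left, hupd, mul_one, ENNReal.tsum_mul_right]
  have hm_sum : ∀ π, ¬ M.Terminal π.last → ∑' α, m π α = w π := by
    intro π hπ
    simp only [m, w]
    rw [ENNReal.tsum_comm]
    simp only [ENNReal.tsum_mul_left, ha1 _ _ hπ, mul_one]
  have hm_le : ∀ π α, m π α ≤ w π := by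
    intro π α
    by_cases hπ : M.Terminal π.last
    · have : ∀ z, a π.last z α = 0 := fun z => by
        by_contra h
        exact hπ α (ha2 _ _ _ h)
      simp [m, this]
    · rw [← hm_sum π hπ]
      exact ENNReal.le_tsum α
  have hw1 : ∀ π, w π ≤ 1 := by
    intro π
    induction π with
    | start s => exact hι.le
    | snoc π α t ih =>
      rw [hw_snoc]
      refine mul_le_one' ((hm_le π α).trans ih) ?_
      exact (ENNReal.le_tsum (f := fun t => M.P π.last α t) t).trans (M.tsum_P_le_one _ _)
  have hwt : ∀ π, w π ≠ ⊤ := fun π => ((hw1 π).trans_lt ENNReal.one_lt_top).ne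
  obtain ⟨d, hd⟩ := exists_rule M
  let c : History S A → A → ℝ≥0∞ := fun π α => if w π = 0 then d π.last α else m π α / w π
  have hc : ∀ π α, w π * c π α = m π α := by
    intro π α
    by_cases h : w π = 0
    · rw [h, zero_mul]
      exact (le_antisymm ((hm_le π α).trans h.le) zero_le).symm
    · simp only [c, h, if_false]
      exact ENNReal.mul_div_cancel h (hwt π)
  obtain ⟨σ, hσ⟩ := MDP.exists_policy (M := M) c
    (by
      intro π hπ
      by_cases h : w π = 0
      · simp only [c, h, if_true]
        exact hd.sum _ hπ
      · simp only [c, h, if_false, div_eq_mul_inv]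
        rw [ENNReal.tsum_mul_right, hm_sum π hπ]
        exact ENNReal.mul_inv_cancel h (hwt π))
    (by
      intro π α h
      by_cases h' : w π = 0
      · simp only [c, h', if_true] at h
        exact hd.enabled _ _ h
      · simp only [c, h', if_false] at h
        by_contra hen
        refine h ?_
        have : ∀ z, a π.last z α = 0 := fun z => by
          by_contra h
          exact hen (ha2 _ _ _ h)
        simp [m, this])
  -- `R F G` says that `F` is the conditional expectation of `G` given the path. The relation is
  -- preserved by restriction, by the two operators and hence by their Green operators, which gives
  -- both claims, including the nested one.
  let R : (History S A → ℝ≥0∞) → (S × Z → ℝ≥0∞) → Prop := fun F G =>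
    ∀ π, w π * F π = ∑' z, W π z * G (π.last, z)
  have hR_start : ∀ F G, R F G → ∀ s, F (.start s) = ∑' z, ι z * G (s, z) := by
    intro F G h s
    have h1 : w (.start s) = 1 := hι
    have h := h (.start s)
    rwa [h1, one_mul] at h
  have hR_last : ∀ f : S → ℝ≥0∞, R (fun π => f π.last) (fun p => f p.1) := by
    intro f π
    simp only [w, ENNReal.tsum_mul_right]
  have hR_ite : ∀ (D : Set S) F G, R F G → R (fun π => if π.last ∈ D then F π else 0)
      (fun p => if p.1 ∈ D then G p else 0) := by
    intro D F G h π
    by_cases hD : π.last ∈ D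
    · simp only [hD, if_true, h π]
    · simp [hD]
  have hR_op : ∀ D F G, R F G → R (σ.op D F) (M.memOp a upd D G) := by
    intro D F G h π
    by_cases hD : π.last ∈ D
    · simp [Policy.op, memOp, hD]
    · simp only [Policy.op, memOp, hD, if_false, hσ]
      calc _ = ∑' α, ∑' t, w (π.snoc α t) * F (π.snoc α t) := by
            rw [← ENNReal.tsum_mul_left]
            refine tsum_congr fun α => ?_
            rw [← mul_assoc, hc, ← ENNReal.tsum_mul_left]
            refine tsum_congr fun t => ?_
            rw [hw_snoc, mul_assoc]
        _ = ∑' α, ∑' t, ∑' z, W π z * (a π.last z α * (M.P π.last α t *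
              ∑' z', upd π.last z α t z' * G (t, z'))) := by
            refine tsum_congr fun α => tsum_congr fun t => ?_
            rw [h (π.snoc α t)]
            simp only [hW, memWeight_snoc, History.last_snoc, ← ENNReal.tsum_mul_right,
              ← ENNReal.tsum_mul_left]
            rw [ENNReal.tsum_comm]
            simp only [mul_assoc]
        _ = _ := by
            have hz (z : Z) (H : A → S → ℝ≥0∞) :
                W π z * ∑' α, a π.last z α * ∑' t, M.P π.last α t * H α t =
                  ∑' α, ∑' t, W π z * (a π.last z α * (M.P π.last α t * H α t)) := by
              simp only [ENNReal.tsum_mul_left]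
            simp only [hz]
            exact (ENNReal.tsum_comm.trans (tsum_congr fun α => ENNReal.tsum_comm)).symm
  have hR_green : ∀ D F G, R F G → R (green (σ.op D) F) (green (M.memOp a upd D) G) := by
    intro D F G h π
    have hn : ∀ n, R ((σ.op D)^[n] F) ((M.memOp a upd D)^[n] G) := by
      intro n
      induction n with
      | zero => exact h
      | succ n ih =>
        rw [Function.iterate_succ_apply', Function.iterate_succ_apply']
        exact hR_op _ _ _ ih
    simp only [green, ← ENNReal.tsum_mul_left]
    rw [ENNReal.tsum_comm]
    refine tsum_congr fun n => ?_
    exact hn n π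
  refine ⟨σ, fun D f s => hR_start _ _ (hR_green _ _ _ (hR_last f)) s, fun C E s => ?_⟩
  refine hR_start _ _ (hR_green _ _ _ (hR_ite _ _ _ ?_)) s
  rw [funext (σ.reach_eq_green E)]
  exact hR_green _ _ _ (hR_last (fun s : S => if s ∈ E then (1 : ℝ≥0∞) else 0))

end Memory

end MDP

/-- The minimum principle for one average: no value on the support can exceed a lower bound that the
average attains. The bound is assumed on the support only, because successors outside of an end
component have weight 0. -/
theorem ENNReal.eq_of_tsum_mul_le {Y : Type*} {p f : Y → ℝ≥0∞} {m : ℝ≥0∞} (hp : ∑' y, p y = 1)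
    (hm : m ≠ ⊤) (hf : ∀ y, p y ≠ 0 → m ≤ f y) (h : ∑' y, p y * f y ≤ m) {y : Y} (hy : p y ≠ 0) :
    f y = m := by
  have h1 : ∑' y, p y * f y = m + ∑' y, p y * (f y - m) := by
    calc _ = ∑' y, (p y * m + p y * (f y - m)) := tsum_congr fun y => by
          by_cases hy : p y = 0
          · simp [hy]
          · rw [← mul_add, add_tsub_cancel_of_le (hf y hy)]
      _ = _ := by rw [ENNReal.tsum_add, ENNReal.tsum_mul_right, hp, one_mul]
  rw [h1] at h
  have h2 : ∑' y, p y * (f y - m) = 0 := by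
    have : m + ∑' y, p y * (f y - m) ≤ m + 0 := by rwa [add_zero]
    exact le_antisymm ((ENNReal.add_le_add_iff_left hm).1 this) zero_le
  have h3 := (mul_eq_zero.1 (ENNReal.tsum_eq_zero.1 h2 y)).resolve_left hy
  exact le_antisymm (tsub_eq_zero_iff_le.1 h3) (hf y hy)

/-! ### From the canonical MDP back to the MDP: the lifted policy. -/

namespace MDP

open Classical

section Lift

variable {S A : Type*} [Fintype S] {M : MDP S A} {C E : Set S}

variable (M C E) in
/-- The memory contents of the lifted policies: either a history of the canonical MDP together with
the next action to be simulated, or the choice between a minimizing and a maximizing rule. -/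
abbrev Memo := (History (M.CanState C E) (CanAct S A) × CanAct S A) ⊕ Bool

/-- The fresh action of the first step that is named by a Boolean. -/
def optAct (A : Type*) (b : Bool) : MMAct A := if b then .amax else .amin

/-- The minimal or the maximal probability to reach `E`. -/
noncomputable def prOpt (M : MDP S A) (E : Set S) (b : Bool) (s : S) : ℝ≥0∞ :=
  if b then M.prMax E s else M.prMin E s

/-- A memoryless policy that moves around in every end component, and visits all its states. -/
structure IsNav (M : MDP S A) (C E : Set S) (nav : S → A → ℝ≥0∞) : Prop where
  rule : M.IsRule nav
  ne_zero_iff : ∀ s, (∃ α, (M.minmax C E).Inner (.orig s) (.orig α)) →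
    ∀ α, nav s α ≠ 0 ↔ (M.minmax C E).Inner (.orig s) (.orig α)

theorem IsNav.mem_pairs_iff {nav : S → A → ℝ≥0∞} (hnav : M.IsNav C E nav)
    {e : (M.minmax C E).MEC} {s : S} (hs : .orig s ∈ e.states) (α : A) :
    nav s α ≠ 0 ↔ (.orig s, .orig α) ∈ e.pairs := by
  obtain ⟨β, hβ⟩ := e.isEC.exists_pair hs
  obtain ⟨s', α', -, rfl, -⟩ := mec_pair_orig e hβ
  rw [hnav.ne_zero_iff s ⟨α', e, hβ⟩]
  refine ⟨fun ⟨e', he'⟩ => ?_, fun h => ⟨e, h⟩⟩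
  rwa [MEC.eq_of_mem hs (e'.isEC.mem _ _ he')]

theorem IsNav.mem_states {nav : S → A → ℝ≥0∞} (hnav : M.IsNav C E nav)
    {e : (M.minmax C E).MEC} {s t : S} {α : A} (hs : .orig s ∈ e.states) (hα : nav s α ≠ 0)
    (ht : M.P s α t ≠ 0) : .orig t ∈ e.states := by
  obtain ⟨s', h1, h2, -⟩ := mec_state_orig e hs
  cases h1
  refine e.isEC.closed _ _ ((hnav.mem_pairs_iff hs α).1 hα) _ ?_
  rwa [minmax_P_orig h2]

theorem IsNav.tsum_le {nav : S → A → ℝ≥0∞} (hnav : M.IsNav C E nav) {e : (M.minmax C E).MEC} {s : S}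
    (hs : .orig s ∈ e.states) {f : S → ℝ≥0∞} {c : ℝ≥0∞}
    (hf : ∀ t, .orig t ∈ e.states → f t ≤ c) : ∑' α, nav s α * ∑' t, M.P s α t * f t ≤ c := by
  calc _ ≤ ∑' α, nav s α * c := ENNReal.tsum_le_tsum fun α => by
        by_cases h0 : nav s α = 0
        · simp [h0]
        gcongr
        calc _ ≤ ∑' t, M.P s α t * c := ENNReal.tsum_le_tsum fun t => by
              by_cases h1 : M.P s α t = 0
              · simp [h1]
              gcongr
              exact hf t (hnav.mem_states hs h0 h1)
          _ ≤ c := by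
              rw [ENNReal.tsum_mul_right]
              exact mul_le_of_le_one_left' (M.tsum_P_le_one s α)
    _ ≤ c := by
        rw [ENNReal.tsum_mul_right]
        exact mul_le_of_le_one_left' (hnav.rule.sum_le_one s)

/-- A function that is superharmonic for `nav`, outside of `s₀`, on an end component takes its
minimum on the end component in `s₀`. -/
theorem IsNav.le_of_superharmonic {nav : S → A → ℝ≥0∞} (hnav : M.IsNav C E nav) {e : (M.minmax C E).MEC} {s₀ : S}
    (hs₀ : .orig s₀ ∈ e.states) {f : S → ℝ≥0∞}
    (hf : ∀ s, .orig s ∈ e.states → s ≠ s₀ → ∑' α, nav s α * ∑' t, M.P s α t * f t ≤ f s)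
    {s : S} (hs : .orig s ∈ e.states) : f s₀ ≤ f s := by
  obtain ⟨u, hu, hmin⟩ := Set.exists_min_image {s | MMState.orig s ∈ e.states} f
    (Set.toFinite _) ⟨s₀, hs₀⟩
  refine le_trans ?_ (hmin s hs)
  by_cases htop : f u = ⊤
  · rw [htop]; exact le_top
  -- Along a path from a minimizer `u` to `s₀` the minimal value propagates from each state to its
  -- successor, until the path first meets `s₀`.
  suffices ∀ x, Relation.ReflTransGen
      (fun u v => ∃ α, (u, α) ∈ e.pairs ∧ (M.minmax C E).P u α v ≠ 0) (.orig u) x →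
      f s₀ ≤ f u ∨ ∃ v, x = .orig v ∧ v ≠ s₀ ∧ .orig v ∈ e.states ∧ f v = f u by
    obtain h | ⟨v, hv, hne, -⟩ := this _ (e.isEC.connected _ hu _ hs₀)
    · exact h
    · cases hv
      exact absurd rfl hne
  intro x hx
  induction hx with
  | refl =>
    by_cases h : u = s₀
    · exact Or.inl (h ▸ le_rfl)
    · exact Or.inr ⟨u, rfl, h, hu, rfl⟩
  | tail _ hvw ih =>
    obtain h | ⟨v, rfl, hne, hv, hfv⟩ := ih
    · exact Or.inl h
    obtain ⟨β, hβ, hP⟩ := hvw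
    obtain ⟨s', α, h1, rfl, hC⟩ := mec_pair_orig e hβ
    cases h1
    obtain ⟨w, rfl, -, -⟩ := mec_state_orig e (e.isEC.closed _ _ hβ _ hP)
    rw [minmax_P_orig hC] at hP
    have hα := (hnav.mem_pairs_iff hv α).2 hβ
    have hen : ∀ α, nav v α ≠ 0 → ∑' t, M.P v α t = 1 := fun α h =>
      tsum_P_of_enabled (hnav.rule.enabled _ _ h)
    have hfw : f w = f u := by
      refine ENNReal.eq_of_tsum_mul_le (Y := A × S) (p := fun i => nav v i.1 * M.P v i.1 i.2)
        (f := fun i => f i.2) ?_ htop ?_ ?_ (y := (α, w)) (mul_ne_zero hα hP)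
      · rw [ENNReal.tsum_prod']
        rw [← hnav.rule.sum v fun h => h α (hnav.rule.enabled _ _ hα)]
        refine tsum_congr fun γ => ?_
        dsimp only
        rw [ENNReal.tsum_mul_left]
        by_cases h0 : nav v γ = 0
        · simp [h0]
        · rw [hen γ h0, mul_one]
      · rintro ⟨γ, t⟩ h
        exact hmin t (hnav.mem_states hv (left_ne_zero_of_mul h) (right_ne_zero_of_mul h))
      · rw [← hfv]
        refine le_trans (le_of_eq ?_) (hf v hv hne)
        rw [ENNReal.tsum_prod']
        simp only [mul_assoc, ENNReal.tsum_mul_left]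
    by_cases h : w = s₀
    · exact Or.inl (by rw [← h, hfw])
    · exact Or.inr ⟨w, rfl, h, hnav.mem_states hv hα hP, hfw⟩

/-- The action probabilities of the lifted policy. It moves around in an end component by `nav`
until it is in the state in which the simulated action is available. -/
noncomputable def memAct (M : MDP S A) (C E : Set S) (nav : S → A → ℝ≥0∞)
    (d : Bool → S → A → ℝ≥0∞) (s : S) : Memo M C E → A → ℝ≥0∞
  | .inl m, α => if ∃ α', m.2 = .move (.orig s) (.orig α') ∧ M.Enabled s α' then
      (if m.2 = .move (.orig s) (.orig α) then 1 else 0) else nav s α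
  | .inr b, α => d b s α

/-- A state of `C` has the fresh actions, so it is not terminal, and it lies in no end component;
hence it is neither merged nor removed. -/
theorem collapse_of_mem_C (hC : Disjoint C E) {t : S} (ht : t ∈ C) :
    ∃ k : {s : S // M.Kept C E s}, k.1 = t ∧ M.collapse C E (.orig t) = .keep k := by
  refine ⟨⟨t, Set.disjoint_left.1 hC ht, fun h => (minmax_terminal_orig.1 h).1 ht, ?_⟩, rfl,
    collapse_keep ⟨t, _⟩⟩
  rintro ⟨e, he⟩
  obtain ⟨s', h1, h2, -⟩ := mec_state_orig e he
  cases h1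
  exact h2 ht

theorem tsum_minmax_optAct {s : S} (hs : s ∈ C) (b : Bool) (F : MMState S → ℝ≥0∞) :
    ∑' t, (M.minmax C E).P (.orig s) (optAct A b) t * F t =
      M.prOpt E b s * F .TP + (1 - M.prOpt E b s) * F .FP := by
  cases b
  · exact tsum_minmax_amin hs F
  · exact tsum_minmax_amax hs F

variable {nav : S → A → ℝ≥0∞} {d : Bool → S → A → ℝ≥0∞}

theorem memAct_enabled (hnav : M.IsRule nav) (hd : ∀ b, M.IsRule (d b)) (s : S) (m : Memo M C E)
    (α : A) (h : M.memAct C E nav d s m α ≠ 0) : M.Enabled s α := by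
  rcases m with m | b
  · simp only [memAct] at h
    split_ifs at h with h1 h2
    · obtain ⟨α', h3, h4⟩ := h1
      rw [h2] at h3
      cases h3
      exact h4
    · exact absurd rfl h
    · exact hnav.enabled _ _ h
  · exact (hd b).enabled _ _ h

theorem memAct_move {s : S} {α β : A} (hα : M.Enabled s α)
    (h : History (M.CanState C E) (CanAct S A)) :
    M.memAct C E nav d s (.inl (h, .move (.orig s) (.orig α))) β = if β = α then 1 else 0 := by
  have h1 : ∃ α', (CanAct.move (.orig s) (.orig α) : CanAct S A) = .move (.orig s) (.orig α') ∧
      M.Enabled s α' := ⟨α, rfl, hα⟩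
  refine (if_pos h1).trans ?_
  simp [eq_comm]

theorem tsum_memAct (hnav : M.IsRule nav) (hd : ∀ b, M.IsRule (d b)) (s : S) (m : Memo M C E)
    (h : ¬ M.Terminal s) : ∑' α, M.memAct C E nav d s m α = 1 := by
  rcases m with m | b
  · by_cases h1 : ∃ α', m.2 = .move (.orig s) (.orig α') ∧ M.Enabled s α'
    · obtain ⟨h', a⟩ := m
      obtain ⟨α', rfl, h3⟩ := h1
      simp [memAct_move h3]
    · simp only [memAct, h1, if_false]
      exact hnav.sum s h
  · exact (hd b).sum s h

variable [Finite A]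

/-- The distribution of the next memory content if `t` is entered and `h` is the history of the
simulated policy. -/
noncomputable def Policy.sample (υ : (M.canonical C E).Policy) (t : S)
    (h : History (M.CanState C E) (CanAct S A)) : Memo M C E → ℝ≥0∞
  | .inl m => if t ∈ C then 0 else if m.1 = h then
      -- Nothing is left to simulate after a maximal history; here `tau` is only a filler.
      (if (M.canonical C E).Terminal h.last then (if m.2 = .tau then 1 else 0)
        else υ.act h m.2) else 0
  | .inr b => if t ∈ C then υ.act h (.move (.orig t) (optAct A b)) else 0

/-- The memory update of the lifted policy. -/
noncomputable def Policy.memUpd (υ : (M.canonical C E).Policy) (s : S) :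
    Memo M C E → A → S → Memo M C E → ℝ≥0∞
  | .inl m, α, t, m' => if m.2 = .move (.orig s) (.orig α) then
      υ.sample t (m.1.snoc m.2 (M.collapse C E (.orig t))) m' else if m' = .inl m then 1 else 0
  | .inr b, _, _, m' => if m' = .inr b then 1 else 0

variable {υ : (M.canonical C E).Policy} {h : History (M.CanState C E) (CanAct S A)}

/-- A state of `C` is collapsed with no other state, so the only actions enabled in it are its own
two fresh ones. A Boolean thus records the simulated choice. -/
theorem Policy.tsum_act_of_mem (hC : Disjoint C E) {t : S}
    (ht : t ∈ C) (hh : h.last = M.collapse C E (.orig t)) (G : CanAct S A → ℝ≥0∞) :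
    ∑' a, υ.act h a * G a = ∑' b, υ.act h (.move (.orig t) (optAct A b)) *
      G (.move (.orig t) (optAct A b)) := by
  obtain ⟨k, hk, hkt⟩ := collapse_of_mem_C hC ht
  have hz : ∀ a, υ.act h a ≠ 0 → ∃ b, a = .move (.orig t) (optAct A b) := by
    intro a ha
    have hen := Policy.act_enabled ha
    rw [hh, hkt] at hen
    rcases a with ⟨s, β⟩ | _
    · obtain ⟨h1, -, h3⟩ := canonical_enabled_move.1 hen
      have h1 := eq_of_collapse_keep h1
      rw [hk] at h1
      subst h1
      rcases β with α | _ | _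
      · exact absurd ht (minmax_enabled_orig.1 h3).1
      · exact ⟨false, rfl⟩
      · exact ⟨true, rfl⟩
    · obtain ⟨e, he⟩ := canonical_enabled_tau.1 hen
      cases he
  have hinj : Function.Injective
      (fun b : Bool => (CanAct.move (.orig t) (optAct A b) : CanAct S A)) := by
    intro b b' hb
    cases b <;> cases b' <;> simp [optAct] at hb ⊢
  exact (Function.Injective.tsum_eq hinj (f := fun a => υ.act h a * G a) fun a ha => by
    obtain ⟨b, hb⟩ := hz a (left_ne_zero_of_mul ha)
    exact ⟨b, hb.symm⟩).symm

theorem Policy.tsum_sample_of_mem {t : S} (ht : t ∈ C) (G : Memo M C E → ℝ≥0∞) :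
    ∑' m, υ.sample t h m * G m =
      ∑' b, υ.act h (.move (.orig t) (optAct A b)) * G (.inr b) := by
  rw [ENNReal.tsum_sum_type]
  simp [sample, ht]

theorem Policy.tsum_sample_of_terminal {t : S} (ht : t ∉ C)
    (hh : (M.canonical C E).Terminal h.last) (G : Memo M C E → ℝ≥0∞) :
    ∑' m, υ.sample t h m * G m = G (.inl (h, .tau)) := by
  rw [ENNReal.tsum_sum_type, tsum_eq_single (h, .tau)]
  · simp [sample, ht, hh]
  · rintro ⟨h', a⟩ hm
    by_cases h1 : h' = h
    · have : a ≠ .tau := fun h2 => hm (by rw [h1, h2])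
      simp [sample, hh, this]
    · simp [sample, h1]

theorem Policy.tsum_sample_of_not_terminal {t : S} (ht : t ∉ C)
    (hh : ¬ (M.canonical C E).Terminal h.last) (G : Memo M C E → ℝ≥0∞) :
    ∑' m, υ.sample t h m * G m = ∑' a, υ.act h a * G (.inl (h, a)) := by
  rw [ENNReal.tsum_sum_type, ENNReal.tsum_prod', tsum_eq_single h]
  · simp [sample, ht, hh]
  · intro h' hm
    simp [sample, hm]

theorem canonical_terminal_collapse (hE : ∀ e ∈ E, M.Terminal e) (hC : Disjoint C E) {t : S}
    (h : (M.canonical C E).Terminal (M.collapse C E (.orig t))) : t ∉ C ∧ M.Terminal t :=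
  minmax_terminal_orig.1 (terminal_of_collapse hE hC ((canonical_terminal_iff hE hC).1 h))

theorem Policy.tsum_sample (hE : ∀ e ∈ E, M.Terminal e) (hC : Disjoint C E) {t : S}
    (hh : h.last = M.collapse C E (.orig t)) : ∑' m, υ.sample t h m = 1 := by
  have key : ∑' m, υ.sample t h m * 1 = 1 := by
    by_cases hT : (M.canonical C E).Terminal h.last
    · have ht := (canonical_terminal_collapse hE hC (hh ▸ hT)).1
      rw [Policy.tsum_sample_of_terminal ht hT]
    · by_cases ht : t ∈ C
      · rw [Policy.tsum_sample_of_mem ht, ← Policy.tsum_act_of_mem hC ht hh (fun _ => 1)]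
        simpa using υ.tsum_act hT
      · rw [Policy.tsum_sample_of_not_terminal ht hT]
        simpa using υ.tsum_act hT
  simpa using key

theorem Policy.tsum_memUpd (hE : ∀ e ∈ E, M.Terminal e) (hC : Disjoint C E) (s : S)
    (m : Memo M C E) (α : A) (t : S) : ∑' m', υ.memUpd s m α t m' = 1 := by
  rcases m with m | b
  · by_cases hm : m.2 = .move (.orig s) (.orig α)
    · simp only [memUpd, hm, if_true]
      exact Policy.tsum_sample hE hC rfl
    · simp [memUpd, hm]
  · simp [memUpd]

/-- The uniform distribution on the inner actions of a state has the required support; states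
without inner actions use an arbitrary rule. -/
theorem exists_nav (M : MDP S A) (C E : Set S) : ∃ nav, M.IsNav C E nav := by
  have := Fintype.ofFinite A
  obtain ⟨d, hd⟩ := exists_rule M
  let I : S → Finset A := fun s =>
    Finset.univ.filter fun α => (M.minmax C E).Inner (.orig s) (.orig α)
  have hI : ∀ s α, α ∈ I s ↔ (M.minmax C E).Inner (.orig s) (.orig α) := by simp [I]
  refine ⟨fun s α => if h : (I s).Nonempty then PMF.uniformOfFinset (I s) h α else d s α,
    ⟨fun s hs => ?_, fun s α h => ?_⟩, ?_⟩
  · by_cases h : (I s).Nonempty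
    · simp only [h, dif_pos]
      exact PMF.tsum_coe _
    · simp only [h, dif_neg, not_false_eq_true]
      exact hd.sum s hs
  · by_cases h' : (I s).Nonempty
    · simp only [h', dif_pos] at h
      have h := (PMF.mem_support_iff _ _).2 h
      rw [PMF.mem_support_uniformOfFinset_iff, hI] at h
      obtain ⟨e, he⟩ := h
      exact (minmax_enabled_orig.1 (e.isEC.enabled _ _ he)).2
    · simp only [h', dif_neg, not_false_eq_true] at h
      exact hd.enabled _ _ h
  · rintro s ⟨β, hβ⟩ α
    have h : (I s).Nonempty := ⟨β, (hI s β).2 hβ⟩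
    simp only [h, dif_pos]
    rw [← PMF.mem_support_iff, PMF.mem_support_uniformOfFinset_iff, hI]

/-- In the state in which the simulated action is available, this action is taken. -/
theorem memOp_move {s : S} {α : A} (hs : s ∉ C) (hα : M.Enabled s α) (F : S × Memo M C E → ℝ≥0∞) :
    M.memOp (M.memAct C E nav d) υ.memUpd C F (s, .inl (h, .move (.orig s) (.orig α))) =
      ∑' t, M.P s α t * ∑' m, υ.sample t
        (h.snoc (.move (.orig s) (.orig α)) (M.collapse C E (.orig t))) m * F (t, m) := by
  simp only [memOp, hs, if_false, memAct_move hα]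
  rw [tsum_eq_single α (fun β hβ => by simp [hβ])]
  simp [Policy.memUpd]

/-- Otherwise, the lifted policy moves around. -/
theorem memOp_nav (hnav : M.IsRule nav) {s : S} {a : CanAct S A} (hs : s ∉ C)
    (ha : ¬ ∃ α', a = .move (.orig s) (.orig α') ∧ M.Enabled s α')
    (F : S × Memo M C E → ℝ≥0∞) :
    M.memOp (M.memAct C E nav d) υ.memUpd C F (s, .inl (h, a)) =
      ∑' α, nav s α * ∑' t, M.P s α t * F (t, .inl (h, a)) := by
  simp only [memOp, hs, if_false]
  refine tsum_congr fun α => ?_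
  simp only [memAct, ha, if_false]
  by_cases h0 : nav s α = 0
  · simp [h0]
  · have h1 : a ≠ .move (.orig s) (.orig α) := fun h => ha ⟨α, h, hnav.enabled _ _ h0⟩
    simp only [Policy.memUpd, h1, if_false]
    congr 1
    refine tsum_congr fun t => ?_
    rw [tsum_eq_single (.inl (h, a))]
    · simp
    · intro m hm; simp [hm]

end Lift

end MDP

/-! ### Expected rewards under the lifted policy. -/

namespace MDP

open Classical

section Value

variable {S A : Type*} [Fintype S] [Finite A] {M : MDP S A} {C E : Set S}
  {υ : (M.canonical C E).Policy} {h : History (M.CanState C E) (CanAct S A)}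
  {nav : S → A → ℝ≥0∞} {d : Bool → S → A → ℝ≥0∞}

/-- The expected value of `V` at the next history if the canonical MDP takes the action `a`. -/
noncomputable def stepValue (M : MDP S A) (C E : Set S)
    (V : History (M.CanState C E) (CanAct S A) → ℝ≥0∞)
    (h : History (M.CanState C E) (CanAct S A)) (a : CanAct S A) : ℝ≥0∞ :=
  ∑' y, (M.canonical C E).P h.last a y * V (h.snoc a y)

theorem stepValue_move {V : History (M.CanState C E) (CanAct S A) → ℝ≥0∞} {s : S} {α : A}
    (hα : (M.canonical C E).Enabled h.last (.move (.orig s) (.orig α))) :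
    M.stepValue C E V h (.move (.orig s) (.orig α)) =
      ∑' t, M.P s α t *
        V (h.snoc (.move (.orig s) (.orig α)) (M.collapse C E (.orig t))) := by
  obtain ⟨h1, h2, h3⟩ := canonical_enabled_move.1 hα
  unfold stepValue
  rw [tsum_canonical_move h1 h2 (fun y => V (h.snoc (.move (.orig s) (.orig α)) y)),
    tsum_minmax_orig (minmax_enabled_orig.1 h3).1]

theorem stepValue_optAct {V : History (M.CanState C E) (CanAct S A) → ℝ≥0∞}
    {s : S} (hs : s ∈ C) (hh : h.last = M.collapse C E (.orig s)) (b : Bool) :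
    M.stepValue C E V h (.move (.orig s) (optAct A b)) =
      M.prOpt E b s * V (h.snoc (.move (.orig s) (optAct A b)) .TP) +
        (1 - M.prOpt E b s) * V (h.snoc (.move (.orig s) (optAct A b)) .FP) := by
  unfold stepValue
  rw [tsum_canonical_move hh.symm (not_inner_of_mem hs _)
    (fun y => V (h.snoc (.move (.orig s) (optAct A b)) y)), tsum_minmax_optAct hs]
  rfl

theorem stepValue_tau {V : History (M.CanState C E) (CanAct S A) → ℝ≥0∞}
    (hα : (M.canonical C E).Enabled h.last .tau) :
    M.stepValue C E V h .tau = V (h.snoc .tau .TN) := by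
  obtain ⟨e, he⟩ := canonical_enabled_tau.1 hα
  unfold stepValue
  rw [he]
  exact tsum_canonical_tau e (fun y => V (h.snoc .tau y))

theorem Policy.op_empty_eq (V : History (M.CanState C E) (CanAct S A) → ℝ≥0∞) :
    υ.op ∅ V h = ∑' a, υ.act h a * M.stepValue C E V h a := by
  simp [op, stepValue]

/-- If an action that leaves an end component is simulated in `s`, and this is not an action of
`s`, then `s` belongs to the end component. -/
theorem exists_mec_of_enabled (hE : ∀ e ∈ E, M.Terminal e) (hC : Disjoint C E) {s : S} {a : CanAct S A} (hs : s ∉ C)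
    (ha : (M.canonical C E).Enabled (M.collapse C E (.orig s)) a)
    (hn : ¬ ∃ α', a = .move (.orig s) (.orig α') ∧ M.Enabled s α') :
    ∃ e : (M.minmax C E).MEC, .orig s ∈ e.states := by
  rcases a with ⟨u, β⟩ | _
  · obtain ⟨h1, h2, h3⟩ := canonical_enabled_move.1 ha
    generalize hx : M.collapse C E (.orig s) = x at h1
    have hne : u ≠ .orig s := by
      rintro rfl
      rcases β with α | _ | _
      · exact hn ⟨α, rfl, (minmax_enabled_orig.1 h3).2⟩
      · exact hs (minmax_enabled_amin.1 h3)
      · exact hs (minmax_enabled_amax.1 h3)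
    rcases x with k | e | _ | _ | _ | _
    · exact absurd ((eq_of_collapse_keep h1).trans (eq_of_collapse_keep hx).symm) hne
    · exact ⟨e, mem_of_collapse_mec hx⟩
    all_goals exact absurd h3 (terminal_of_collapse hE hC (by simp [h1]) _)
  · obtain ⟨e, he⟩ := canonical_enabled_tau.1 ha
    exact ⟨e, mem_of_collapse_mec he⟩

variable {φ : M.CanState C E → ℝ≥0∞} {F : S × Memo M C E → ℝ≥0∞}

/-- The expected value of the terminal reward `φ` under `υ`. -/
noncomputable def Policy.reward (υ : (M.canonical C E).Policy) (φ : M.CanState C E → ℝ≥0∞)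
    (h : History (M.CanState C E) (CanAct S A)) : ℝ≥0∞ :=
  green (υ.op ∅) (fun h => φ h.last) h

theorem Policy.reward_eq : υ.reward φ h = φ h.last +
    ∑' a, υ.act h a * M.stepValue C E (υ.reward φ) h a := by
  rw [← Policy.op_empty_eq]
  exact (υ.isPosOp_op ∅).green_eq _ _

theorem Policy.reward_of_terminal (hh : (M.canonical C E).Terminal h.last) :
    υ.reward φ h = φ h.last := by
  rw [reward_eq]
  simp [υ.act_terminal hh]

variable (M C E) in
/-- The reward `F` on states and memory contents corresponds to the terminal reward `φ` of the
canonical MDP. -/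
structure RewardMatch (φ : M.CanState C E → ℝ≥0∞) (F : S × Memo M C E → ℝ≥0∞) : Prop where
  not_terminal : ∀ x, ¬ (M.canonical C E).Terminal x → φ x = 0
  tn : φ .TN = 0
  mem_C : ∀ s ∈ C, ∀ b, F (s, .inr b) = M.prOpt E b s * φ .TP + (1 - M.prOpt E b s) * φ .FP
  mem_E : ∀ s ∈ E, ∀ m, F (s, m) = φ .FN
  zero : ∀ s, s ∉ C → s ∉ E → ∀ m, F (s, m) = 0

theorem canonical_terminal_TP (hE : ∀ e ∈ E, M.Terminal e) (hC : Disjoint C E) :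
    (M.canonical C E).Terminal .TP := (canonical_terminal_iff hE hC).2 (by simp)

theorem canonical_terminal_FP (hE : ∀ e ∈ E, M.Terminal e) (hC : Disjoint C E) :
    (M.canonical C E).Terminal .FP := (canonical_terminal_iff hE hC).2 (by simp)

/-- A bound for the expected reward of the lifted policy. -/
noncomputable def Policy.liftBound (υ : (M.canonical C E).Policy) (φ : M.CanState C E → ℝ≥0∞) :
    S × Memo M C E → ℝ≥0∞
  -- The value `⊤` stands at pairs of state and memory that the simulation never samples; it makes
  -- the supersolution inequality trivial there.
  | (s, .inr b) => if s ∈ C then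
      M.prOpt E b s * φ .TP + (1 - M.prOpt E b s) * φ .FP else ⊤
  | (s, .inl m) => if s ∉ C ∧ M.collapse C E (.orig s) = m.1.last then
      if (M.canonical C E).Terminal m.1.last then φ m.1.last
      else if (M.canonical C E).Enabled m.1.last m.2 then
        M.stepValue C E (υ.reward φ) m.1 m.2
      else ⊤ else ⊤

theorem Policy.tsum_sample_liftBound (hE : ∀ e ∈ E, M.Terminal e) (hC : Disjoint C E)
    (hφ : M.RewardMatch C E φ F) {t : S} (hh : h.last = M.collapse C E (.orig t)) :
    ∑' m, υ.sample t h m * υ.liftBound φ (t, m) = υ.reward φ h := by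
  by_cases hT : (M.canonical C E).Terminal h.last
  · have ht := (canonical_terminal_collapse hE hC (hh ▸ hT)).1
    rw [Policy.tsum_sample_of_terminal ht hT, reward_of_terminal hT]
    simp [liftBound, ht, hh.symm, hT]
  rw [reward_eq, hφ.not_terminal _ hT, zero_add]
  by_cases ht : t ∈ C
  · rw [Policy.tsum_sample_of_mem ht, Policy.tsum_act_of_mem hC ht hh]
    refine tsum_congr fun b => ?_
    rw [stepValue_optAct ht hh, reward_of_terminal (canonical_terminal_TP hE hC),
      reward_of_terminal (canonical_terminal_FP hE hC)]
    simp [liftBound, ht, History.last_snoc]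
  · rw [Policy.tsum_sample_of_not_terminal ht hT]
    refine tsum_congr fun a => ?_
    by_cases ha : υ.act h a = 0
    · simp [ha]
    · simp [liftBound, ht, hh.symm, hT, Policy.act_enabled ha]

/-- `liftBound` is a supersolution: when the simulated action is taken it satisfies an equation, and
while the policy wanders with fixed memory it is constant on the end component. -/
theorem Policy.green_memOp_le (hE : ∀ e ∈ E, M.Terminal e) (hC : Disjoint C E)
    (hnav : M.IsNav C E nav) (hφ : M.RewardMatch C E φ F) (p : S × Memo M C E) :
    green (M.memOp (M.memAct C E nav d) υ.memUpd C) F p ≤ υ.liftBound φ p := by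
  refine (M.isPosOp_memOp _ _ _).green_le (fun p => ?_) p
  obtain ⟨s, ⟨h, a⟩ | b⟩ := p
  · by_cases hs : s ∉ C ∧ M.collapse C E (.orig s) = h.last
    swap
    · simp only [liftBound, hs, if_false, le_top]
    have hb : υ.liftBound φ (s, .inl (h, a)) = if (M.canonical C E).Terminal h.last then φ h.last
        else if (M.canonical C E).Enabled h.last a then
          M.stepValue C E (υ.reward φ) h a else ⊤ := if_pos hs
    obtain ⟨hs, hh⟩ := hs
    by_cases hT : (M.canonical C E).Terminal h.last
    · have hMT := (canonical_terminal_collapse hE hC (hh ▸ hT)).2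
      have hz : ∀ α t, M.P s α t = 0 := fun α t => P_of_not_enabled (hMT α) t
      have : M.memOp (M.memAct C E nav d) υ.memUpd C (υ.liftBound φ) (s, .inl (h, a)) = 0 := by
        simp [memOp, hz]
      rw [this, add_zero, hb, if_pos hT]
      by_cases hsE : s ∈ E
      · rw [hφ.mem_E s hsE, ← hh, collapse_of_mem hsE]
      · rw [hφ.zero s hs hsE]
        exact zero_le
    rw [hb, if_neg hT]
    by_cases ha : (M.canonical C E).Enabled h.last a
    swap
    · simp [ha]
    have hsE : s ∉ E := fun hsE => hT <| by
      rw [← hh, collapse_of_mem hsE]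
      exact (canonical_terminal_iff hE hC).2 (by simp)
    rw [if_pos ha, hφ.zero s hs hsE, zero_add]
    by_cases hm : ∃ α', a = .move (.orig s) (.orig α') ∧ M.Enabled s α'
    · obtain ⟨α', rfl, hα'⟩ := hm
      rw [memOp_move hs hα', stepValue_move ha]
      refine le_of_eq (tsum_congr fun t => ?_)
      rw [Policy.tsum_sample_liftBound hE hC hφ rfl]
    · obtain ⟨e, he⟩ := exists_mec_of_enabled hE hC hs (hh ▸ ha) hm
      rw [memOp_nav hnav.rule hs hm]
      refine hnav.tsum_le he fun t ht => ?_
      obtain ⟨t', h1, htC, -⟩ := mec_state_orig e ht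
      cases h1
      have hht : M.collapse C E (.orig t) = h.last := by
        rw [← hh, collapse_mec hE ht, collapse_mec hE he]
      simp [liftBound, htC, hht, hT, ha]
  · by_cases hs : s ∈ C
    · simp [liftBound, hs, memOp, hφ.mem_C]
    · simp [liftBound, hs]

/-- Induction on the number of steps of `υ`. One simulated step may need unboundedly many real ones;
the minimum principle bridges this without a separate proof that the wandering policy reaches its
target almost surely. -/
theorem Policy.sum_iterate_le_tsum_sample (hE : ∀ e ∈ E, M.Terminal e) (hC : Disjoint C E)
    (hnav : M.IsNav C E nav) (hφ : M.RewardMatch C E φ F) (n : ℕ) {t : S}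
    (hh : h.last = M.collapse C E (.orig t)) :
    (∑ i ∈ Finset.range n, (υ.op ∅)^[i] (fun h => φ h.last)) h ≤
      ∑' m, υ.sample t h m * green (M.memOp (M.memAct C E nav d) υ.memUpd C) F (t, m) := by
  have hpos := M.isPosOp_memOp (M.memAct C E nav d) υ.memUpd C
  set val := green (M.memOp (M.memAct C E nav d) υ.memUpd C) F with hval
  have hval_eq : ∀ p, val p = F p + M.memOp (M.memAct C E nav d) υ.memUpd C val p :=
    hpos.green_eq F
  induction n generalizing h t with
  | zero => simp
  | succ n ih =>
    set L := ∑ i ∈ Finset.range n, (υ.op ∅)^[i] (fun h => φ h.last) with hL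
    have hLt : ∀ h, (M.canonical C E).Terminal h.last → L h ≤ φ h.last := fun h hT => by
      rw [← Policy.reward_of_terminal (υ := υ) (φ := φ) hT, reward, green_eq_iSup]
      exact le_iSup (fun n => (∑ i ∈ Finset.range n, (υ.op ∅)^[i] (fun h => φ h.last)) h) n
    rw [(υ.isPosOp_op ∅).sum_iterate_succ, Pi.add_apply, ← hL, Policy.op_empty_eq]
    by_cases hT : (M.canonical C E).Terminal h.last
    · obtain ⟨htC, htT⟩ := canonical_terminal_collapse hE hC (hh ▸ hT)
      rw [Policy.tsum_sample_of_terminal htC hT, hval_eq]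
      simp only [υ.act_terminal hT, zero_mul, tsum_zero, add_zero]
      refine le_trans ?_ le_self_add
      by_cases htE : t ∈ E
      · rw [hφ.mem_E t htE, hh, collapse_of_mem htE]
      · rw [hh, collapse_of_terminal htE htC htT, hφ.tn]
        exact zero_le
    rw [hφ.not_terminal _ hT, zero_add]
    by_cases ht : t ∈ C
    · rw [Policy.tsum_sample_of_mem ht, Policy.tsum_act_of_mem hC ht hh]
      refine ENNReal.tsum_le_tsum fun b => ?_
      gcongr
      rw [stepValue_optAct ht hh, hval_eq]
      refine le_trans ?_ le_self_add
      rw [hφ.mem_C t ht]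
      gcongr
      · exact hLt _ (canonical_terminal_TP hE hC)
      · exact hLt _ (canonical_terminal_FP hE hC)
    rw [Policy.tsum_sample_of_not_terminal ht hT]
    refine ENNReal.tsum_le_tsum fun a => ?_
    by_cases ha : υ.act h a = 0
    · simp [ha]
    have ha := Policy.act_enabled ha
    gcongr
    rcases a with ⟨u, β⟩ | _
    · obtain ⟨h1, h2, h3⟩ := canonical_enabled_move.1 ha
      rcases u with s | _ | _
      swap; · exact absurd h3 (minmax_terminal_TP _)
      swap; · exact absurd h3 (minmax_terminal_FP _)
      have hsC : s ∉ C := fun hsC => by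
        obtain ⟨k, hk, hks⟩ := collapse_of_mem_C hC hsC
        rw [h1, hh] at hks
        have := eq_of_collapse_keep hks
        rw [hk] at this
        cases this
        exact ht hsC
      obtain ⟨α, rfl⟩ : ∃ α, β = .orig α := by
        rcases β with α | _ | _
        · exact ⟨α, rfl⟩
        · exact absurd (minmax_enabled_amin.1 h3) hsC
        · exact absurd (minmax_enabled_amax.1 h3) hsC
      have hα := (minmax_enabled_orig.1 h3).2
      rw [stepValue_move ha]
      -- In `s` itself the stored action is taken at once, so the induction hypothesis applies to
      -- its successors.
      have hs : ∑' t, M.P s α t * L (h.snoc (.move (.orig s) (.orig α))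
          (M.collapse C E (.orig t))) ≤ val (s, .inl (h, .move (.orig s) (.orig α))) := by
        rw [hval_eq, memOp_move hsC hα]
        refine le_trans ?_ le_add_self
        refine ENNReal.tsum_le_tsum fun t' => ?_
        gcongr
        exact ih rfl
      refine hs.trans ?_
      by_cases hst : s = t
      · rw [hst]
      obtain ⟨e, he⟩ := exists_mec_of_enabled hE hC ht (hh ▸ ha) (by
        rintro ⟨α', hα', -⟩
        cases hα'
        exact hst rfl)
      have hes : .orig s ∈ e.states := mem_of_collapse_mec (by
        rw [h1, hh, collapse_mec hE he])
      -- With fixed memory, `val` is superharmonic for `nav` away from `s`, so its value in `t` is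
      -- at least its value in `s`.
      refine hnav.le_of_superharmonic
        (f := fun t => val (t, .inl (h, .move (.orig s) (.orig α)))) hes (fun v hv hne => ?_) he
      obtain ⟨v', hv', hvC, -⟩ := mec_state_orig e hv
      cases hv'
      rw [hval_eq (v, _), memOp_nav hnav.rule hvC (by
        rintro ⟨α', hα', -⟩
        cases hα'
        exact hne rfl)]
      exact le_add_self
    · rw [stepValue_tau ha]
      -- `tau` leads to `TN`, which carries no reward, so wandering forever loses nothing.
      refine (hLt _ ((canonical_terminal_iff hE hC).2 (by simp [History.last_snoc]))).trans ?_
      rw [History.last_snoc, hφ.tn]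
      exact zero_le

/-- The lifted policy earns the same expected reward as `υ`. -/
theorem Policy.tsum_sample_green (hE : ∀ e ∈ E, M.Terminal e) (hC : Disjoint C E)
    (hnav : M.IsNav C E nav) (hφ : M.RewardMatch C E φ F) {t : S}
    (hh : h.last = M.collapse C E (.orig t)) :
    ∑' m, υ.sample t h m * green (M.memOp (M.memAct C E nav d) υ.memUpd C) F (t, m) =
      υ.reward φ h := by
  refine le_antisymm ?_ ?_
  · rw [← Policy.tsum_sample_liftBound hE hC hφ hh]
    exact ENNReal.tsum_le_tsum fun m =>
      mul_le_mul_right (Policy.green_memOp_le hE hC hnav hφ _) _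
  · rw [reward, green_eq_iSup]
    exact iSup_le fun n => Policy.sum_iterate_le_tsum_sample hE hC hnav hφ n hh

theorem Policy.reward_singleton {x : M.CanState C E} (hx : (M.canonical C E).Terminal x) :
    υ.reward (fun y => if y = x then 1 else 0) h = υ.reach {x} h := by
  rw [υ.reach_eq_green_empty (by rintro y rfl; exact hx)]
  simp only [Set.mem_singleton_iff]
  rfl

theorem exists_lifted_policy (hE : ∀ e ∈ E, M.Terminal e) (hC : Disjoint C E)
    (υ : (M.canonical C E).Policy) : ∃ σ : M.Policy, M.SameConfusion C E σ υ := by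
  obtain ⟨dmin, dmax, hmin, hmax, hpmin, hpmax, -⟩ := M.exists_optimal_rules E
  obtain ⟨nav, hnav⟩ := M.exists_nav C E
  let d : Bool → S → A → ℝ≥0∞ := fun b => if b then dmax else dmin
  have hd : ∀ b, M.IsRule (d b) := by rintro (_ | _) <;> assumption
  have hp : ∀ b s, M.value (d b) E s = M.prOpt E b s := by
    rintro (_ | _) s
    · exact (hpmin s).symm
    · exact (hpmax s).symm
  obtain ⟨σ, hσ, hσE⟩ := M.exists_policy_of_memory (M.memAct C E nav d) υ.memUpd
    (υ.sample M.init (.start (M.canonical C E).init)) (tsum_memAct hnav.rule hd)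
    (memAct_enabled hnav.rule hd) (Policy.tsum_memUpd hE hC) (Policy.tsum_sample hE hC rfl)
  -- A Boolean memory content never changes again, so from then on the chain is that of the rule `d
  -- b`, started in `s`.
  have hval : ∀ s b, green (M.memOp (M.memAct C E nav d) υ.memUpd E)
      (fun p => if p.1 ∈ E then 1 else 0) (s, .inr b) = M.prOpt E b s := by
    intro s b
    rw [← hp, value]
    refine (green_comp (fun s : S => (s, (.inr b : Memo M C E))) (fun F => ?_)
      (fun p => if p.1 ∈ E then 1 else 0) s).symm
    funext s
    simp only [ruleOp, memOp, Function.comp_apply, memAct, Policy.memUpd]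
    split_ifs
    · rfl
    refine tsum_congr fun α => ?_
    congr 1
    refine tsum_congr fun t => ?_
    rw [tsum_eq_single (.inr b) (fun m hm => by simp [hm])]
    simp
  have hne : ∀ s ∈ E, s ∉ C := fun s hsE hsC => Set.disjoint_left.1 hC hsC hsE
  have hterm : ∀ x : M.CanState C E, (x = .TP ∨ x = .FP ∨ x = .FN ∨ x = .TN) →
    (M.canonical C E).Terminal x := fun x => (canonical_terminal_iff hE hC).2
  have key : ∀ (φ : M.CanState C E → ℝ≥0∞) (F : S × Memo M C E → ℝ≥0∞), M.RewardMatch C E φ F →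
      ∑' m, υ.sample M.init (.start (M.canonical C E).init) m *
        green (M.memOp (M.memAct C E nav d) υ.memUpd C) F (M.init, m) =
        υ.reward φ (.start (M.canonical C E).init) := fun φ F hφ =>
    Policy.tsum_sample_green hE hC hnav hφ rfl
  have hx0 : ∀ x : M.CanState C E, (x = .TP ∨ x = .FP ∨ x = .FN ∨ x = .TN) →
      ∀ y, ¬ (M.canonical C E).Terminal y → (if y = x then (1 : ℝ≥0∞) else 0) = 0 := by
    intro x hx y hy
    refine if_neg ?_
    rintro rfl
    exact hy (hterm _ hx)
  have htp : M.tp C E σ = υ.reach {.TP} (.start (M.canonical C E).init) := by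
    rw [tp_eq_green σ hE hC, hσE, ← Policy.reward_singleton (hterm _ (by simp))]
    refine key _ _ ⟨hx0 _ (by simp), by simp, fun s hs b => ?_, fun s hs m => ?_, fun s h1 h2 m => ?_⟩
    · simp [hs, hval]
    · simp [hne s hs]
    · simp [h1]
  have hfn : M.fn C E σ = υ.reach {.FN} (.start (M.canonical C E).init) := by
    rw [fn_eq_green σ hE hC, hσ C (fun s => if s ∈ E then 1 else 0),
      ← Policy.reward_singleton (hterm _ (by simp))]
    refine key _ _ ⟨hx0 _ (by simp), by simp, fun s hs b => ?_, fun s hs m => ?_, fun s h1 h2 m => ?_⟩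
    · simp [Set.disjoint_left.1 hC hs]
    · simp [hs]
    · simp [h2]
  refine ⟨σ, sameConfusion_of_three hE hC htp ?_ hfn⟩
  have hfin : M.tp C E σ ≠ ⊤ := measure_ne_top (M.Pr σ M.init) _
  refine (ENNReal.add_right_inj hfin).1 ?_
  have h1 : M.tp C E σ + M.fp C E σ = σ.reach C (.start M.init) :=
    measure_inter_add_sdiff (ev C) (measurableSet_ev E)
  rw [h1, htp, σ.reach_eq_green, hσ C (fun s => if s ∈ C then 1 else 0),
    ← Policy.reward_singleton (hterm _ (by simp)), ← Policy.reward_singleton (hterm _ (by simp)),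
    Policy.reward, Policy.reward, ← (υ.isPosOp_op ∅).green_add]
  -- For fp the probability of reaching `C` is compared with the reward 1 in both `TP` and `FP`;
  -- subtracting tp, which is already matched and finite, leaves fp.
  refine key (fun y => (if y = .TP then 1 else 0) + if y = .FP then 1 else 0) _
    ⟨fun y hy => ?_, by simp, fun s hs b => ?_, fun s hs m => ?_, fun s h1 h2 m => ?_⟩
  · rw [hx0 .TP (by simp) y hy, hx0 .FP (by simp) y hy, add_zero]
  · have : M.prOpt E b s ≤ 1 := by
      cases b
      · exact M.prMin_le_one E s
      · exact M.prMax_le_one E s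
    simp [hs, add_tsub_cancel_of_le this]
  · simp [hne s hs]
  · simp [h1]

end Value

end MDP

theorem lemma13 {S A : Type*} [Fintype S] [Finite A] (M : MDP S A) (C E : Set S)
    (hE : ∀ e ∈ E, M.Terminal e) (hC : Disjoint C E) :
    (∀ σ : M.Policy, ∃ υ : (M.canonical C E).Policy, M.SameConfusion C E σ υ) ∧
    (∀ υ : (M.canonical C E).Policy, ∃ σ : M.Policy, M.SameConfusion C E σ υ) :=
  ⟨MDP.exists_canonical_policy hE hC, MDP.exists_lifted_policy hE hC⟩
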